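/- **Conventions.** Manifolds are smooth, Hausdorff and second countable; Lorentzian metrics have signature $(-,+,\dots,+)$. For $k\in\mathbb N_0$, $C^{k,0}_{\mathrm{loc}}$ means $C^k$, and $C^{k,1}_{\mathrm{loc}}$ means $C^k$ with locally Lipschitz derivatives of order $k$. A map defined on a subset $A\subseteq\mathbb R^{n}$ is of class $C^{k,a}_{\mathrm{loc}}$ if it agrees on $A$ with a map of this class defined on an open neighbourhood of $A$. A $C^{k,a}_{\mathrm{loc}}$-extension of a Lorentzian manifold $(M,g)$ is a smooth isometric embedding $\iota:M\hookrightarrow\tilde M$ into a Lorentzian manifold $(\tilde M,\tilde g)$ of the same dimension, with $\tilde g$ of class $C^{k,a}_{\mathrm{loc}}$ and $\partial\iota(M)\neq\emptyset$. If $(M,g)$ is time-oriented, the future boundary $\partial^+\iota(M)$ is the set of points $\tilde p\in\partial\iota(M)$ for which there is a smooth timelike curve $\tilde\gamma:[-1,0]\to\tilde M$ with $\tilde\gamma(0)=\tilde p$, $\tilde\gamma([-1,0))\subseteq\iota(M)$ and $\iota^{-1}\circ\tilde\gamma|_{[-1,0)}$ future directed. A future boundary chart around $\tilde p\in\partial^+\iota(M)$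 is a smooth chart $\tilde\varphi:\tilde U\to(-\varepsilon_0,\varepsilon_0)\times(-\varepsilon_1,\varepsilon_1)^d$ (onto, $\varepsilon_0,\varepsilon_1>0$) with centre $\tilde p$, i.e. $\tilde\varphi(\tilde p)=0$, such that $|\tilde g_{\mu\nu}-m_{\mu\nu}|<\delta$ on $\tilde U$ for some $\delta>0$, where $m=\mathrm{diag}(-1,1,\dots,1)$, together with a Lipschitz function $f:(-\varepsilon_1,\varepsilon_1)^d\to(-\varepsilon_0,\varepsilon_0)$ such that, with coordinates $(x_0,\underline x)$, the set $\tilde U_<=\{x_0<f(\underline x)\}$ lies in $\iota(I^+(\Sigma,M))$ for some Cauchy hypersurface $\Sigma$ of $M$, and the graph $\{x_0=f(\underline x)\}$ lies in $\partial^+\iota(M)$ and is achronal in $\tilde U$ with respect to smooth timelike curves. Put $\tilde U_\le=\{x_0\le f(\underline x)\}$, and for $\tilde W\subseteq\tilde U$ put $\tilde W_<=\tilde W\cap\tilde U_<$ and $\tilde W_\le=\tilde W\cap\tilde U_\le$. **Lemma.** Let $(M,g)$ be a smooth, time-oriented, globally hyperbolic Lorentzian manifold of dimension $d+1$, and for $i=1,2$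 let $\iota_i:M\hookrightarrow\tilde M_i$ be a $C^{k_i,a_i}_{\mathrm{loc}}$-extension, with $k_i\in\mathbb N_0$ and $a_i\in\{0,1\}$. Let $\mathrm{id}=\iota_2\circ\iota_1^{-1}:\iota_1(M)\to\iota_2(M)$ be the identification map. Let $\tilde\varphi_i:\tilde U_i\to(-\varepsilon_{0,i},\varepsilon_{0,i})\times(-\varepsilon_{1,i},\varepsilon_{1,i})^d$ be future boundary charts, and let $\tilde W_i\subseteq\tilde U_i$ be open neighbourhoods of their centres such that $\mathrm{id}|_{\tilde W_{1,<}}:\tilde W_{1,<}\to\tilde W_{2,<}$ is a diffeomorphism and extends to a map $\mathrm{id}|_{\tilde W_{1,\le}}:\tilde W_{1,\le}\to\tilde W_{2,\le}$ that is of class $C^1$ in the coordinates $\tilde\varphi_1,\tilde\varphi_2$. Then $\mathrm{id}|_{\tilde W_{1,\le}}$ is of class $C^{k+1,a}_{\mathrm{loc}}$ in these coordinates, where $(k,a)$ is the lexicographic minimum of $(k_1,a_1)$ and $(k_2,a_2)$, i.e. $C^{k,a}_{\mathrm{loc}}$ is the regularity of the rougher of the two extensions. -/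

import Mathlib

open Set Filter Topology
open scoped Manifold ContDiff

noncomputable section

namespace SpacetimeExt

/-- The coordinate space `ℝ^{d+1}`, with coordinates `x 0, x 1, …, x d`. -/
abbrev E (d : ℕ) : Type := EuclideanSpace ℝ (Fin (d + 1))

/-! ### Functions of class `C^{k,a}_loc`, with `a = 0` or `a = 1` -/

/-- `f` is of class `C^{k,a}_loc` on the open set `O`: it is `C^k` there and, if `a = 1`, its
derivative of order `k` is moreover locally Lipschitz (so `C^{k,0}_loc` is just `C^k`). -/
def CkaLocOn {V W : Type*} [NormedAddCommGroup V] [NormedSpace ℝ V]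
    [NormedAddCommGroup W] [NormedSpace ℝ W] (k : ℕ) (a : Fin 2) (f : V → W) (O : Set V) : Prop :=
  ContDiffOn ℝ k f O ∧ (a = 1 → LocallyLipschitzOn O (iteratedFDerivWithin ℝ k f O))

/-- `f` is of class `C^{k,a}_loc` on an arbitrary subset `A`: it coincides on `A` with a function
of class `C^{k,a}_loc` on some open neighbourhood of `A`. -/
def CkaLocOnSet {V W : Type*} [NormedAddCommGroup V] [NormedSpace ℝ V]
    [NormedAddCommGroup W] [NormedSpace ℝ W] (k : ℕ) (a : Fin 2) (f : V → W) (A : Set V) : Prop :=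
  ∃ (O : Set V) (F : V → W), IsOpen O ∧ A ⊆ O ∧ CkaLocOn k a F O ∧ EqOn F f A

/-! ### Lorentzian metrics -/

/-- A (not necessarily continuous) Lorentzian metric of signature `(-, +, …, +)` on a
`(d+1)`-dimensional manifold. -/
structure LorentzMetric (d : ℕ) (M : Type*) [TopologicalSpace M] [ChartedSpace (E d) M] where
  /-- the scalar product of the tangent space at each point -/
  val : ∀ x : M, TangentSpace (𝓡 (d + 1)) x →L[ℝ] TangentSpace (𝓡 (d + 1)) x →L[ℝ] ℝ
  symm : ∀ (x : M) (v w : TangentSpace (𝓡 (d + 1)) x), val x v w = val x w v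
  /-- every tangent space has an orthonormal basis with exactly one timelike vector -/
  signature : ∀ x : M, ∃ b : Module.Basis (Fin (d + 1)) ℝ (TangentSpace (𝓡 (d + 1)) x),
    ∀ i j, val x (b i) (b j) = if i = j then (if i = 0 then -1 else 1) else 0

section Metric

variable {d : ℕ} {M : Type*} [TopologicalSpace M] [ChartedSpace (E d) M]

/-- The metric in the coordinates of the chart `e`, as a scalar product on `ℝ^{d+1}` depending on
the coordinate point `y`. -/
def LorentzMetric.coord (g : LorentzMetric d M) (e : OpenPartialHomeomorph M (E d)) (y : E d) :
    E d →L[ℝ] E d →L[ℝ] ℝ :=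
  let B : E d →L[ℝ] E d →L[ℝ] ℝ := g.val (e.symm y)
  let D : E d →L[ℝ] E d := mfderiv (𝓡 (d + 1)) (𝓡 (d + 1)) e.symm y
  B.bilinearComp D D

theorem LorentzMetric.coord_apply (g : LorentzMetric d M) (e : OpenPartialHomeomorph M (E d))
    (y v w : E d) :
    g.coord e y v w = g.val (e.symm y) (mfderiv (𝓡 (d + 1)) (𝓡 (d + 1)) e.symm y v)
      (mfderiv (𝓡 (d + 1)) (𝓡 (d + 1)) e.symm y w) := rfl

/-- The component `g_{μν}` in the coordinates of the chart `e`. -/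
def LorentzMetric.component (g : LorentzMetric d M) (e : OpenPartialHomeomorph M (E d)) (y : E d)
    (μ ν : Fin (d + 1)) : ℝ :=
  g.coord e y (EuclideanSpace.single μ 1) (EuclideanSpace.single ν 1)

/-- The metric is of class `C^{k,a}_loc`: its components in all smooth charts are. -/
def LorentzMetric.IsCkaLoc (g : LorentzMetric d M) (k : ℕ) (a : Fin 2) : Prop :=
  ∀ e ∈ IsManifold.maximalAtlas (𝓡 (d + 1)) ∞ M, CkaLocOn k a (g.coord e) e.target

/-- The metric is smooth. -/
def LorentzMetric.IsSmooth (g : LorentzMetric d M) : Prop :=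
  ∀ e ∈ IsManifold.maximalAtlas (𝓡 (d + 1)) ∞ M, ContDiffOn ℝ ∞ (g.coord e) e.target

/-! ### Timelike curves, time orientation, global hyperbolicity -/

/-- The velocity at parameter `s` of a curve with parameter interval `S` (one-sided at an end point
that belongs to `S`). -/
def velocity (d : ℕ) {M : Type*} [TopologicalSpace M] [ChartedSpace (E d) M]
    (γ : ℝ → M) (S : Set ℝ) (s : ℝ) : TangentSpace (𝓡 (d + 1)) (γ s) :=
  mfderivWithin 𝓘(ℝ, ℝ) (𝓡 (d + 1)) γ S s (show TangentSpace 𝓘(ℝ, ℝ) s from (1 : ℝ))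

/-- `γ : S → M` is a smooth timelike curve. -/
def IsTimelike (g : LorentzMetric d M) (γ : ℝ → M) (S : Set ℝ) : Prop :=
  ContMDiffOn 𝓘(ℝ, ℝ) (𝓡 (d + 1)) ∞ γ S ∧
    ∀ s ∈ S, g.val (γ s) (velocity d γ S s) (velocity d γ S s) < 0

/-- A Cauchy hypersurface: a subset that is met exactly once by every inextendible smooth timelike
curve. An inextendible curve has an open parameter interval, which can be taken to be `ℝ`, and it
has no end point in either direction. -/
def IsCauchyHypersurface (g : LorentzMetric d M) (A : Set M) : Prop :=
  ∀ γ : ℝ → M, IsTimelike g γ univ →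
    (¬ ∃ p, Tendsto γ atTop (𝓝 p)) → (¬ ∃ p, Tendsto γ atBot (𝓝 p)) → ∃! s : ℝ, γ s ∈ A

/-- Global hyperbolicity: the existence of a Cauchy hypersurface. -/
def IsGloballyHyperbolic (g : LorentzMetric d M) : Prop :=
  ∃ A : Set M, IsCauchyHypersurface g A

/-- A time orientation: a continuous timelike vector field, declared to be future directed. -/
structure TimeOrientation [IsManifold (𝓡 (d + 1)) ∞ M] (g : LorentzMetric d M) where
  /-- the vector field -/
  field : ∀ x : M, TangentSpace (𝓡 (d + 1)) x
  continuous : Continuous fun x : M => (⟨x, field x⟩ : TangentBundle (𝓡 (d + 1)) M)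
  timelike : ∀ x : M, g.val x (field x) (field x) < 0

variable [IsManifold (𝓡 (d + 1)) ∞ M]

/-- `γ : S → M` is a smooth future directed timelike curve. -/
def IsFutureTimelike (g : LorentzMetric d M) (T : TimeOrientation g) (γ : ℝ → M) (S : Set ℝ) :
    Prop :=
  IsTimelike g γ S ∧ ∀ s ∈ S, g.val (γ s) (velocity d γ S s) (T.field (γ s)) < 0

/-- The timelike future `I⁺(A, M)` of a subset `A`. -/
def timelikeFuture (g : LorentzMetric d M) (T : TimeOrientation g) (A : Set M) : Set M :=
  {q | ∃ γ : ℝ → M, IsFutureTimelike g T γ (Icc 0 1) ∧ γ 0 ∈ A ∧ γ 1 = q}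

end Metric

/-! ### Extensions and their future boundary -/

section Extension

variable {d : ℕ} {M N : Type*} [TopologicalSpace M] [ChartedSpace (E d) M]
  [TopologicalSpace N] [ChartedSpace (E d) N]

/-- `ι : M → N` is a `C^{k,a}_loc`-extension of `(M, g)`, where `N` carries the metric `h`: a smooth
isometric embedding into a manifold of the same dimension whose metric is of class `C^{k,a}_loc`,
such that the boundary of the image is not empty. -/
structure IsExtension (g : LorentzMetric d M) (h : LorentzMetric d N) (ι : M → N)
    (k : ℕ) (a : Fin 2) : Prop where
  embedding : Manifold.IsSmoothEmbedding (𝓡 (d + 1)) (𝓡 (d + 1)) ∞ ι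
  isometric : ∀ (x : M) (v w : TangentSpace (𝓡 (d + 1)) x),
    h.val (ι x) (mfderiv (𝓡 (d + 1)) (𝓡 (d + 1)) ι x v)
      (mfderiv (𝓡 (d + 1)) (𝓡 (d + 1)) ι x w) = g.val x v w
  regular : h.IsCkaLoc k a
  boundary_nonempty : (frontier (range ι)).Nonempty

/-- The future boundary `∂⁺ι(M)`: the boundary points of `ι(M)` that are the end point of a smooth
timelike curve `γ : [-1, 0] → N` such that `ι⁻¹ ∘ γ` (the curve `c`) is defined and future directed
on `[-1, 0)`. -/
def futureBoundary [IsManifold (𝓡 (d + 1)) ∞ M] (g : LorentzMetric d M) (T : TimeOrientation g)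
    (h : LorentzMetric d N) (ι : M → N) : Set N :=
  {p | p ∈ frontier (range ι) ∧ ∃ γ : ℝ → N, IsTimelike h γ (Icc (-1) 0) ∧ γ 0 = p ∧
    ∃ c : ℝ → M, IsFutureTimelike g T c (Ico (-1) 0) ∧ ∀ s ∈ Ico (-1 : ℝ) 0, ι (c s) = γ s}

/-- The coordinates `(x_1, …, x_d)` of `(x_0, x_1, …, x_d)`. -/
def spatial (x : E d) : Fin d → ℝ := fun i => x i.succ

/-- The cube `(-ε, ε)^d`. -/
def cube (d : ℕ) (ε : ℝ) : Set (Fin d → ℝ) := {x | ∀ i, x i ∈ Ioo (-ε) ε}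

/-- The points of the chart domain strictly below the graph of `f`. -/
def below (e : OpenPartialHomeomorph N (E d)) (f : (Fin d → ℝ) → ℝ) : Set N :=
  {p | p ∈ e.source ∧ e p 0 < f (spatial (e p))}

/-- The points of the chart domain on the graph of `f`. -/
def onGraph (e : OpenPartialHomeomorph N (E d)) (f : (Fin d → ℝ) → ℝ) : Set N :=
  {p | p ∈ e.source ∧ e p 0 = f (spatial (e p))}

/-- The points of the chart domain on or below the graph of `f`. -/
def belowEq (e : OpenPartialHomeomorph N (E d)) (f : (Fin d → ℝ) → ℝ) : Set N :=
  {p | p ∈ e.source ∧ e p 0 ≤ f (spatial (e p))}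

/-- `e` is a future boundary chart around `p`, onto `(-ε₀, ε₀) × (-ε₁, ε₁)^d`, with graphing
function `f` and with metric `δ`-close to the Minkowski metric `diag(-1, 1, …, 1)`. -/
structure IsFutureBoundaryChart [IsManifold (𝓡 (d + 1)) ∞ M] (g : LorentzMetric d M)
    (T : TimeOrientation g) (h : LorentzMetric d N) (ι : M → N) (p : N) (δ : ℝ) (e : OpenPartialHomeomorph N (E d))
    (ε₀ ε₁ : ℝ) (f : (Fin d → ℝ) → ℝ) : Prop where
  ε₀_pos : 0 < ε₀
  ε₁_pos : 0 < ε₁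
  chart : e ∈ IsManifold.maximalAtlas (𝓡 (d + 1)) ∞ N
  target_eq : e.target = {x | x 0 ∈ Ioo (-ε₀) ε₀ ∧ spatial x ∈ cube d ε₁}
  centre_mem_futureBoundary : p ∈ futureBoundary g T h ι
  centre_mem : p ∈ e.source
  centre_eq : e p = 0
  near_minkowski : ∀ y ∈ e.target, ∀ μ ν : Fin (d + 1),
    |h.component e y μ ν - (if μ = ν then (if μ = 0 then -1 else 1) else 0)| < δ
  lipschitz : ∃ L, LipschitzOnWith L f (cube d ε₁)
  mapsTo : MapsTo f (cube d ε₁) (Ioo (-ε₀) ε₀)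
  below_subset : ∃ A : Set M, IsCauchyHypersurface g A ∧ below e f ⊆ ι '' timelikeFuture g T A
  graph_subset : onGraph e f ⊆ futureBoundary g T h ι
  /-- the graph is achronal in the chart domain, with respect to smooth timelike curves -/
  achronal : ¬ ∃ γ : ℝ → N, IsTimelike h γ (Icc 0 1) ∧ MapsTo γ (Icc 0 1) e.source ∧
    γ 0 ∈ onGraph e f ∧ γ 1 ∈ onGraph e f

/-- The identification map `id = ι₂ ∘ ι₁⁻¹`, meaningful on `ι₁(M)`. -/
def identMap {N₁ N₂ : Type*} [Nonempty M] (ι₁ : M → N₁) (ι₂ : M → N₂) : N₁ → N₂ :=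
  ι₂ ∘ Function.invFun ι₁

end Extension

/-- The regularity `(k, a)` of the rougher of the classes `C^{k₁,a₁}_loc` and `C^{k₂,a₂}_loc`: the
lexicographic minimum, since `C^{k,0} ⊇ C^{k,1} ⊇ C^{k+1,0}`. -/
def minReg (k₁ : ℕ) (a₁ : Fin 2) (k₂ : ℕ) (a₂ : Fin 2) : ℕ × Fin 2 :=
  ofLex (min (toLex (k₁, a₁)) (toLex (k₂, a₂)))

end SpacetimeExt

end

/-!
Below the graphs the identification map is, in coordinates, a smooth isometry `ψ` between the two
metrics `B` and `H`, so its second derivative is determined by Koszul's formula: isometries map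
Christoffel symbols to Christoffel symbols, which expresses `D²ψ` as a smooth function of
`DB`, `DH ∘ ψ`, `H ∘ ψ` and `Dψ`, where `Dψ` is invertible (`fderiv_fderiv_eq_hessianOfJet`). Since
`ψ` is of class `C^1` up to the graph, `Dψ` stays invertible there, and the formula allows a
bootstrap: if `ψ` is of class `C^{n+1}` up to the graph and the metrics are of class `C^{n+1}`, then
the right hand side is of class `C^n` up to the graph, whence `ψ` is of class `C^{n+2}`
(`IsIsometryBelow.contDiffWithinAt_succ`). Metrics of class `C^k` thus yield class `C^{k+1}`. If the
metrics are of class `C^{k,1}_loc`, their derivatives of order `k + 1` are bounded, and the formula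
bounds those of `ψ` of order `k + 2` (`IsIsometryBelow.exists_bound`).

The assertion is about extensions to a neighbourhood of the graph, and the bootstrap also needs
them, since `H` is to be differentiated at points of the graph. So Whitney's extension theorem is
proved for the closed subgraph `{δ ≤ 0}` of a Lipschitz function, `δ` being the height above the
graph (`exists_extension_of_contDiffWithinAt`, and
`exists_lipschitz_extension_of_contDiffWithinAt` for a bounded highest derivative). At a point at
height comparable to `2⁻ʲ` the extension is the extrapolation of the function from equidistant
points below, with step length `2⁻ʲ`, by weights that are exact on polynomials of high degree. The
extrapolations with step lengths `2⁻ʲ` and `2⁻ʲ⁻¹` differ so little that cutoff functions in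
Lipschitz layers of thickness `2⁻ʲ` glue them in `C^m` (`exists_extension_of_uniformContinuous`).
That a function on `{δ ≤ 0}` whose derivative on `{δ < 0}` has a limit at the boundary is
differentiable there follows by integrating along segments inside the cones below the points
(`hasFDerivWithinAt_sublevel_of_tendsto`).

Finally, a partition of unity glues local extensions (`ckaLocOnSet_of_local`), and the inverse
function theorem, applied to the isometric embeddings in charts, provides the smoothness of the
metrics and of the identification map below the graphs (`IsExtension.exists_local_inverse`).
-/

namespace SpacetimeExt

/-! ### Cutoff functions adapted to the sublevel sets of a Lipschitz function -/

section Cutoff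

open MeasureTheory ContinuousLinearMap
open scoped Convolution

universe u

variable {G : Type u} [NormedAddCommGroup G] [NormedSpace ℝ G] [FiniteDimensional ℝ G]

/-- Every derivative of the convolution of a fixed smooth compactly supported function with a
function bounded by `1` is bounded, uniformly in the latter. -/
theorem exists_bound_iteratedFDeriv_convolution [MeasurableSpace G] [BorelSpace G]
    (μ : Measure G) [μ.IsAddHaarMeasure] (i : ℕ) :
    ∀ {W W' : Type u} [NormedAddCommGroup W] [NormedSpace ℝ W] [NormedAddCommGroup W']
      [NormedSpace ℝ W'] (L : ℝ →L[ℝ] W →L[ℝ] W') (φ : G → W),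
      ContDiff ℝ ∞ φ → HasCompactSupport φ →
      ∃ C : ℝ, 0 ≤ C ∧ ∀ g : G → ℝ, Measurable g → (∀ x, ‖g x‖ ≤ 1) → ∀ x,
        ‖iteratedFDeriv ℝ i (g ⋆[L, μ] φ) x‖ ≤ C := by
  induction i with
  | zero =>
    intro W W' _ _ _ _ L φ hφ hc
    refine ⟨∫ t, ‖L‖ * ‖φ t‖ ∂μ, integral_nonneg fun t => by positivity, fun g hg hg1 x => ?_⟩
    rw [norm_iteratedFDeriv_zero, convolution_def,
      ← integral_sub_left_eq_self (fun t => ‖L‖ * ‖φ t‖) μ x]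
    refine norm_integral_le_of_norm_le ?_ (Eventually.of_forall fun t => ?_)
    · have h : Integrable (fun t => ‖L‖ * ‖φ t‖) μ :=
        ((hφ.continuous.integrable_of_hasCompactSupport hc).norm).const_mul _
      exact h.comp_sub_left x
    · calc ‖L (g t) (φ (x - t))‖ ≤ ‖L‖ * ‖g t‖ * ‖φ (x - t)‖ := L.le_opNorm₂ _ _
        _ ≤ ‖L‖ * 1 * ‖φ (x - t)‖ := by gcongr; exact hg1 t
        _ = _ := by ring
  | succ i ih =>
    intro W W' _ _ _ _ L φ hφ hc
    obtain ⟨C, hC0, hC⟩ := ih (L.precompR G) (fderiv ℝ φ) (hφ.fderiv_right (by simp))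
      (hc.fderiv ℝ)
    refine ⟨C, hC0, fun g hg hg1 x => ?_⟩
    have hloc : LocallyIntegrable g μ :=
      (memLp_top_of_bound hg.aestronglyMeasurable 1
        (Eventually.of_forall hg1)).locallyIntegrable le_top
    have hfd : fderiv ℝ (g ⋆[L, μ] φ) = g ⋆[L.precompR G, μ] fderiv ℝ φ := by
      ext1 y
      exact (hc.hasFDerivAt_convolution_right L hloc (hφ.of_le (by simp)) y).fderiv
    rw [← norm_iteratedFDeriv_fderiv, hfd]
    exact hC g hg hg1 x

theorem exists_cutoff_unit_scale (K : NNReal) : ∃ C : ℕ → ℝ, (∀ i, 0 ≤ C i) ∧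
    ∀ δ : G → ℝ, LipschitzWith K δ → ∃ η : G → ℝ, ContDiff ℝ ∞ η ∧
      (∀ x, δ x ≤ 1 / 4 → η x = 1) ∧ (∀ x, 3 / 8 ≤ δ x → η x = 0) ∧
      ∀ i x, ‖iteratedFDeriv ℝ i η x‖ ≤ C i := by
  borelize G
  let μ : Measure G := Measure.addHaar
  have hr : (0 : ℝ) < 1 / (16 * (K + 1)) := by positivity
  let b : ContDiffBump (0 : G) := ⟨1 / (16 * (K + 1)) / 2, 1 / (16 * (K + 1)), by linarith,
    by linarith⟩
  -- the universe levels of the spaces in the preceding lemma agree, whence the lift of `ℝ`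
  let e : ULift.{u} ℝ ≃L[ℝ] ℝ := ContinuousLinearEquiv.ulift
  let φ : G → ULift.{u} ℝ := fun x => e.symm (b.normed μ x)
  have hφ : ContDiff ℝ ∞ φ := e.symm.contDiff.comp b.contDiff_normed
  have hφc : HasCompactSupport φ := b.hasCompactSupport_normed.comp_left (map_zero e.symm)
  have key := fun i => exists_bound_iteratedFDeriv_convolution μ i
    (lsmul ℝ ℝ : ℝ →L[ℝ] ULift.{u} ℝ →L[ℝ] ULift.{u} ℝ) φ hφ hφc
  choose C hC0 hC using key
  refine ⟨fun i => ‖(e : ULift.{u} ℝ →L[ℝ] ℝ)‖ * C i, fun i => by have := hC0 i; positivity,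
    fun δ hδ => ?_⟩
  let g : G → ℝ := indicator {x | δ x ≤ 5 / 16} 1
  have hgm : Measurable g := measurable_one.indicator
    (measurableSet_le hδ.continuous.measurable measurable_const)
  have hg1 : ∀ x, ‖g x‖ ≤ 1 := fun x => by
    by_cases h : δ x ≤ 5 / 16 <;> simp [g, h]
  let w : G → ULift.{u} ℝ := g ⋆[lsmul ℝ ℝ, μ] φ
  have hloc : LocallyIntegrable g μ :=
    (memLp_top_of_bound hgm.aestronglyMeasurable 1
      (Eventually.of_forall hg1)).locallyIntegrable le_top
  have hw : ContDiff ℝ ∞ w := hφc.contDiff_convolution_right _ hloc hφ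
  have hball : ∀ x y, y ∈ Metric.ball x b.rOut → |δ y - δ x| < 1 / 16 := fun x y hy => by
    have h1 := hδ.dist_le_mul y x
    rw [Real.dist_eq] at h1
    have h2 : dist y x ≤ 1 / (16 * (K + 1)) := (Metric.mem_ball.1 hy).le
    have h3 : (K : ℝ) * (1 / (16 * (K + 1))) < 1 / 16 := by
      rw [mul_one_div, div_lt_div_iff₀ (by positivity) (by norm_num)]
      nlinarith [K.2]
    calc _ ≤ _ := h1
      _ ≤ (K : ℝ) * (1 / (16 * (K + 1))) := by gcongr
      _ < _ := h3
  have hval : ∀ x (c : ℝ), g x = c → (∀ y ∈ Metric.ball x b.rOut, g y = c) → e (w x) = c := by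
    intro x c hx hc
    have h1 : (b.normed μ ⋆[lsmul ℝ ℝ, μ] g : G → ℝ) x = g x :=
      b.normed_convolution_eq_right fun y hy => by rw [hc y hy, hx]
    have h2 : e (w x) = (g ⋆[lsmul ℝ ℝ, μ] b.normed μ : G → ℝ) x := by
      simp only [w, convolution_def]
      rw [← ContinuousLinearEquiv.integral_comp_comm]
      simp [φ]
    rw [h2, ← hx, ← h1, ← convolution_flip]
    congr 1
    ext
    simp
  refine ⟨fun x => e (w x), e.contDiff.comp hw, fun x hx => ?_, fun x hx => ?_, fun i x => ?_⟩
  · refine hval x 1 ?_ fun y hy => ?_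
    · have : δ x ≤ 5 / 16 := by linarith
      simp [g, this]
    · have := abs_lt.1 (hball x y hy)
      have : δ y ≤ 5 / 16 := by linarith [this.1, this.2]
      simp [g, this]
  · refine hval x 0 ?_ fun y hy => ?_
    · have : ¬ δ x ≤ 5 / 16 := by intro h; linarith
      simp [g, this]
    · have h := abs_lt.1 (hball x y hy)
      have : ¬ δ y ≤ 5 / 16 := by linarith [h.1]
      simp [g, this]
  · have := ContinuousLinearMap.norm_iteratedFDeriv_comp_left (e : ULift.{u} ℝ →L[ℝ] ℝ)
      (hw.contDiffAt (x := x)) (n := i) (by exact_mod_cast le_top)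
    exact this.trans (mul_le_mul_of_nonneg_left (hC i g hgm hg1 x) (norm_nonneg _))

/-- A smooth cutoff between the sublevel sets `δ ≤ h / 4` and `δ < 3 h / 8`, whose `i`-th
derivative is `O(h⁻ⁱ)` with constants that depend on `δ` only through its Lipschitz constant. -/
theorem exists_cutoff (K : NNReal) : ∃ C : ℕ → ℝ, (∀ i, 0 ≤ C i) ∧
    ∀ δ : G → ℝ, LipschitzWith K δ → ∀ h : ℝ, 0 < h → ∃ η : G → ℝ, ContDiff ℝ ∞ η ∧
      (∀ x, δ x ≤ h / 4 → η x = 1) ∧ (∀ x, 3 * h / 8 ≤ δ x → η x = 0) ∧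
      ∀ i x, ‖iteratedFDeriv ℝ i η x‖ ≤ C i * h⁻¹ ^ i := by
  obtain ⟨C, hC0, hC⟩ := exists_cutoff_unit_scale (G := G) K
  refine ⟨C, hC0, fun δ hδ h hh => ?_⟩
  have hδ' : LipschitzWith K fun x => h⁻¹ * δ (h • x) := by
    refine LipschitzWith.of_dist_le_mul fun x y => ?_
    have h1 := hδ.dist_le_mul (h • x) (h • y)
    rw [dist_smul₀, Real.norm_of_nonneg hh.le] at h1
    rw [Real.dist_eq, ← mul_sub, abs_mul, abs_of_pos (inv_pos.2 hh), ← Real.dist_eq,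
      inv_mul_le_iff₀ hh]
    linarith
  obtain ⟨η, hη, h1, h0, hb⟩ := hC _ hδ'
  have hs : ∀ x : G, h • h⁻¹ • x = x := fun x => smul_inv_smul₀ hh.ne' x
  refine ⟨fun x => η (h⁻¹ • x), hη.comp (contDiff_const_smul _), fun x hx => h1 _ ?_,
    fun x hx => h0 _ ?_, fun i x => ?_⟩
  · rw [hs, inv_mul_le_iff₀ hh]; linarith
  · rw [hs, le_inv_mul_iff₀ hh]; linarith
  · rw [iteratedFDeriv_comp_const_smul _ (hη.of_le (by exact_mod_cast le_top))]
    rw [norm_smul, norm_pow, Real.norm_of_nonneg (inv_pos.2 hh).le, mul_comm]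
    gcongr
    exact hb i _

end Cutoff

/-! ### Extrapolation along a line -/

section Extrapolation

open Polynomial in
/-- The weights that extrapolate the values at `1, …, N` of a polynomial of degree less than `N`
to its value at `0`. -/
theorem exists_extrapolation_weights (N : ℕ) : ∃ c : ℕ → ℝ, ∀ i < N, ∀ a h : ℝ,
    ∑ l ∈ Finset.Icc 1 N, c l * (l * h - a) ^ i = (-a) ^ i := by
  refine ⟨fun l => (Lagrange.basis (Finset.Icc 1 N) (fun j : ℕ => (j : ℝ)) l).eval 0,
    fun i hi a h => ?_⟩
  let p : ℝ[X] := (C h * X - C a) ^ i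
  have hinj : InjOn (fun j : ℕ => (j : ℝ)) (Finset.Icc 1 N : Finset ℕ) :=
    Nat.cast_injective.injOn
  have hdeg : p.degree < (Finset.Icc 1 N).card := by
    rw [Nat.card_Icc, Nat.add_sub_cancel]
    refine (degree_pow_le _ _).trans_lt ?_
    have h1 : (C h * X - C a : ℝ[X]).degree ≤ 1 := by
      rw [sub_eq_add_neg, ← C_neg]
      exact degree_linear_le
    calc i • (C h * X - C a : ℝ[X]).degree ≤ i • (1 : WithBot ℕ) := by gcongr
      _ = (i : WithBot ℕ) := by simp
      _ < N := by exact_mod_cast hi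
  have := congrArg (eval 0) (Lagrange.eq_interpolate hinj hdeg)
  rw [Lagrange.interpolate_apply, eval_finsetSum] at this
  simp only [eval_mul, eval_C, p, eval_pow, eval_sub, eval_X, mul_zero, zero_sub] at this
  rw [this]
  refine Finset.sum_congr rfl fun l _ => ?_
  ring

variable {W : Type*} [NormedAddCommGroup W] [NormedSpace ℝ W]

/-- Taylor's formula whose error is controlled by the oscillation of the highest derivative. -/
theorem norm_sub_taylor_le {a b ε : ℝ} (s : ℕ) : ∀ w : ℕ → ℝ → W,
    (∀ i < s, ∀ t ∈ Icc a b, HasDerivWithinAt (w i) (w (i + 1) t) (Icc a b) t) →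
    (∀ t ∈ Icc a b, ‖w s t - w s a‖ ≤ ε) → ∀ t ∈ Icc a b,
    ‖w 0 t - ∑ i ∈ Finset.range (s + 1), ((t - a) ^ i / i.factorial) • w i a‖
      ≤ ε * (t - a) ^ s := by
  induction s with
  | zero => intro w _ h t ht; simpa using h t ht
  | succ s ih =>
    intro w hw h t ht
    have ih' := ih (fun i => w (i + 1)) (fun i hi => hw (i + 1) (by omega)) h
    let r : ℝ → W := fun u =>
      w 0 u - ∑ i ∈ Finset.range (s + 1 + 1), ((u - a) ^ i / i.factorial) • w i a
    have hr : ∀ u ∈ Icc a t, HasDerivWithinAt r (w 1 u -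
        ∑ i ∈ Finset.range (s + 1), ((u - a) ^ i / i.factorial) • w (i + 1) a) (Icc a t) u := by
      intro u hu
      have hsub : Icc a t ⊆ Icc a b := Icc_subset_Icc_right ht.2
      refine ((hw 0 (by omega) u (hsub hu)).mono hsub).sub ?_
      have h1 : (fun u => ∑ i ∈ Finset.range (s + 1 + 1), ((u - a) ^ i / i.factorial) • w i a) =
          fun u => (∑ i ∈ Finset.range (s + 1),
            ((u - a) ^ (i + 1) / (i + 1).factorial) • w (i + 1) a) + w 0 a := by
        ext u; rw [Finset.sum_range_succ']; simp
      rw [h1]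
      refine HasDerivWithinAt.add_const _ (HasDerivWithinAt.fun_sum fun i _ => ?_)
      refine HasDerivWithinAt.smul_const ?_ _
      have h2 := ((((hasDerivAt_id u).sub_const a).pow (i + 1)).div_const
        ((i + 1).factorial : ℝ)).hasDerivWithinAt (s := Icc a t)
      refine h2.congr_deriv ?_
      have : (i.factorial : ℝ) ≠ 0 := by positivity
      rw [Nat.factorial_succ, Nat.add_sub_cancel]
      push_cast
      simp only [id_eq]
      field_simp
    have hat : a ∈ Icc a t := ⟨le_rfl, ht.1⟩
    have htt : t ∈ Icc a t := ⟨ht.1, le_rfl⟩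
    have hε : 0 ≤ ε := (norm_nonneg _).trans (h t ht)
    have := (convex_Icc a t).norm_image_sub_le_of_norm_hasDerivWithin_le (C := ε * (t - a) ^ s) hr
      (fun u hu => (ih' u ⟨hu.1, hu.2.trans ht.2⟩).trans ?_) hat htt
    · have h0 : r a = 0 := by simp [r, Finset.sum_range_succ']
      rw [h0, sub_zero, Real.norm_of_nonneg (by linarith [ht.1])] at this
      calc _ ≤ _ := this
        _ = _ := by ring
    · gcongr
      · linarith [hu.1]
      · exact hu.2

/-- The difference of the extrapolations to `0` with the step lengths `h / 2` and `h`. -/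
theorem norm_extrapolation_sub_le {c : ℕ → ℝ} {N : ℕ}
    (hc : ∀ i < N, ∀ a h : ℝ, ∑ l ∈ Finset.Icc 1 N, c l * (l * h - a) ^ i = (-a) ^ i)
    {s : ℕ} (hs : s < N) {h ε : ℝ} (hh : 0 < h) (hε : 0 ≤ ε) (w : ℕ → ℝ → W)
    (hw : ∀ i < s, ∀ t ∈ Icc (h / 2) (N * h),
      HasDerivWithinAt (w i) (w (i + 1) t) (Icc (h / 2) (N * h)) t)
    (hosc : ∀ t ∈ Icc (h / 2) (N * h), ‖w s t - w s (h / 2)‖ ≤ ε) :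
    ‖∑ l ∈ Finset.Icc 1 N, c l • (w 0 (l * (h / 2)) - w 0 (l * h))‖
      ≤ 2 * (∑ l ∈ Finset.Icc 1 N, |c l|) * ε * (N * h) ^ s := by
  set a := h / 2 with ha
  let P : ℝ → W := fun t => ∑ i ∈ Finset.range (s + 1), ((t - a) ^ i / i.factorial) • w i a
  have hP : ∀ k : ℝ, ∑ l ∈ Finset.Icc 1 N, c l • P (l * k) = P 0 := by
    intro k
    simp only [P, Finset.smul_sum]
    rw [Finset.sum_comm]
    refine Finset.sum_congr rfl fun i hi => ?_
    simp only [smul_smul]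
    rw [← Finset.sum_smul, zero_sub, ← hc i (by have := Finset.mem_range.1 hi; omega) a k,
      Finset.sum_div]
    simp only [mul_div_assoc]
  have hT := norm_sub_taylor_le s w hw hosc
  have hT' : ∀ t ∈ Icc a (N * h), ‖w 0 t - P t‖ ≤ ε * (N * h) ^ s := fun t ht =>
    (hT t ht).trans (by
      have : 0 < a := by positivity
      have := ht.1; have := ht.2
      gcongr; linarith)
  have heq : ∑ l ∈ Finset.Icc 1 N, c l • (w 0 (l * a) - w 0 (l * h)) =
      ∑ l ∈ Finset.Icc 1 N,
        c l • ((w 0 (l * a) - P (l * a)) - (w 0 (l * h) - P (l * h))) := by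
    have h1 := hP a
    have h2 := hP h
    rw [← sub_eq_zero, ← Finset.sum_sub_distrib]
    rw [← sub_eq_zero.2 (h1.trans h2.symm), ← Finset.sum_sub_distrib]
    refine Finset.sum_congr rfl fun l _ => ?_
    rw [← smul_sub, ← smul_sub]
    congr 1
    abel
  rw [heq]
  calc _ ≤ ∑ l ∈ Finset.Icc 1 N, |c l| * (ε * (N * h) ^ s + ε * (N * h) ^ s) := by
        refine norm_sum_le_of_le _ fun l hl => ?_
        have hl1 : (1 : ℝ) ≤ l := by exact_mod_cast (Finset.mem_Icc.1 hl).1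
        have hl2 : (l : ℝ) ≤ N := by exact_mod_cast (Finset.mem_Icc.1 hl).2
        rw [norm_smul, Real.norm_eq_abs]
        refine mul_le_mul_of_nonneg_left ((norm_sub_le _ _).trans (add_le_add ?_ ?_))
          (abs_nonneg _)
        · exact hT' _ ⟨by nlinarith, by nlinarith⟩
        · exact hT' _ ⟨by nlinarith, by nlinarith⟩
    _ = _ := by rw [← Finset.sum_mul]; ring

end Extrapolation

/-! ### Bounds for iterated derivatives, and uniform limits in `C^m` -/

section IteratedDerivatives

variable {E F W : Type*} [NormedAddCommGroup E] [NormedSpace ℝ E]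
  [NormedAddCommGroup F] [NormedSpace ℝ F] [NormedAddCommGroup W] [NormedSpace ℝ W]

theorem exists_isOpen_contDiffOn {f : E → F} {x : E} {n : ℕ} (hf : ContDiffAt ℝ n f x) :
    ∃ u, IsOpen u ∧ x ∈ u ∧ ContDiffOn ℝ n f u := by
  obtain ⟨u, hu, hfu⟩ := hf.contDiffOn le_rfl (by simp)
  obtain ⟨v, hv, hvo, hxv⟩ := mem_nhds_iff.1 hu
  exact ⟨v, hvo, hxv, hfu.mono hv⟩

theorem norm_iteratedFDeriv_smul_le_of_contDiffAt {f : E → ℝ} {g : E → W} {x : E} {n : ℕ}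
    (hf : ContDiffAt ℝ n f x) (hg : ContDiffAt ℝ n g x) :
    ‖iteratedFDeriv ℝ n (fun y => f y • g y) x‖ ≤ ∑ i ∈ Finset.range (n + 1),
      (n.choose i : ℝ) * ‖iteratedFDeriv ℝ i f x‖ * ‖iteratedFDeriv ℝ (n - i) g x‖ := by
  obtain ⟨u, hu, hxu, hfu⟩ := exists_isOpen_contDiffOn hf
  obtain ⟨v, hv, hxv, hgv⟩ := exists_isOpen_contDiffOn hg
  have huv := hu.inter hv
  have := norm_iteratedFDerivWithin_smul_le (hfu.mono inter_subset_left)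
    (hgv.mono inter_subset_right) huv.uniqueDiffOn ⟨hxu, hxv⟩ le_rfl
  simpa only [iteratedFDerivWithin_of_isOpen _ huv ⟨hxu, hxv⟩] using this

/-- A sequence that converges uniformly together with its derivatives of order at most `m` has a
limit of class `C^m`, and the derivatives of order `m` converge as well. -/
theorem exists_contDiffOn_of_uniformCauchySeqOn [CompleteSpace W] {O : Set E} (hO : IsOpen O)
    {m : ℕ} {S : ℕ → E → W} (hS : ∀ J, ContDiffOn ℝ m (S J) O)
    (hC : ∀ q ≤ m, UniformCauchySeqOn (fun J => iteratedFDeriv ℝ q (S J)) atTop O) :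
    ∃ F : E → W, ContDiffOn ℝ m F O ∧ (∀ x ∈ O, Tendsto (fun J => S J x) atTop (𝓝 (F x))) ∧
      ∀ x ∈ O, Tendsto (fun J => iteratedFDeriv ℝ m (S J) x) atTop
        (𝓝 (iteratedFDeriv ℝ m F x)) := by
  classical
  have hlim : ∀ x q, ∃ P, x ∈ O → q ≤ m →
      Tendsto (fun J => iteratedFDeriv ℝ q (S J) x) atTop (𝓝 P) := by
    intro x q
    by_cases h : x ∈ O ∧ q ≤ m
    · obtain ⟨P, hP⟩ := cauchySeq_tendsto_of_complete ((hC q h.2).cauchySeq h.1)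
      exact ⟨P, fun _ _ => hP⟩
    · exact ⟨0, fun h1 h2 => absurd ⟨h1, h2⟩ h⟩
  choose P hP using hlim
  have hU : ∀ q ≤ m, TendstoUniformlyOn (fun J => iteratedFDeriv ℝ q (S J)) (fun x => P x q)
      atTop O := fun q hq =>
    (hC q hq).tendstoUniformlyOn_of_tendsto fun x hx => hP x q hx hq
  have hT : HasFTaylorSeriesUpToOn m (fun x => (P x 0).curry0) P O := by
    refine ⟨fun x hx => rfl, fun q hq x hx => ?_, fun q hq => ?_⟩
    · have hq' : q < m := by exact_mod_cast hq
      refine HasFDerivAt.hasFDerivWithinAt ?_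
      refine hasFDerivAt_of_tendstoUniformlyOn (l := atTop)
        (f := fun J => iteratedFDeriv ℝ q (S J))
        (f' := fun J y => (iteratedFDeriv ℝ (q + 1) (S J) y).curryLeft)
        (g' := fun y => (P y (q + 1)).curryLeft) hO ?_ ?_ (fun y hy => hP y q hy hq'.le) hx
      · exact (continuousMultilinearCurryLeftEquiv ℝ (fun _ : Fin (q + 1) => E)
          W).isometry.uniformContinuous.comp_tendstoUniformlyOn (hU (q + 1) hq')
      · intro J y hy
        have hd : DifferentiableAt ℝ (iteratedFDeriv ℝ q (S J)) y :=
          ((hS J).contDiffAt (hO.mem_nhds hy)).differentiableAt_iteratedFDeriv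
            (by exact_mod_cast hq')
        refine hd.hasFDerivAt.congr_fderiv ?_
        ext z w
        exact (iteratedFDeriv_succ_apply_left (Fin.cons z w)).symm
    · have hq' : q ≤ m := by exact_mod_cast hq
      refine (hU q hq').continuousOn (Eventually.of_forall fun J => ?_).frequently
      intro y hy
      exact (((hS J).contDiffAt (hO.mem_nhds hy)).continuousAt_iteratedFDeriv
        (by exact_mod_cast hq')).continuousWithinAt
  refine ⟨_, hT.contDiffOn, fun x hx => ?_, fun x hx => ?_⟩
  · have h1 := (continuousMultilinearCurryFin0 ℝ E W).continuous.tendsto _ |>.comp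
      (hP x 0 hx (Nat.zero_le m))
    simpa [Function.comp_def] using h1
  · have h1 := hT.eq_iteratedFDerivWithin_of_uniqueDiffOn le_rfl hO.uniqueDiffOn hx
    rw [iteratedFDerivWithin_of_isOpen _ hO hx] at h1
    rw [← h1]
    exact hP x m hx le_rfl

end IteratedDerivatives

/-! ### Extension across the boundary of a Lipschitz subgraph -/

section Layers

variable {E W : Type*} [NormedAddCommGroup E] [NormedSpace ℝ E]
  [NormedAddCommGroup W] [NormedSpace ℝ W]

/-- The extrapolation of `v` to `x` from the points `x - h e, …, x - N h e`. -/
def extrapolate (c : ℕ → ℝ) (N : ℕ) (e : E) (v : E → W) (h : ℝ) (x : E) : W :=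
  ∑ l ∈ Finset.Icc 1 N, c l • v (x - (l * h) • e)

variable {c : ℕ → ℝ} {N M : ℕ} {e : E} {v : E → W} {δ : E → ℝ} {h ε : ℝ} {x : E}

theorem shift_lt_zero (hδe : ∀ x t, δ (x - t • e) = δ x - t) (hx : δ x < h) (hh : 0 < h)
    {l : ℕ} (hl : l ∈ Finset.Icc 1 N) : δ (x - (l * h) • e) < 0 := by
  have hl1 : (1 : ℝ) ≤ l := by exact_mod_cast (Finset.mem_Icc.1 hl).1
  rw [hδe]
  nlinarith

theorem contDiffAt_extrapolate (hδ : Continuous δ) (hδe : ∀ x t, δ (x - t • e) = δ x - t)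
    (hv : ContDiffOn ℝ M v {x | δ x < 0}) (hx : δ x < h) (hh : 0 < h) :
    ContDiffAt ℝ M (extrapolate c N e v h) x := by
  refine ContDiffAt.sum fun l hl => ContDiffAt.const_smul _ ?_
  have h1 : ContDiffAt ℝ M v (x - (l * h) • e) :=
    hv.contDiffAt ((isOpen_lt hδ continuous_const).mem_nhds (shift_lt_zero hδe hx hh hl))
  exact h1.comp x (contDiffAt_id.sub contDiffAt_const)

theorem iteratedFDeriv_extrapolate (hδ : Continuous δ)
    (hδe : ∀ x t, δ (x - t • e) = δ x - t) (hv : ContDiffOn ℝ M v {x | δ x < 0})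
    (hx : δ x < h) (hh : 0 < h) {q : ℕ} (hq : q ≤ M) :
    iteratedFDeriv ℝ q (extrapolate c N e v h) x =
      ∑ l ∈ Finset.Icc 1 N, c l • iteratedFDeriv ℝ q v (x - (l * h) • e) := by
  have h1 : ∀ l ∈ Finset.Icc 1 N, ContDiffAt ℝ q (fun y => v (y - (l * h) • e)) x :=
    fun l hl => by
      have h1 : ContDiffAt ℝ q v (x - (l * h) • e) :=
        (hv.contDiffAt ((isOpen_lt hδ continuous_const).mem_nhds
          (shift_lt_zero hδe hx hh hl))).of_le (by exact_mod_cast hq)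
      exact h1.comp x (contDiffAt_id.sub contDiffAt_const)
  have h2 : extrapolate c N e v h =
      ∑ l ∈ Finset.Icc 1 N, (c l) • fun y => v (y - (l * h) • e) := by
    ext y; simp [extrapolate]
  rw [h2, iteratedFDeriv_sum_apply (f := fun l => c l • fun y => v (y - (l * h) • e))
    fun l hl => (h1 l hl).const_smul _]
  refine Finset.sum_congr rfl fun l hl => ?_
  rw [iteratedFDeriv_const_smul_apply (h1 l hl), iteratedFDeriv_comp_sub]

/-- Halving the step length of the extrapolation changes its `q`-th derivative by
`O(ε h ^ (M - q))` only, where `ε` bounds the oscillation of the `M`-th derivative of `v`. -/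
theorem norm_iteratedFDeriv_extrapolate_sub_le (hδ : Continuous δ)
    (hδe : ∀ x t, δ (x - t • e) = δ x - t) (he : ‖e‖ ≤ 1)
    (hc : ∀ i < N, ∀ a h : ℝ, ∑ l ∈ Finset.Icc 1 N, c l * (l * h - a) ^ i = (-a) ^ i)
    (hv : ContDiffOn ℝ M v {x | δ x < 0}) (hMN : M < N) (hh : 0 < h) (hε : 0 ≤ ε)
    (hosc : ∀ y y', δ y < 0 → δ y' < 0 → dist y y' ≤ N * h →
      ‖iteratedFDeriv ℝ M v y - iteratedFDeriv ℝ M v y'‖ ≤ ε)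
    {q : ℕ} (hq : q ≤ M) (hx : δ x < h / 2) :
    ‖iteratedFDeriv ℝ q (fun y => extrapolate c N e v (h / 2) y - extrapolate c N e v h y) x‖
      ≤ 2 * (∑ l ∈ Finset.Icc 1 N, |c l|) * ε * (N * h) ^ (M - q) := by
  obtain ⟨s, rfl⟩ := Nat.exists_eq_add_of_le hq
  have hxh : δ x < h := by linarith
  have hsub := iteratedFDeriv_sub_apply
    ((contDiffAt_extrapolate (c := c) (N := N) hδ hδe hv hx (half_pos hh)).of_le
      (by exact_mod_cast hq : (q : WithTop ℕ∞) ≤ ((q + s : ℕ) : WithTop ℕ∞)))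
    ((contDiffAt_extrapolate (c := c) (N := N) hδ hδe hv hxh hh).of_le
      (by exact_mod_cast hq : (q : WithTop ℕ∞) ≤ ((q + s : ℕ) : WithTop ℕ∞)))
  rw [iteratedFDeriv_extrapolate hδ hδe hv hx (half_pos hh) hq,
    iteratedFDeriv_extrapolate hδ hδe hv hxh hh hq, ← Finset.sum_sub_distrib] at hsub
  have hfun : (fun y => extrapolate c N e v (h / 2) y - extrapolate c N e v h y) =
      extrapolate c N e v (h / 2) - extrapolate c N e v h := rfl
  rw [hfun, hsub, Nat.add_sub_cancel_left]
  refine ContinuousMultilinearMap.opNorm_le_bound (by positivity) fun m => ?_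
  let mm : (i : ℕ) → Fin (q + i) → E := fun i => Nat.rec m (fun _ f => Fin.cons (-e) f) i
  have hmm : ∀ i, ∏ k, ‖mm i k‖ ≤ ∏ k, ‖m k‖ := by
    intro i
    induction i with
    | zero => exact le_rfl
    | succ i ih =>
      have : ∏ k, ‖mm (i + 1) k‖ = ‖-e‖ * ∏ k, ‖mm i k‖ := by
        change ∏ k : Fin (q + i + 1), ‖(Fin.cons (-e) (mm i) : Fin (q + i + 1) → E) k‖ = _
        rw [Fin.prod_univ_succ]; simp
      rw [this, norm_neg]
      exact (mul_le_of_le_one_left (Finset.prod_nonneg fun _ _ => norm_nonneg _) he).trans ih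
  let w : ℕ → ℝ → W := fun i t => iteratedFDeriv ℝ (q + i) v (x - t • e) (mm i)
  have hmem : ∀ t ∈ Icc (h / 2) (N * h), δ (x - t • e) < 0 := fun t ht => by
    rw [hδe]; linarith [ht.1]
  have hN : (1 : ℝ) ≤ N := by exact_mod_cast (by omega : 1 ≤ N)
  have key := norm_extrapolation_sub_le hc (s := s) (by omega) hh (ε := ε * ∏ k, ‖m k‖)
    (by positivity) w (fun i hi t ht => ?_) (fun t ht => ?_)
  · have heq : (∑ l ∈ Finset.Icc 1 N, (c l • iteratedFDeriv ℝ q v (x - (l * (h / 2)) • e) -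
        c l • iteratedFDeriv ℝ q v (x - (l * h) • e))) m =
        ∑ l ∈ Finset.Icc 1 N, c l • (w 0 (l * (h / 2)) - w 0 (l * h)) := by
      rw [_root_.sum_apply]
      refine Finset.sum_congr rfl fun l _ => ?_
      rw [smul_sub]
      rfl
    rw [heq]
    refine key.trans (le_of_eq ?_)
    ring
  · have hd : DifferentiableAt ℝ (iteratedFDeriv ℝ (q + i) v) (x - t • e) :=
      (hv.contDiffAt ((isOpen_lt hδ continuous_const).mem_nhds
        (hmem t ht))).differentiableAt_iteratedFDeriv
        (by exact_mod_cast (by omega : q + i < q + s))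
    have h1 : HasDerivAt (fun t : ℝ => x - t • e) (-e) t := by
      simpa using ((hasDerivAt_id t).smul_const e).const_sub x
    have h2 := hd.hasFDerivAt.comp_hasDerivAt t h1
    have h3 := ((ContinuousMultilinearMap.apply ℝ (fun _ : Fin (q + i) => E) W
      (mm i)).hasFDerivAt).comp_hasDerivAt t h2
    refine HasDerivAt.hasDerivWithinAt ?_
    refine h3.congr_deriv ?_
    exact (iteratedFDeriv_succ_apply_left (Fin.cons (-e) (mm i))).symm
  · have ha : h / 2 ∈ Icc (h / 2) (N * h) := ⟨le_rfl, by nlinarith⟩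
    have hdist : dist (x - t • e) (x - (h / 2) • e) ≤ N * h := by
      rw [dist_sub_left, dist_eq_norm, ← sub_smul, norm_smul, Real.norm_eq_abs,
        abs_of_nonneg (by linarith [ht.1])]
      calc (t - h / 2) * ‖e‖ ≤ (t - h / 2) * 1 := by
            gcongr; linarith [ht.1]
        _ ≤ N * h := by linarith [ht.2]
    have := hosc _ _ (hmem t ht) (hmem _ ha) hdist
    calc ‖w s t - w s (h / 2)‖ = ‖(iteratedFDeriv ℝ (q + s) v (x - t • e) -
          iteratedFDeriv ℝ (q + s) v (x - (h / 2) • e)) (mm s)‖ := rfl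
      _ ≤ ‖iteratedFDeriv ℝ (q + s) v (x - t • e) -
          iteratedFDeriv ℝ (q + s) v (x - (h / 2) • e)‖ * ∏ k, ‖mm s k‖ :=
        ContinuousMultilinearMap.le_opNorm _ _
      _ ≤ ε * ∏ k, ‖m k‖ := by
        gcongr
        exact hmm s

/-- Extrapolations with different small step lengths have nearby derivatives. -/
theorem norm_iteratedFDeriv_extrapolate_sub_le_of_le (hδ : Continuous δ)
    (hδe : ∀ x t, δ (x - t • e) = δ x - t) (he : ‖e‖ ≤ 1)
    (hv : ContDiffOn ℝ M v {x | δ x < 0}) {q : ℕ} (hq : q ≤ M) {h' : ℝ} (hh' : 0 < h')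
    (hle : h' ≤ h)
    (hosc : ∀ y y', δ y < 0 → δ y' < 0 → dist y y' ≤ N * h →
      ‖iteratedFDeriv ℝ q v y - iteratedFDeriv ℝ q v y'‖ ≤ ε)
    (hx : δ x < h') :
    ‖iteratedFDeriv ℝ q (extrapolate c N e v h') x -
      iteratedFDeriv ℝ q (extrapolate c N e v h) x‖ ≤ (∑ l ∈ Finset.Icc 1 N, |c l|) * ε := by
  rw [iteratedFDeriv_extrapolate hδ hδe hv hx hh' hq,
    iteratedFDeriv_extrapolate hδ hδe hv (hx.trans_le hle) (hh'.trans_le hle) hq,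
    ← Finset.sum_sub_distrib, Finset.sum_mul]
  refine norm_sum_le_of_le _ fun l hl => ?_
  rw [← smul_sub, norm_smul, Real.norm_eq_abs]
  gcongr
  refine hosc _ _ (shift_lt_zero hδe hx hh' hl)
    (shift_lt_zero hδe (hx.trans_le hle) (hh'.trans_le hle) hl) ?_
  have hl1 : (l : ℝ) ≤ N := by exact_mod_cast (Finset.mem_Icc.1 hl).2
  rw [dist_sub_left, dist_eq_norm, ← sub_smul, norm_smul, ← mul_sub, norm_mul, Real.norm_natCast,
    Real.norm_of_nonpos (by linarith)]
  calc (l : ℝ) * -(h' - h) * ‖e‖ ≤ N * h * 1 := by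
        gcongr
        · have := hh'.trans_le hle
          positivity
        all_goals linarith
    _ = N * h := mul_one _

end Layers

section LayerSum

variable {E W : Type*} [NormedAddCommGroup E] [NormedSpace ℝ E]
  [NormedAddCommGroup W] [NormedSpace ℝ W]

/-- The correction that replaces the extrapolation of step length `2⁻ʲ` by the one of step length
`2⁻ʲ⁻¹` in the layer where the cutoff `η j` equals `1`. -/
noncomputable def layerTerm (c : ℕ → ℝ) (N : ℕ) (e : E) (v : E → W) (η : ℕ → E → ℝ)
    (j : ℕ) (x : E) : W :=
  η j x • (extrapolate c N e v ((1 / 2) ^ j / 2) x - extrapolate c N e v ((1 / 2) ^ j) x)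

/-- The function that equals the extrapolation of step length comparable to the height above the
boundary, as long as this height is at least of the order `2⁻ᴶ`. -/
noncomputable def layerSum (c : ℕ → ℝ) (N : ℕ) (e : E) (v : E → W) (η : ℕ → E → ℝ)
    (J : ℕ) (x : E) : W :=
  extrapolate c N e v 1 x + ∑ j ∈ Finset.range J, layerTerm c N e v η j x

variable {c : ℕ → ℝ} {N M : ℕ} {e : E} {v : E → W} {η : ℕ → E → ℝ} {δ : E → ℝ} {x : E} {j J : ℕ}

theorem layerTerm_eventuallyEq_zero (hδ : Continuous δ)
    (hη0 : ∀ j x, 3 * (1 / 2) ^ j / 8 ≤ δ x → η j x = 0) (hx : (1 / 2) ^ j / 2 ≤ δ x) :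
    layerTerm c N e v η j =ᶠ[𝓝 x] 0 := by
  have hpos : (0 : ℝ) < (1 / 2) ^ j := by positivity
  have h1 : 3 * (1 / 2) ^ j / 8 < δ x := by linarith
  filter_upwards [(isOpen_lt continuous_const hδ).mem_nhds h1] with y hy
  simp only [layerTerm, hη0 j y (le_of_lt hy), zero_smul, Pi.zero_apply]

theorem contDiffAt_layerTerm (hδ : Continuous δ) (hδe : ∀ x t, δ (x - t • e) = δ x - t)
    (hηs : ∀ j, ContDiff ℝ ∞ (η j)) (hη0 : ∀ j x, 3 * (1 / 2) ^ j / 8 ≤ δ x → η j x = 0)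
    (hv : ContDiffOn ℝ M v {x | δ x < 0}) (j : ℕ) (x : E) :
    ContDiffAt ℝ M (layerTerm c N e v η j) x := by
  rcases lt_or_ge (δ x) ((1 / 2) ^ j / 2) with hx | hx
  · have hpos : (0 : ℝ) < (1 / 2) ^ j := by positivity
    exact ((hηs j).contDiffAt.of_le (by exact_mod_cast le_top)).smul
      ((contDiffAt_extrapolate hδ hδe hv hx (half_pos hpos)).sub
        (contDiffAt_extrapolate hδ hδe hv (by linarith) hpos))
  · exact contDiffAt_const.congr_of_eventuallyEq (layerTerm_eventuallyEq_zero hδ hη0 hx)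

theorem contDiffAt_layerSum (hδ : Continuous δ) (hδe : ∀ x t, δ (x - t • e) = δ x - t)
    (hηs : ∀ j, ContDiff ℝ ∞ (η j)) (hη0 : ∀ j x, 3 * (1 / 2) ^ j / 8 ≤ δ x → η j x = 0)
    (hv : ContDiffOn ℝ M v {x | δ x < 0}) (J : ℕ) (hx : δ x < 1 / 2) :
    ContDiffAt ℝ M (layerSum c N e v η J) x :=
  (contDiffAt_extrapolate hδ hδe hv (by linarith) one_pos).add
    (ContDiffAt.sum fun j _ => contDiffAt_layerTerm hδ hδe hηs hη0 hv j x)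

/-- Below the height `2⁻ᴶ⁻¹` all corrections are fully switched on, and the sum telescopes. -/
theorem layerSum_eventuallyEq_extrapolate (hδ : Continuous δ)
    (hη1 : ∀ j x, δ x ≤ (1 / 2) ^ j / 4 → η j x = 1) (hx : δ x < (1 / 2) ^ J / 2) :
    layerSum c N e v η J =ᶠ[𝓝 x] extrapolate c N e v ((1 / 2) ^ J) := by
  filter_upwards [(isOpen_lt hδ continuous_const).mem_nhds hx] with y hy
  have h1 : ∀ j ∈ Finset.range J, layerTerm c N e v η j y =
      extrapolate c N e v ((1 / 2) ^ (j + 1)) y - extrapolate c N e v ((1 / 2) ^ j) y := by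
    intro j hj
    have h2 : ((1 : ℝ) / 2) ^ J ≤ (1 / 2) ^ (j + 1) :=
      pow_le_pow_of_le_one (by norm_num) (by norm_num) (Finset.mem_range.1 hj)
    have h3 : ((1 : ℝ) / 2) ^ (j + 1) = (1 / 2) ^ j / 2 := by ring
    have hy' : δ y < (1 / 2) ^ J / 2 := hy
    rw [layerTerm, hη1 j y (by linarith), one_smul, h3]
  rw [layerSum, Finset.sum_congr rfl h1,
    Finset.sum_range_sub (fun j => extrapolate c N e v ((1 / 2) ^ j) y)]
  simp

/-- Each point has a neighbourhood in which at most one correction is switched on partially. -/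
theorem layerSum_eventuallyEq (hδ : Continuous δ)
    (hη1 : ∀ j x, δ x ≤ (1 / 2) ^ j / 4 → η j x = 1)
    (hη0 : ∀ j x, 3 * (1 / 2) ^ j / 8 ≤ δ x → η j x = 0) {J' : ℕ} (hJ : J ≤ J')
    (hx : δ x < (1 / 2) ^ J / 2) : δ x < (1 / 2) ^ J' / 2 ∨
      ∃ j, J ≤ j ∧ δ x < (1 / 2) ^ j / 2 ∧ layerSum c N e v η J' =ᶠ[𝓝 x]
        extrapolate c N e v ((1 / 2) ^ j) + layerTerm c N e v η j := by
  induction J', hJ using Nat.le_induction with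
  | base => exact Or.inl hx
  | succ J' hJ ih =>
    rcases lt_or_ge (δ x) ((1 / 2) ^ (J' + 1) / 2) with h | h
    · exact Or.inl h
    have hs : layerSum c N e v η (J' + 1) = layerSum c N e v η J' + layerTerm c N e v η J' := by
      ext y; simp [layerSum, Finset.sum_range_succ, add_assoc]
    rcases lt_or_ge (δ x) ((1 / 2) ^ J' / 2) with h' | h'
    · refine Or.inr ⟨J', hJ, h', ?_⟩
      rw [hs]
      exact (layerSum_eventuallyEq_extrapolate hδ hη1 h').add EventuallyEq.rfl
    · rcases ih with h3 | ⟨j, hj, hxj, hE⟩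
      · linarith
      · refine Or.inr ⟨j, hj, hxj, ?_⟩
        have h0 : layerTerm c N e v η J' =ᶠ[𝓝 x] 0 := layerTerm_eventuallyEq_zero hδ hη0 h'
        rw [hs]
        simpa using hE.add h0

theorem layerSum_eventuallyEq_of_le (hδ : Continuous δ)
    (hη0 : ∀ j x, 3 * (1 / 2) ^ j / 8 ≤ δ x → η j x = 0) {J' : ℕ} (hJ : J ≤ J')
    (hx : (1 / 2) ^ J / 2 ≤ δ x) :
    layerSum c N e v η J' =ᶠ[𝓝 x] layerSum c N e v η J := by
  induction J', hJ using Nat.le_induction with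
  | base => exact EventuallyEq.rfl
  | succ J' hJ ih =>
    have hs : layerSum c N e v η (J' + 1) = layerSum c N e v η J' + layerTerm c N e v η J' := by
      ext y; simp [layerSum, Finset.sum_range_succ, add_assoc]
    have h2 : ((1 : ℝ) / 2) ^ J' ≤ (1 / 2) ^ J :=
      pow_le_pow_of_le_one (by norm_num) (by norm_num) hJ
    have h0 : layerTerm c N e v η J' =ᶠ[𝓝 x] 0 :=
      layerTerm_eventuallyEq_zero hδ hη0 (by linarith)
    rw [hs]
    simpa using ih.add h0

/-- The derivatives of order at most `M` of the corrections are bounded by the oscillation of the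
`M`-th derivative of `v`: the powers of `2ʲ` produced by the cutoff are compensated by the
accuracy of the extrapolation. -/
theorem exists_norm_iteratedFDeriv_layerTerm_le (hδ : Continuous δ)
    (hδe : ∀ x t, δ (x - t • e) = δ x - t) (he : ‖e‖ ≤ 1)
    (hc : ∀ i < N, ∀ a h : ℝ, ∑ l ∈ Finset.Icc 1 N, c l * (l * h - a) ^ i = (-a) ^ i)
    (hηs : ∀ j, ContDiff ℝ ∞ (η j)) {C : ℕ → ℝ} (hC0 : ∀ i, 0 ≤ C i)
    (hηb : ∀ j i x, ‖iteratedFDeriv ℝ i (η j) x‖ ≤ C i * ((1 / 2 : ℝ) ^ j)⁻¹ ^ i)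
    (hv : ContDiffOn ℝ M v {x | δ x < 0}) (hMN : M < N) :
    ∃ B : ℝ, 0 ≤ B ∧ ∀ (j : ℕ) (ε : ℝ), 0 ≤ ε →
      (∀ y y', δ y < 0 → δ y' < 0 → dist y y' ≤ N * (1 / 2) ^ j →
        ‖iteratedFDeriv ℝ M v y - iteratedFDeriv ℝ M v y'‖ ≤ ε) →
      ∀ q ≤ M, ∀ x, δ x < (1 / 2) ^ j / 2 →
        ‖iteratedFDeriv ℝ q (layerTerm c N e v η j) x‖ ≤ B * ε := by
  let A := 2 * (∑ l ∈ Finset.Icc 1 N, |c l|)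
  let B : ℕ → ℝ := fun q => ∑ i ∈ Finset.range (q + 1), (q.choose i : ℝ) * C i * (A * N ^ M)
  have hA : 0 ≤ A := by positivity
  have hB : ∀ q, 0 ≤ B q := fun q => Finset.sum_nonneg fun i _ => by
    have := hC0 i; positivity
  have hN : (1 : ℝ) ≤ N := by exact_mod_cast (by omega : 1 ≤ N)
  refine ⟨∑ q ∈ Finset.range (M + 1), B q, Finset.sum_nonneg fun q _ => hB q,
    fun j ε hε hosc q hq x hx => ?_⟩
  set h : ℝ := (1 / 2) ^ j with hh
  have hpos : 0 < h := by positivity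
  have hle : h ≤ 1 := pow_le_one₀ (by norm_num) (by norm_num)
  have hd : ContDiffAt ℝ q
      (fun y => extrapolate c N e v (h / 2) y - extrapolate c N e v h y) x :=
    ((contDiffAt_extrapolate hδ hδe hv hx (half_pos hpos)).sub
      (contDiffAt_extrapolate hδ hδe hv (by linarith) hpos)).of_le (by exact_mod_cast hq)
  have hBq : B q ≤ ∑ q ∈ Finset.range (M + 1), B q :=
    Finset.single_le_sum (fun q _ => hB q) (Finset.mem_range.2 (by omega))
  refine (norm_iteratedFDeriv_smul_le_of_contDiffAt
    ((hηs j).contDiffAt.of_le (by exact_mod_cast le_top)) hd).trans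
    (le_trans ?_ (mul_le_mul_of_nonneg_right hBq hε))
  rw [Finset.sum_mul]
  refine Finset.sum_le_sum fun i hi => ?_
  have hiq : i ≤ q := by have := Finset.mem_range.1 hi; omega
  have h1 := norm_iteratedFDeriv_extrapolate_sub_le hδ hδe he hc hv hMN hpos hε hosc
    (q := q - i) (by omega) hx
  have h2 : (h⁻¹) ^ i * (N * h) ^ (M - (q - i)) ≤ (N : ℝ) ^ M := by
    obtain ⟨k, hk⟩ : ∃ k, M - (q - i) = i + k := ⟨M - (q - i) - i, by omega⟩
    rw [hk, mul_pow, pow_add h, ← mul_assoc, mul_comm (h⁻¹ ^ i), mul_assoc, ← mul_assoc (h⁻¹ ^ i),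
      ← mul_pow, inv_mul_cancel₀ hpos.ne', one_pow, one_mul]
    calc (N : ℝ) ^ (i + k) * h ^ k ≤ N ^ M * 1 := by
          gcongr
          · omega
          · exact pow_le_one₀ hpos.le hle
      _ = N ^ M := mul_one _
  have h0 := hC0 i
  calc (q.choose i : ℝ) * ‖iteratedFDeriv ℝ i (η j) x‖ * _
      ≤ (q.choose i : ℝ) * (C i * h⁻¹ ^ i) * (A * ε * (N * h) ^ (M - (q - i))) := by
        gcongr
        exact hηb j i x
    _ = (q.choose i : ℝ) * C i * A * ε * (h⁻¹ ^ i * (N * h) ^ (M - (q - i))) := by ring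
    _ ≤ (q.choose i : ℝ) * C i * A * ε * N ^ M := by gcongr
    _ = _ := by ring

end LayerSum

section Extension

variable {E W : Type*} [NormedAddCommGroup E] [NormedSpace ℝ E] [FiniteDimensional ℝ E]
  [NormedAddCommGroup W] [NormedSpace ℝ W] [CompleteSpace W]

theorem eventually_mul_half_pow_le (N : ℕ) {ρ : ℝ} (hρ : 0 < ρ) :
    ∃ J₀ : ℕ, ∀ J ≥ J₀, (N : ℝ) * (1 / 2) ^ J ≤ ρ := by
  have h1 : Tendsto (fun J : ℕ => (N : ℝ) * (1 / 2) ^ J) atTop (𝓝 (N * 0)) :=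
    (tendsto_pow_atTop_nhds_zero_of_lt_one (by norm_num) (by norm_num)).const_mul _
  rw [mul_zero] at h1
  exact eventually_atTop.1 (h1.eventually (ge_mem_nhds hρ))

/-- A function on `{δ < 0}` whose derivatives of order at most `m` are uniformly continuous extends
to `{δ < 1 / 2}` as a function of class `C^m`. If moreover the derivative of order `m + 1` exists
and is bounded, then the derivative of order `m` of the extension is Lipschitz. Here `δ` is to be
thought of as the height above the graph of a Lipschitz function, in the direction `e`. -/
theorem exists_extension_of_uniformContinuous {δ : E → ℝ} {e : E} {K : NNReal} {v : E → W} {m : ℕ}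
    (hδL : LipschitzWith K δ) (hδe : ∀ x t, δ (x - t • e) = δ x - t) (he : ‖e‖ ≤ 1)
    (hv : ContDiffOn ℝ m v {x | δ x < 0})
    (hunif : ∀ q ≤ m, ∀ ε > 0, ∃ ρ > 0, ∀ y y', δ y < 0 → δ y' < 0 → dist y y' ≤ ρ →
      ‖iteratedFDeriv ℝ q v y - iteratedFDeriv ℝ q v y'‖ ≤ ε) :
    ∃ F : E → W, ContDiffOn ℝ m F {x | δ x < 1 / 2} ∧ (∀ x, δ x < 0 → F x = v x) ∧
      ∀ C, ContDiffOn ℝ (m + 1 : ℕ) v {x | δ x < 0} →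
        (∀ x, δ x < 0 → ‖iteratedFDeriv ℝ (m + 1) v x‖ ≤ C) →
        ∃ C' : NNReal, ∀ s, Convex ℝ s → s ⊆ {x | δ x < 1 / 2} →
          LipschitzOnWith C' (iteratedFDeriv ℝ m F) s := by
  have hδ := hδL.continuous
  -- annihilating polynomials of degree `m + 1` serves the Lipschitz case
  obtain ⟨c, hc⟩ := exists_extrapolation_weights (m + 2)
  obtain ⟨D, hD0, hD⟩ := exists_cutoff (G := E) K
  choose η hηs hη1 hη0 hηb using fun j : ℕ => hD δ hδL ((1 / 2) ^ j) (by positivity)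
  set N := m + 2 with hN
  have hN1 : (1 : ℝ) ≤ N := by exact_mod_cast (by omega : 1 ≤ N)
  have hO : IsOpen {x | δ x < 1 / 2} := isOpen_lt hδ continuous_const
  let S : ℕ → E → W := layerSum c N e v η
  let A := ∑ l ∈ Finset.Icc 1 N, |c l|
  have hA : 0 ≤ A := Finset.sum_nonneg fun _ _ => abs_nonneg _
  have hp : ∀ J : ℕ, (0 : ℝ) < (1 / 2) ^ J := fun J => by positivity
  have hanti : ∀ {J J' : ℕ}, J ≤ J' → ((1 : ℝ) / 2) ^ J' ≤ (1 / 2) ^ J := fun h =>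
    pow_le_pow_of_le_one (by norm_num) (by norm_num) h
  have hSm : ∀ J, ContDiffOn ℝ m (S J) {x | δ x < 1 / 2} := fun J x hx =>
    (contDiffAt_layerSum hδ hδe hηs hη0 hv J hx).contDiffWithinAt
  obtain ⟨B, hB0, hB⟩ := exists_norm_iteratedFDeriv_layerTerm_le hδ hδe he hc hηs hD0 hηb hv
    (by omega)
  have hclose : ∀ q ≤ m, ∀ ε > 0, ∃ J₀, ∀ J ≥ J₀, ∀ J' ≥ J, ∀ x, δ x < 1 / 2 →
      ‖iteratedFDeriv ℝ q (S J') x - iteratedFDeriv ℝ q (S J) x‖ ≤ (A + B) * ε := by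
    intro q hq ε hε
    obtain ⟨ρ, hρ, h1⟩ := hunif q hq ε hε
    obtain ⟨ρ', hρ', h1'⟩ := hunif m le_rfl ε hε
    obtain ⟨J₀, hJ₀⟩ := eventually_mul_half_pow_le N (lt_min hρ hρ')
    refine ⟨J₀, fun J hJ J' hJ' x hx => ?_⟩
    have hosc : ∀ j ≥ J, ∀ y y', δ y < 0 → δ y' < 0 → dist y y' ≤ N * (1 / 2) ^ j →
        ‖iteratedFDeriv ℝ q v y - iteratedFDeriv ℝ q v y'‖ ≤ ε := fun j hj y y' hy hy' hd =>
      h1 y y' hy hy' (hd.trans ((hJ₀ j (le_trans hJ hj)).trans (min_le_left _ _)))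
    have hosc' : ∀ j ≥ J, ∀ y y', δ y < 0 → δ y' < 0 → dist y y' ≤ N * (1 / 2) ^ j →
        ‖iteratedFDeriv ℝ m v y - iteratedFDeriv ℝ m v y'‖ ≤ ε := fun j hj y y' hy hy' hd =>
      h1' y y' hy hy' (hd.trans ((hJ₀ j (le_trans hJ hj)).trans (min_le_right _ _)))
    rcases lt_or_ge (δ x) ((1 / 2) ^ J / 2) with h | h
    · rw [((layerSum_eventuallyEq_extrapolate hδ hη1 h).iteratedFDeriv ℝ q).eq_of_nhds]
      have hcmp : ∀ j ≥ J, δ x < (1 / 2) ^ j / 2 →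
          ‖iteratedFDeriv ℝ q (extrapolate c N e v ((1 / 2) ^ j)) x -
            iteratedFDeriv ℝ q (extrapolate c N e v ((1 / 2) ^ J)) x‖ ≤ A * ε :=
        fun j hj hxj => norm_iteratedFDeriv_extrapolate_sub_le_of_le hδ hδe he hv hq (hp j) (hanti hj)
          (hosc J le_rfl) (by linarith [hp j])
      rcases layerSum_eventuallyEq (c := c) (N := N) (e := e) (v := v) hδ hη1 hη0 hJ' h with
        h3 | ⟨j, hj, hxj, hE⟩
      · rw [((layerSum_eventuallyEq_extrapolate hδ hη1 h3).iteratedFDeriv ℝ q).eq_of_nhds]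
        refine (hcmp J' hJ' h3).trans ?_
        gcongr
        linarith
      · rw [(hE.iteratedFDeriv ℝ q).eq_of_nhds, iteratedFDeriv_add_apply
          ((contDiffAt_extrapolate hδ hδe hv (by linarith [hp j]) (hp j)).of_le
            (by exact_mod_cast hq))
          ((contDiffAt_layerTerm hδ hδe hηs hη0 hv j x).of_le (by exact_mod_cast hq)),
          add_sub_right_comm, add_mul]
        exact (norm_add_le _ _).trans (add_le_add (hcmp j hj hxj)
          (hB j ε hε.le (hosc' j hj) q hq x hxj))
    · rw [((layerSum_eventuallyEq_of_le hδ hη0 hJ' h).iteratedFDeriv ℝ q).eq_of_nhds, sub_self,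
        norm_zero]
      positivity
  obtain ⟨F, hF, hFlim, hFm⟩ := exists_contDiffOn_of_uniformCauchySeqOn hO hSm fun q hq => by
    rw [Metric.uniformCauchySeqOn_iff]
    intro ε hε
    obtain ⟨J₀, hJ₀⟩ := hclose q hq (ε / (4 * (A + B + 1))) (by positivity)
    have hlt : (A + B) * (ε / (4 * (A + B + 1))) ≤ ε / 4 := by
      rw [mul_div_assoc', div_le_div_iff₀ (by positivity) (by norm_num)]
      nlinarith
    refine ⟨J₀, fun J hJ J' hJ' x hx => ?_⟩
    have h1 := (hJ₀ J₀ le_rfl J hJ x hx).trans hlt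
    have h2 := (hJ₀ J₀ le_rfl J' hJ' x hx).trans hlt
    rw [← dist_eq_norm] at h1 h2
    linarith [dist_triangle_right (iteratedFDeriv ℝ q (S J) x) (iteratedFDeriv ℝ q (S J') x)
      (iteratedFDeriv ℝ q (S J₀) x)]
  refine ⟨F, hF, fun x hx => ?_, fun C hv' hC => ?_⟩
  · refine tendsto_nhds_unique (hFlim x (show δ x < 1 / 2 by linarith)) ?_
    rw [Metric.tendsto_atTop]
    intro ε hε
    obtain ⟨ρ, hρ, h1⟩ := hunif 0 (Nat.zero_le m) (ε / (A + 1)) (by positivity)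
    obtain ⟨J₀, hJ₀⟩ := eventually_mul_half_pow_le N hρ
    refine ⟨J₀, fun J hJ => ?_⟩
    have h2 : S J x = extrapolate c N e v ((1 / 2) ^ J) x :=
      (layerSum_eventuallyEq_extrapolate hδ hη1 (by linarith [hp J])).eq_of_nhds
    have hsum : ∑ l ∈ Finset.Icc 1 N, c l = 1 := by simpa using hc 0 (by omega) 0 0
    have h3 : v x = ∑ l ∈ Finset.Icc 1 N, c l • v x := by rw [← Finset.sum_smul, hsum, one_smul]
    rw [dist_eq_norm, h2, extrapolate]
    rw [h3, ← Finset.sum_sub_distrib]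
    have h4 : ‖∑ l ∈ Finset.Icc 1 N, (c l • v (x - (l * (1 / 2) ^ J : ℝ) • e) - c l • v x)‖ ≤
        ∑ l ∈ Finset.Icc 1 N, |c l| * (ε / (A + 1)) := by
      refine norm_sum_le_of_le _ fun l hl => ?_
      rw [← smul_sub, norm_smul, Real.norm_eq_abs]
      gcongr
      have hl1 : (l : ℝ) ≤ N := by exact_mod_cast (Finset.mem_Icc.1 hl).2
      have h5 := h1 (x - (l * (1 / 2) ^ J : ℝ) • e) x
        (shift_lt_zero hδe (hx.trans (hp J)) (hp J) hl) hx ?_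
      · have h6 : iteratedFDeriv ℝ 0 v (x - (l * (1 / 2) ^ J : ℝ) • e) - iteratedFDeriv ℝ 0 v x =
            iteratedFDeriv ℝ 0 (fun _ : E => v (x - (l * (1 / 2) ^ J : ℝ) • e) - v x) x := by
          ext; simp
        rwa [h6, norm_iteratedFDeriv_zero] at h5
      · rw [dist_eq_norm, sub_sub_cancel_left, norm_neg, norm_smul, Real.norm_of_nonneg
          (by have := hp J; positivity)]
        calc (l : ℝ) * (1 / 2) ^ J * ‖e‖ ≤ N * (1 / 2) ^ J * 1 := by gcongr
          _ ≤ ρ := by rw [mul_one]; exact hJ₀ J hJ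
    refine h4.trans_lt ?_
    rw [← Finset.sum_mul, mul_div_assoc', div_lt_iff₀ (by positivity)]
    change A * ε < ε * (A + 1)
    nlinarith
  · obtain ⟨B', hB0', hB'⟩ := exists_norm_iteratedFDeriv_layerTerm_le hδ hδe he hc hηs hD0 hηb hv'
      (by omega)
    have hCa : ∀ x, δ x < 0 → ‖iteratedFDeriv ℝ (m + 1) v x‖ ≤ |C| := fun x hx =>
      (hC x hx).trans (le_abs_self C)
    have hex : ∀ j x, δ x < (1 / 2) ^ j / 2 →
        ‖iteratedFDeriv ℝ (m + 1) (extrapolate c N e v ((1 / 2) ^ j)) x‖ ≤ A * |C| := by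
      intro j x hx
      have hx' : δ x < (1 / 2) ^ j := by linarith [hp j]
      rw [iteratedFDeriv_extrapolate hδ hδe hv' hx' (hp j) le_rfl, Finset.sum_mul]
      refine norm_sum_le_of_le _ fun l hl => ?_
      rw [norm_smul, Real.norm_eq_abs]
      gcongr
      exact hCa _ (shift_lt_zero hδe hx' (hp j) hl)
    have hbound : ∀ J x, δ x < 1 / 2 →
        ‖iteratedFDeriv ℝ (m + 1) (S J) x‖ ≤ A * |C| + B' * (2 * |C|) := by
      intro J x hx
      rcases layerSum_eventuallyEq (c := c) (N := N) (e := e) (v := v) (J := 0) hδ hη1 hη0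
        (Nat.zero_le J) (by simpa using hx) with h3 | ⟨j, hj, hxj, hE⟩
      · rw [((layerSum_eventuallyEq_extrapolate hδ hη1 h3).iteratedFDeriv ℝ (m + 1)).eq_of_nhds]
        have := hex J x h3
        have : 0 ≤ B' * (2 * |C|) := by positivity
        linarith
      · rw [(hE.iteratedFDeriv ℝ (m + 1)).eq_of_nhds, iteratedFDeriv_add_apply
          (contDiffAt_extrapolate hδ hδe hv' (by linarith [hp j]) (hp j))
          (contDiffAt_layerTerm hδ hδe hηs hη0 hv' j x)]
        refine (norm_add_le _ _).trans (add_le_add (hex j x hxj)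
          (hB' j (2 * |C|) (by positivity) (fun y y' hy hy' _ => ?_) (m + 1) le_rfl x hxj))
        exact (norm_sub_le _ _).trans (by linarith [hCa y hy, hCa y' hy'])
    have hC0 : 0 ≤ A * |C| + B' * (2 * |C|) := by positivity
    refine ⟨(A * |C| + B' * (2 * |C|)).toNNReal, fun s hs hsO => ?_⟩
    have hSL : ∀ J, LipschitzOnWith (A * |C| + B' * (2 * |C|)).toNNReal
        (iteratedFDeriv ℝ m (S J)) s := fun J => by
      refine hs.lipschitzOnWith_of_nnnorm_fderiv_le (𝕜 := ℝ) (fun x hx => ?_) fun x hx => ?_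
      · exact (contDiffAt_layerSum hδ hδe hηs hη0 hv' J (hsO hx)).differentiableAt_iteratedFDeriv
          (by exact_mod_cast Nat.lt_succ_self m)
      · rw [← NNReal.coe_le_coe, coe_nnnorm, Real.coe_toNNReal _ hC0, norm_fderiv_iteratedFDeriv]
        exact hbound J x (hsO hx)
    refine LipschitzOnWith.of_dist_le_mul fun x hx y hy => ?_
    refine le_of_tendsto ((hFm x (hsO hx)).dist (hFm y (hsO hy))) (Eventually.of_forall fun J => ?_)
    exact (hSL J).dist_le_mul x hx y hy

end Extension

/-! ### Differentiability on a closed Lipschitz subgraph -/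

section LipschitzSubgraph

variable {E W : Type*} [NormedAddCommGroup E] [NormedSpace ℝ E]
  [NormedAddCommGroup W] [NormedSpace ℝ W] {δ : E → ℝ} {e : E} {K : NNReal}

theorem lt_zero_of_mem_cone (hδL : LipschitzWith K δ) (hδe : ∀ x t, δ (x - t • e) = δ x - t)
    {y w : E} {t : ℝ} (hy : δ y ≤ 0) (hw : K * ‖w‖ < t) : δ (y + w - t • e) < 0 := by
  have h := hδL.dist_le_mul (y + w) y
  rw [dist_eq_norm (y + w), add_sub_cancel_left, Real.dist_eq] at h
  have := (abs_le.1 h).2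
  rw [hδe]
  linarith

/-- The closed sublevel set contains a cone with vertex at any of its points. -/
theorem uniqueDiffOn_sublevel (hδL : LipschitzWith K δ)
    (hδe : ∀ x t, δ (x - t • e) = δ x - t) : UniqueDiffOn ℝ {x | δ x ≤ 0} := by
  intro p hp
  have hr : (0 : ℝ) < 1 / (K + 1) := by positivity
  let B := Metric.ball (p - e) (1 / (K + 1))
  have hBne : B.Nonempty := ⟨p - e, Metric.mem_ball_self hr⟩
  have hsub : convexHull ℝ (insert p B) ⊆ {x | δ x ≤ 0} := by
    rw [convexHull_insert hBne, (convex_ball _ _).convexHull_eq]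
    intro y hy
    rw [mem_convexJoin] at hy
    obtain ⟨a, ha, b, hb, hy⟩ := hy
    rw [mem_singleton_iff] at ha
    subst ha
    rw [segment_eq_image'] at hy
    obtain ⟨s, hs, rfl⟩ := hy
    rcases hs.1.eq_or_lt with rfl | hs0
    · simpa using hp
    · have h1 : ‖b - (a - e)‖ < 1 / (K + 1) := by rw [← dist_eq_norm]; exact hb
      have h2 : a + s • (b - a) = a + s • (b - (a - e)) - s • e := by
        simp only [smul_sub]; abel
      have h3 : (K : ℝ) * ‖b - (a - e)‖ < 1 := by
        calc (K : ℝ) * ‖b - (a - e)‖ ≤ K * (1 / (K + 1)) := by gcongr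
          _ < 1 := by rw [mul_one_div, div_lt_one (by positivity)]; linarith
      change δ (a + s • (b - a)) ≤ 0
      rw [h2]
      refine le_of_lt (lt_zero_of_mem_cone hδL hδe hp ?_)
      rw [norm_smul, Real.norm_of_nonneg hs0.le]
      nlinarith
  refine (uniqueDiffWithinAt_convex (convex_convexHull ℝ _) ?_ ?_).mono hsub
  · refine ⟨p - e, mem_interior.2 ⟨B, (subset_insert _ _).trans (subset_convexHull ℝ _),
      Metric.isOpen_ball, Metric.mem_ball_self hr⟩⟩
  · exact subset_closure (subset_convexHull ℝ _ (mem_insert _ _))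

theorem norm_sub_sub_le_of_segment {u : E → W} {f' : E →L[ℝ] W} {y z : E} {ε : ℝ}
    (hc : ∀ s ∈ Icc (0 : ℝ) 1, ContinuousWithinAt u {x | δ x ≤ 0} (z + s • (y - z)))
    (hle : ∀ s ∈ Icc (0 : ℝ) 1, δ (z + s • (y - z)) ≤ 0)
    (hd : ∀ s ∈ Ico (0 : ℝ) 1, DifferentiableAt ℝ u (z + s • (y - z)))
    (hb : ∀ s ∈ Ico (0 : ℝ) 1, ‖fderiv ℝ u (z + s • (y - z)) - f'‖ ≤ ε) :
    ‖u y - u z - f' (y - z)‖ ≤ ε * ‖y - z‖ := by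
  let g : ℝ → W := fun s => u (z + s • (y - z)) - s • f' (y - z)
  have hline : ∀ s : ℝ, HasDerivAt (fun s : ℝ => z + s • (y - z)) (y - z) s := fun s => by
    simpa using ((hasDerivAt_id s).smul_const (y - z)).const_add z
  have hgc : ContinuousOn g (Icc 0 1) := by
    refine ContinuousOn.sub (fun s hs => ?_) (by fun_prop)
    exact ContinuousWithinAt.comp (f := fun s : ℝ => z + s • (y - z)) (hc s hs)
      (hline s).continuousAt.continuousWithinAt fun s hs => hle s hs
  have hgd : ∀ s ∈ Ico (0 : ℝ) 1,
      HasDerivWithinAt g ((fderiv ℝ u (z + s • (y - z)) - f') (y - z)) (Ici s) s := by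
    intro s hs
    have h1 := (hd s hs).hasFDerivAt.comp_hasDerivAt s (hline s)
    have h2 := (hasDerivAt_id s).smul_const (f' (y - z))
    exact ((h1.sub h2).congr_deriv (by simp)).hasDerivWithinAt
  have := norm_image_sub_le_of_norm_deriv_right_le_segment hgc hgd
    (fun s hs => (ContinuousLinearMap.le_opNorm _ _).trans
      (mul_le_mul_of_nonneg_right (hb s hs) (norm_nonneg _))) 1 (by simp)
  simp only [g, one_smul, add_sub_cancel, zero_smul, add_zero, sub_zero, mul_one] at this
  rwa [sub_right_comm]

/-- A continuous function on the closed sublevel set whose derivative in the open sublevel set has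
a limit at a boundary point is differentiable there. A point `y` is joined to the boundary point
`p` through the point `p - C |y - p| e`, which is well below the boundary. -/
theorem hasFDerivWithinAt_sublevel_of_tendsto (hδL : LipschitzWith K δ)
    (hδe : ∀ x t, δ (x - t • e) = δ x - t) (he : ‖e‖ ≤ 1) {u : E → W} {f' : E →L[ℝ] W} {p : E}
    (hp : δ p ≤ 0) (hc : ∀ᶠ x in 𝓝 p, δ x ≤ 0 → ContinuousWithinAt u {x | δ x ≤ 0} x)
    (hd : ∀ᶠ x in 𝓝 p, δ x < 0 → DifferentiableAt ℝ u x)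
    (hlim : Tendsto (fderiv ℝ u) (𝓝[{x | δ x < 0}] p) (𝓝 f')) :
    HasFDerivWithinAt u f' {x | δ x ≤ 0} p := by
  rw [hasFDerivWithinAt_iff_isLittleO, Asymptotics.isLittleO_iff]
  intro ε hε
  set R : ℝ := K + 2 with hR
  have hR2 : (2 : ℝ) ≤ R := by rw [hR]; linarith [K.2, NNReal.coe_nonneg K]
  have hε' : 0 < ε / (2 * R + 1) := by positivity
  have hb : ∀ᶠ x in 𝓝 p, δ x < 0 → ‖fderiv ℝ u x - f'‖ ≤ ε / (2 * R + 1) := by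
    have h1 := (Metric.tendsto_nhds.1 hlim) _ hε'
    rw [eventually_nhdsWithin_iff] at h1
    filter_upwards [h1] with x hx hx0
    have := hx hx0
    rw [dist_eq_norm] at this
    exact this.le
  obtain ⟨r, hr, hball⟩ := Metric.eventually_nhds_iff_ball.1 (hc.and (hd.and hb))
  have hr' : 0 < r / (2 * R + 1) := by positivity
  rw [eventually_nhdsWithin_iff]
  filter_upwards [Metric.ball_mem_nhds p hr'] with y hy hy0
  have hy0' : δ y ≤ 0 := hy0
  rcases eq_or_ne y p with rfl | hyp
  · simp
  set ρ := ‖y - p‖ with hρ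
  have hρ0 : 0 < ρ := norm_pos_iff.2 (sub_ne_zero.2 hyp)
  have hρr : ρ * (2 * R + 1) < r := by
    rw [← lt_div_iff₀ (by positivity)]
    simpa [dist_eq_norm] using hy
  set z := p - (R * ρ) • e with hz
  have hzp : ‖z - p‖ ≤ R * ρ := by
    rw [hz, sub_sub_cancel_left, norm_neg, norm_smul, Real.norm_of_nonneg (by positivity)]
    exact mul_le_of_le_one_right (by positivity) he
  have hyz : ‖y - z‖ ≤ (R + 1) * ρ := by
    calc ‖y - z‖ = ‖(y - p) - (z - p)‖ := by rw [sub_sub_sub_cancel_right]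
      _ ≤ ‖y - p‖ + ‖z - p‖ := norm_sub_le _ _
      _ ≤ ρ + R * ρ := by gcongr
      _ = _ := by ring
  have hseg : ∀ w : E, δ w ≤ 0 → ‖w - p‖ ≤ ρ → ‖w - z‖ ≤ (R + 1) * ρ →
      ‖u w - u z - f' (w - z)‖ ≤ ε / (2 * R + 1) * ‖w - z‖ := by
    intro w hw hwρ hwz
    have hlt : ∀ s ∈ Ico (0 : ℝ) 1, δ (z + s • (w - z)) < 0 := by
      intro s hs
      have h1 : z + s • (w - z) =
          w + (1 - s) • (p - w) - ((1 - s) * (R * ρ)) • e := by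
        rw [hz]; module
      rw [h1]
      refine lt_zero_of_mem_cone hδL hδe hw ?_
      have hs1 : 0 < 1 - s := by linarith [hs.2]
      rw [norm_smul, Real.norm_of_nonneg hs1.le, norm_sub_rev]
      have : (K : ℝ) * ‖w - p‖ < R * ρ := by
        calc (K : ℝ) * ‖w - p‖ ≤ K * ρ := by gcongr
          _ < R * ρ := by rw [hR]; nlinarith
      nlinarith
    have hmem : ∀ s ∈ Icc (0 : ℝ) 1, z + s • (w - z) ∈ Metric.ball p r := by
      intro s hs
      rw [Metric.mem_ball, dist_eq_norm]
      calc ‖z + s • (w - z) - p‖ = ‖(z - p) + s • (w - z)‖ := by congr 1; abel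
        _ ≤ ‖z - p‖ + ‖s • (w - z)‖ := norm_add_le _ _
        _ ≤ R * ρ + 1 * ((R + 1) * ρ) := by
          rw [norm_smul, Real.norm_of_nonneg hs.1]
          gcongr
          exact hs.2
        _ = ρ * (2 * R + 1) := by ring
        _ < r := hρr
    have hle : ∀ s ∈ Icc (0 : ℝ) 1, δ (z + s • (w - z)) ≤ 0 := by
      intro s hs
      rcases hs.2.eq_or_lt with rfl | h
      · simpa using hw
      · exact (hlt s ⟨hs.1, h⟩).le
    exact norm_sub_sub_le_of_segment (fun s hs => (hball _ (hmem s hs)).1 (hle s hs)) hle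
      (fun s hs => (hball _ (hmem s ⟨hs.1, hs.2.le⟩)).2.1 (hlt s hs))
      (fun s hs => (hball _ (hmem s ⟨hs.1, hs.2.le⟩)).2.2 (hlt s hs))
  have h1 := hseg y hy0' le_rfl hyz
  have h2 := hseg p hp (by simpa using hρ0.le) (by
    rw [norm_sub_rev]; exact hzp.trans (by nlinarith))
  have h3 : u y - u p - f' (y - p) =
      (u y - u z - f' (y - z)) - (u p - u z - f' (p - z)) := by
    simp only [map_sub]; abel
  rw [h3]
  calc _ ≤ _ := norm_sub_le _ _
    _ ≤ ε / (2 * R + 1) * ‖y - z‖ + ε / (2 * R + 1) * ‖p - z‖ := add_le_add h1 h2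
    _ ≤ ε / (2 * R + 1) * ((R + 1) * ρ) + ε / (2 * R + 1) * (R * ρ) := by
      gcongr
      rw [norm_sub_rev]; exact hzp
    _ = ε * ρ := by field_simp; ring

end LipschitzSubgraph

/-! ### Whitney's extension theorem near a point of the subgraph -/

section LocalExtension

theorem mem_nhds_sublevel {E : Type*} [TopologicalSpace E] {δ : E → ℝ} (hδ : Continuous δ)
    {x : E} (hx : δ x < 0) : {x | δ x ≤ 0} ∈ 𝓝 x :=
  mem_of_superset ((isOpen_lt hδ continuous_const).mem_nhds hx) fun _ (h : δ _ < 0) => h.le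

variable {E W : Type*} [NormedAddCommGroup E] [NormedSpace ℝ E]
  [NormedAddCommGroup W] [NormedSpace ℝ W] {δ : E → ℝ} {e : E} {K : NNReal}

/-- The open sublevel set accumulates at every point of the closed one. -/
theorem tendsto_sub_smul (hδe : ∀ x t, δ (x - t • e) = δ x - t) {x : E} (hx : δ x ≤ 0) :
    Tendsto (fun t : ℝ => x - t • e) (𝓝[>] 0) (𝓝[{x | δ x < 0}] x) := by
  refine tendsto_nhdsWithin_iff.2 ⟨?_, ?_⟩
  · have : Continuous fun t : ℝ => x - t • e := by fun_prop
    simpa using this.continuousAt.tendsto.mono_left (nhdsWithin_le_nhds (a := (0 : ℝ)) (s := Ioi 0))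
  · filter_upwards [self_mem_nhdsWithin] with t ht
    rw [hδe]
    linarith [show (0 : ℝ) < t from ht]

theorem nhdsWithin_neBot (hδe : ∀ x t, δ (x - t • e) = δ x - t) {x : E} (hx : δ x ≤ 0) :
    (𝓝[{x | δ x < 0}] x).NeBot :=
  (tendsto_sub_smul hδe hx).neBot

variable [FiniteDimensional ℝ E]

/-- The derivatives of a compactly supported function of class `C^m` on the closed sublevel set are
uniformly continuous. -/
theorem uniformContinuous_iteratedFDeriv_of_eq_zero (hδL : LipschitzWith K δ)
    (hδe : ∀ x t, δ (x - t • e) = δ x - t) {v : E → W} {m : ℕ} {p : E} {R : ℝ}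
    (hv : ContDiffOn ℝ m v {x | δ x ≤ 0}) (hR : ∀ x, R < dist x p → v =ᶠ[𝓝 x] 0)
    {q : ℕ} (hq : q ≤ m) {ε : ℝ} (hε : 0 < ε) :
    ∃ ρ > 0, ∀ y y', δ y < 0 → δ y' < 0 → dist y y' ≤ ρ →
      ‖iteratedFDeriv ℝ q v y - iteratedFDeriv ℝ q v y'‖ ≤ ε := by
  have hδ := hδL.continuous
  have hU := uniqueDiffOn_sublevel hδL hδe
  have hcl : IsClosed {x | δ x ≤ 0} := isClosed_le hδ continuous_const
  have hK : IsCompact ({x | δ x ≤ 0} ∩ Metric.closedBall p (R + 1)) :=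
    (isCompact_closedBall p (R + 1)).inter_left hcl
  have hcont := hv.continuousOn_iteratedFDerivWithin (m := q) (by exact_mod_cast hq) hU
  have huc := Metric.uniformContinuousOn_iff.1
    (hK.uniformContinuousOn_of_continuous (hcont.mono inter_subset_left)) ε hε
  obtain ⟨ρ, hρ, h⟩ := huc
  have heq : ∀ y, δ y < 0 → iteratedFDerivWithin ℝ q v {x | δ x ≤ 0} y =
      iteratedFDeriv ℝ q v y := fun y hy =>
    iteratedFDerivWithin_eq_iteratedFDeriv hU
      (((hv y hy.le).contDiffAt (mem_nhds_sublevel hδ hy)).of_le (by exact_mod_cast hq)) hy.le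
  refine ⟨min (ρ / 2) 1, by positivity, fun y y' hy hy' hd => ?_⟩
  by_cases hfar : R < dist y p ∧ R < dist y' p
  · rw [((hR y hfar.1).iteratedFDeriv ℝ q).eq_of_nhds,
      ((hR y' hfar.2).iteratedFDeriv ℝ q).eq_of_nhds]
    simp [hε.le]
  · have h1 : dist y y' ≤ 1 := hd.trans (min_le_right _ _)
    have h1' : dist y' y ≤ 1 := by rwa [dist_comm]
    have h2 : dist y p ≤ R + 1 ∧ dist y' p ≤ R + 1 := by
      have t1 := dist_triangle y y' p
      have t2 := dist_triangle y' y p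
      by_cases hc : R < dist y p
      · have : dist y' p ≤ R := not_lt.1 fun h => hfar ⟨hc, h⟩
        constructor <;> linarith
      · have := not_lt.1 hc
        constructor <;> linarith
    have h3 : dist y y' < ρ := lt_of_le_of_lt (hd.trans (min_le_left _ _)) (by linarith)
    have := (h y ⟨hy.le, h2.1⟩ y' ⟨hy'.le, h2.2⟩ h3).le
    rwa [heq y hy, heq y' hy', dist_eq_norm] at this

variable [CompleteSpace W]

/-- A cutoff function reduces the extension near `p` to that of a function with uniformly continuous
derivatives, namely the product of `u` with the cutoff. The bound on the derivative of order `m + 1`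
is a hypothesis of the last clause only. -/
theorem exists_extension_of_contDiffOn_ball (hδL : LipschitzWith K δ)
    (hδe : ∀ x t, δ (x - t • e) = δ x - t) (he : ‖e‖ ≤ 1) {u : E → W} {m : ℕ} {p : E}
    (hp : δ p ≤ 0) {r : ℝ} (hr : 0 < r)
    (hu : ContDiffOn ℝ m u ({x | δ x ≤ 0} ∩ Metric.ball p r)) :
    ∃ F : E → W, ContDiffAt ℝ m F p ∧ F =ᶠ[𝓝[{x | δ x ≤ 0}] p] u ∧
      ∀ C, (∀ x ∈ Metric.ball p r, δ x < 0 →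
          ContDiffAt ℝ (m + 1 : ℕ) u x ∧ ‖iteratedFDeriv ℝ (m + 1) u x‖ ≤ C) →
        ∃ K' : NNReal, ∃ t ∈ 𝓝 p, LipschitzOnWith K' (iteratedFDeriv ℝ m F) t := by
  have hδ := hδL.continuous
  have hU := uniqueDiffOn_sublevel hδL hδe
  have hcl : IsClosed {x | δ x ≤ 0} := isClosed_le hδ continuous_const
  let χ : ContDiffBump p := ⟨r / 4, r / 2, by positivity, by linarith⟩
  let v : E → W := fun x => χ x • u x
  have hfar : ∀ x, r / 2 < dist x p → v =ᶠ[𝓝 x] 0 := by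
    intro x hx
    filter_upwards [(isOpen_lt continuous_const (continuous_id.dist continuous_const)).mem_nhds hx]
      with y hy
    have h0 : χ y = 0 := χ.zero_of_le_dist (le_of_lt hy)
    simp [v, h0]
  have hv : ContDiffOn ℝ m v {x | δ x ≤ 0} := by
    intro x hx
    rcases lt_or_ge (dist x p) r with h | h
    · have h1 : ContDiffWithinAt ℝ m u {x | δ x ≤ 0} x :=
        (hu x ⟨hx, h⟩).mono_of_mem_nhdsWithin
          (inter_mem_nhdsWithin _ (Metric.isOpen_ball.mem_nhds h))
      exact χ.contDiff.contDiffAt.contDiffWithinAt.smul h1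
    · exact (contDiffAt_const.congr_of_eventuallyEq (hfar x (by linarith))).contDiffWithinAt
  obtain ⟨F, hF, hFv, hFL⟩ := exists_extension_of_uniformContinuous hδL hδe he
    (hv.mono fun x (hx : δ x < 0) => hx.le) fun q hq ε hε =>
      uniformContinuous_iteratedFDeriv_of_eq_zero hδL hδe hv hfar hq hε
  have hO : IsOpen {x | δ x < 1 / 2} := isOpen_lt hδ continuous_const
  have hle : ∀ x, δ x ≤ 0 → x ∈ {x | δ x < 1 / 2} := fun x hx => by
    change δ x < 1 / 2; linarith
  refine ⟨F, hF.contDiffAt (hO.mem_nhds (hle p hp)), ?_, fun C hC => ?_⟩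
  · have hFS : ∀ x, δ x ≤ 0 → F x = v x := by
      intro x hx
      have := nhdsWithin_neBot hδe hx
      have h1 : Tendsto F (𝓝[{x | δ x < 0}] x) (𝓝 (F x)) :=
        ((hF.contDiffAt (hO.mem_nhds (hle x hx))).continuousAt).tendsto.mono_left
          nhdsWithin_le_nhds
      have h2 : Tendsto v (𝓝[{x | δ x < 0}] x) (𝓝 (v x)) :=
        (hv x hx).continuousWithinAt.tendsto.mono_left
          (nhdsWithin_mono _ fun y (hy : δ y < 0) => hy.le)
      refine tendsto_nhds_unique (h1.congr' ?_) h2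
      filter_upwards [self_mem_nhdsWithin] with y hy using hFv y hy
    have hball : Metric.closedBall p (r / 4) ∈ 𝓝 p := Metric.closedBall_mem_nhds _ (by positivity)
    filter_upwards [self_mem_nhdsWithin, mem_nhdsWithin_of_mem_nhds hball] with x hx hxr
    have h1 : χ x = 1 := χ.one_of_mem_closedBall hxr
    simp [hFS x hx, v, h1]
  · have hUr : UniqueDiffOn ℝ ({x | δ x ≤ 0} ∩ Metric.ball p r) := hU.inter Metric.isOpen_ball
    have hcpt : IsCompact ({x | δ x ≤ 0} ∩ Metric.closedBall p (r / 2)) :=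
      (isCompact_closedBall p (r / 2)).inter_left hcl
    have hsub : {x | δ x ≤ 0} ∩ Metric.closedBall p (r / 2) ⊆ {x | δ x ≤ 0} ∩ Metric.ball p r :=
      inter_subset_inter_right _ (Metric.closedBall_subset_ball (by linarith))
    have hbu : ∀ q, ∃ B : ℝ, 0 ≤ B ∧ (q ≤ m + 1 → ∀ x, δ x < 0 → dist x p ≤ r / 2 →
        ‖iteratedFDeriv ℝ q u x‖ ≤ B) := by
      intro q
      rcases le_or_gt q m with hq | hq
      · obtain ⟨B, hB⟩ := hcpt.exists_bound_of_continuousOn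
          ((hu.continuousOn_iteratedFDerivWithin (m := q) (by exact_mod_cast hq) hUr).mono hsub)
        refine ⟨|B|, abs_nonneg _, fun _ x hx hxr => ?_⟩
        have hxm : x ∈ {x | δ x ≤ 0} ∩ Metric.closedBall p (r / 2) := ⟨hx.le, hxr⟩
        have hat : ContDiffAt ℝ q u x :=
          (hC x (hsub hxm).2 hx).1.of_le (by exact_mod_cast (by omega : q ≤ m + 1))
        rw [← iteratedFDerivWithin_eq_iteratedFDeriv hUr hat (hsub hxm)]
        exact (hB x hxm).trans (le_abs_self B)
      · refine ⟨|C|, abs_nonneg _, fun hq' x hx hxr => ?_⟩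
        obtain rfl : q = m + 1 := by omega
        exact (hC x (Metric.mem_ball.2 (by linarith)) hx).2.trans (le_abs_self C)
    choose B hB0 hB using hbu
    have hbχ : ∀ q, ∃ D : ℝ, ∀ x, dist x p ≤ r / 2 → ‖iteratedFDeriv ℝ q χ x‖ ≤ D := by
      intro q
      obtain ⟨D, hD⟩ := (isCompact_closedBall p (r / 2)).exists_bound_of_continuousOn
        ((χ.contDiff (n := ⊤)).continuous_iteratedFDeriv (m := q)
          (by exact_mod_cast le_top)).continuousOn
      exact ⟨D, fun x hx => hD x hx⟩
    choose D hD using hbχ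
    have hatu : ∀ x, δ x < 0 → dist x p < r → ContDiffAt ℝ (m + 1 : ℕ) v x := fun x hx hxr =>
      χ.contDiff.contDiffAt.smul (hC x hxr hx).1
    have hvm : ContDiffOn ℝ (m + 1 : ℕ) v {x | δ x < 0} := fun x hx => by
      rcases lt_or_ge (dist x p) r with h | h
      · exact (hatu x hx h).contDiffWithinAt
      · exact (contDiffAt_const.congr_of_eventuallyEq (hfar x (by linarith))).contDiffWithinAt
    have hvb : ∀ x, δ x < 0 → ‖iteratedFDeriv ℝ (m + 1) v x‖ ≤
        ∑ i ∈ Finset.range (m + 1 + 1), ((m + 1).choose i : ℝ) * |D i| * B (m + 1 - i) := by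
      intro x hx
      rcases le_or_gt (dist x p) (r / 2) with h | h
      · refine (norm_iteratedFDeriv_smul_le_of_contDiffAt χ.contDiff.contDiffAt
          (hC x (Metric.mem_ball.2 (by linarith)) hx).1).trans ?_
        gcongr with i hi
        · exact (hD i x h).trans (le_abs_self _)
        · exact hB _ (by omega) x hx h
      · rw [((hfar x h).iteratedFDeriv ℝ (m + 1)).eq_of_nhds]
        have h0 : ‖iteratedFDeriv ℝ (m + 1) (0 : E → W) x‖ = 0 := by simp
        rw [h0]
        exact Finset.sum_nonneg fun i _ => mul_nonneg (by positivity) (hB0 _)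
    obtain ⟨K', hK'⟩ := hFL _ hvm hvb
    obtain ⟨ρ, hρ, hball⟩ := Metric.isOpen_iff.1 hO p (hle p hp)
    exact ⟨K', _, Metric.ball_mem_nhds p hρ, hK' _ (convex_ball p ρ) hball⟩

/-- Whitney's extension theorem for a closed subgraph of a Lipschitz function, near a point. -/
theorem exists_extension_of_contDiffWithinAt (hδL : LipschitzWith K δ)
    (hδe : ∀ x t, δ (x - t • e) = δ x - t) (he : ‖e‖ ≤ 1) {u : E → W} {m : ℕ} {p : E}
    (hp : δ p ≤ 0) (hu : ContDiffWithinAt ℝ m u {x | δ x ≤ 0} p) :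
    ∃ F : E → W, ContDiffAt ℝ m F p ∧ F =ᶠ[𝓝[{x | δ x ≤ 0}] p] u := by
  obtain ⟨U, hUo, hpU, hU⟩ := hu.contDiffOn' le_rfl (by simp)
  rw [insert_eq_of_mem (show p ∈ {x | δ x ≤ 0} from hp)] at hU
  obtain ⟨r, hr, hball⟩ := Metric.isOpen_iff.1 hUo p hpU
  obtain ⟨F, h1, h2, -⟩ := exists_extension_of_contDiffOn_ball hδL hδe he hp hr
    (hU.mono (inter_subset_inter_right _ hball))
  exact ⟨F, h1, h2⟩

/-- The extension has a Lipschitz derivative of order `m` if the derivative of order `m + 1` of the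
given function is bounded. -/
theorem exists_lipschitz_extension_of_contDiffWithinAt (hδL : LipschitzWith K δ)
    (hδe : ∀ x t, δ (x - t • e) = δ x - t) (he : ‖e‖ ≤ 1) {u : E → W} {m : ℕ} {p : E}
    (hp : δ p ≤ 0) (hu : ContDiffWithinAt ℝ m u {x | δ x ≤ 0} p) {C : ℝ}
    (hC : ∀ᶠ x in 𝓝 p, δ x < 0 →
      ContDiffAt ℝ (m + 1 : ℕ) u x ∧ ‖iteratedFDeriv ℝ (m + 1) u x‖ ≤ C) :
    ∃ F : E → W, ContDiffAt ℝ m F p ∧ F =ᶠ[𝓝[{x | δ x ≤ 0}] p] u ∧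
      ∃ K' : NNReal, ∃ t ∈ 𝓝 p, LipschitzOnWith K' (iteratedFDeriv ℝ m F) t := by
  obtain ⟨U, hUo, hpU, hU⟩ := hu.contDiffOn' le_rfl (by simp)
  rw [insert_eq_of_mem (show p ∈ {x | δ x ≤ 0} from hp)] at hU
  obtain ⟨r, hr, hball⟩ := Metric.eventually_nhds_iff_ball.1 (hC.and (hUo.eventually_mem hpU))
  obtain ⟨F, h1, h2, h3⟩ := exists_extension_of_contDiffOn_ball hδL hδe he hp hr
    (hU.mono (inter_subset_inter_right _ fun x hx => (hball x hx).2))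
  exact ⟨F, h1, h2, h3 C fun x hx => (hball x hx).1⟩

end LocalExtension

/-! ### The second derivatives of an isometry -/

section Koszul

set_option maxSynthPendingDepth 3

variable {E : Type*} [NormedAddCommGroup E] [NormedSpace ℝ E]

/-- Trilinear forms, such as the derivative of a metric in coordinates. -/
abbrev Tri (E : Type*) [NormedAddCommGroup E] [NormedSpace ℝ E] : Type _ :=
  E →L[ℝ] E →L[ℝ] E →L[ℝ] ℝ

/-- The values `(DB, DH ∘ ψ, H ∘ ψ, Dψ)` at a point, for metrics `B` and `H` and a map `ψ`. -/
abbrev MetricJet (E : Type*) [NormedAddCommGroup E] [NormedSpace ℝ E] : Type _ :=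
  Tri E × Tri E × (E →L[ℝ] E →L[ℝ] ℝ) × (E →L[ℝ] E)

/-- Cyclic permutation of the arguments of a trilinear form. -/
noncomputable def rotateArgs : Tri E →L[ℝ] Tri E :=
  (ContinuousLinearMap.compL ℝ E (E →L[ℝ] E →L[ℝ] ℝ) (E →L[ℝ] E →L[ℝ] ℝ)
    (ContinuousLinearMap.flipₗᵢ ℝ E E ℝ : (E →L[ℝ] E →L[ℝ] ℝ) →L[ℝ] (E →L[ℝ] E →L[ℝ] ℝ))).comp
  (ContinuousLinearMap.flipₗᵢ ℝ E E (E →L[ℝ] ℝ) :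
    Tri E →L[ℝ] Tri E)

/-- The combination `∂_z b(v, w) + ∂_v b(z, w) - ∂_w b(z, v)` of the first derivatives of a metric,
that is, twice its Christoffel symbols of the first kind. -/
noncomputable def koszul : Tri E →L[ℝ] Tri E :=
  ContinuousLinearMap.id ℝ _ + (ContinuousLinearMap.flipₗᵢ ℝ E E (E →L[ℝ] ℝ) :
    Tri E →L[ℝ] Tri E) - rotateArgs

@[simp]
theorem koszul_apply (b : Tri E) (z v w : E) :
    koszul b z v w = b z v w + b v z w - b w z v := rfl

/-- The pullback of a trilinear form by a linear map. -/
noncomputable def pullTri (L : E →L[ℝ] E) (c : Tri E) :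
    Tri E :=
  rotateArgs ((rotateArgs ((rotateArgs (c.comp L)).comp L)).comp L)

@[simp]
theorem pullTri_apply (L : E →L[ℝ] E) (c : Tri E) (z v w : E) :
    pullTri L c z v w = c (L z) (L v) (L w) := rfl

/-- The linear map `q ↦ h(q, L ·)`. -/
noncomputable def pairing (h : E →L[ℝ] E →L[ℝ] ℝ) (L : E →L[ℝ] E) : E →L[ℝ] (E →L[ℝ] ℝ) :=
  ((ContinuousLinearMap.compL ℝ E E ℝ).flip L).comp h

@[simp]
theorem pairing_apply (h : E →L[ℝ] E →L[ℝ] ℝ) (L : E →L[ℝ] E) (q w : E) :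
    pairing h L q w = h q (L w) := rfl

/-- The second derivative of an isometry `ψ` from a metric `B` to a metric `H`, as a function of
`DB`, `DH ∘ ψ`, `H ∘ ψ` and `Dψ`. -/
noncomputable def hessianOfJet (y : MetricJet E) : E →L[ℝ] E →L[ℝ] E :=
  ContinuousLinearMap.compL ℝ E (E →L[ℝ] E →L[ℝ] ℝ) (E →L[ℝ] E)
    (ContinuousLinearMap.compL ℝ E (E →L[ℝ] ℝ) E
      (ContinuousLinearMap.inverse (pairing y.2.2.1 y.2.2.2)))
    ((1 / 2 : ℝ) • (koszul y.1 - pullTri y.2.2.2 (koszul y.2.1)))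

theorem hessianOfJet_apply (b c : Tri E) (h : E →L[ℝ] E →L[ℝ] ℝ)
    (L : E →L[ℝ] E) (z v : E) : hessianOfJet (b, c, h, L) z v =
      ContinuousLinearMap.inverse (pairing h L)
        ((1 / 2 : ℝ) • (koszul b z v - pullTri L (koszul c) z v)) := rfl

theorem isInvertible_pairing [FiniteDimensional ℝ E] {b h : E →L[ℝ] E →L[ℝ] ℝ} {L : E →L[ℝ] E}
    (hb : ∀ v, (∀ w, b v w = 0) → v = 0) (hbh : ∀ v w, b v w = h (L v) (L w)) :
    (pairing h L).IsInvertible := by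
  have hL : Function.Injective L := by
    rw [injective_iff_map_eq_zero]
    intro v hv
    refine hb v fun w => ?_
    rw [hbh, hv, map_zero]
    rfl
  have hLs : Function.Surjective L := LinearMap.injective_iff_surjective.1 hL
  have hinj : Function.Injective (pairing h L : E →ₗ[ℝ] (E →L[ℝ] ℝ)) := by
    rw [injective_iff_map_eq_zero]
    intro q hq
    obtain ⟨v, rfl⟩ := hLs q
    have : v = 0 := hb v fun w => by
      rw [hbh]
      exact congrArg (fun f : E →L[ℝ] ℝ => f w) hq
    rw [this, map_zero]
  have hdim : Module.finrank ℝ E = Module.finrank ℝ (E →L[ℝ] ℝ) := by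
    rw [← (LinearMap.toContinuousLinearMap : (E →ₗ[ℝ] ℝ) ≃ₗ[ℝ] (E →L[ℝ] ℝ)).finrank_eq]
    exact (Subspace.dual_finrank_eq).symm
  refine ⟨(LinearEquiv.ofInjectiveOfFinrankEq _ hinj hdim).toContinuousLinearEquiv, ?_⟩
  ext q w
  rfl

theorem contDiffAt_hessianOfJet [CompleteSpace E] {y : MetricJet E}
    (hy : (pairing y.2.2.1 y.2.2.2).IsInvertible) {n : WithTop ℕ∞} :
    ContDiffAt ℝ n hessianOfJet y := by
  have hL : ContDiffAt ℝ n (fun y : MetricJet E => y.2.2.2) y := by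
    fun_prop
  have hh : ContDiffAt ℝ n (fun y : MetricJet E => y.2.2.1) y := by
    fun_prop
  have hb : ContDiffAt ℝ n (fun y : MetricJet E => y.1) y := by
    fun_prop
  have hc : ContDiffAt ℝ n (fun y : MetricJet E => y.2.1) y := by
    fun_prop
  have hN : ContDiffAt ℝ n (fun y : MetricJet E =>
      pairing y.2.2.1 y.2.2.2) y :=
    ((ContinuousLinearMap.contDiff _).contDiffAt.comp y hL).clm_comp hh
  have hR := ContDiffAt.comp y (ContinuousLinearMap.IsInvertible.contDiffAt_map_inverse
    (n := n) hy) hN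
  have hrot : ∀ {f : MetricJet E → Tri E},
      ContDiffAt ℝ n f y → ContDiffAt ℝ n (fun y => rotateArgs (f y)) y := fun hf =>
    (ContinuousLinearMap.contDiff _).contDiffAt.comp y hf
  have hk : ∀ {f : MetricJet E → Tri E},
      ContDiffAt ℝ n f y → ContDiffAt ℝ n (fun y => koszul (f y)) y := fun hf =>
    (ContinuousLinearMap.contDiff _).contDiffAt.comp y hf
  have hpull : ContDiffAt ℝ n (fun y : MetricJet E =>
      pullTri y.2.2.2 (koszul y.2.1)) y :=
    hrot ((hrot ((hrot ((hk hc).clm_comp hL)).clm_comp hL)).clm_comp hL)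
  refine ContDiffAt.clm_apply ?_ (((hk hb).sub hpull).const_smul _)
  exact (ContinuousLinearMap.contDiff _).contDiffAt.comp y
    ((ContinuousLinearMap.contDiff _).contDiffAt.comp y hR)

/-- Koszul's formula: an isometry of class `C^2` between metrics of class `C^1` maps Christoffel
symbols to Christoffel symbols, which determines its second derivative. -/
theorem fderiv_fderiv_eq_hessianOfJet [FiniteDimensional ℝ E] {B H : E → E →L[ℝ] E →L[ℝ] ℝ}
    {ψ : E → E} {x : E} (hψ : ContDiffAt ℝ 2 ψ x) (hB : DifferentiableAt ℝ B x)
    (hH : DifferentiableAt ℝ H (ψ x)) (hHs : ∀ y v w, H y v w = H y w v)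
    (hBn : ∀ v, (∀ w, B x v w = 0) → v = 0)
    (hiso : ∀ᶠ y in 𝓝 x, ∀ v w, B y v w = H (ψ y) (fderiv ℝ ψ y v) (fderiv ℝ ψ y w)) :
    fderiv ℝ (fderiv ℝ ψ) x = hessianOfJet (fderiv ℝ B x, fderiv ℝ H (ψ x), H (ψ x),
      fderiv ℝ ψ x) := by
  set L := fderiv ℝ ψ x with hL
  set Q := fderiv ℝ (fderiv ℝ ψ) x with hQ
  have hψ1 : HasFDerivAt ψ L x := (hψ.differentiableAt (by simp)).hasFDerivAt
  have hψ2 : HasFDerivAt (fderiv ℝ ψ) Q x :=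
    ((hψ.fderiv_right (m := 1) (by norm_num)).differentiableAt (by simp)).hasFDerivAt
  have hsymm : ∀ v w, Q v w = Q w v := fun v w =>
    (hψ.isSymmSndFDerivAt (by simp)) v w
  have hHψ : HasFDerivAt (fun y => H (ψ y)) ((fderiv ℝ H (ψ x)).comp L) x :=
    hH.hasFDerivAt.comp x hψ1
  have hder : ∀ z v w, fderiv ℝ B x z v w = fderiv ℝ H (ψ x) (L z) (L v) (L w) +
      H (ψ x) (Q z v) (L w) + H (ψ x) (L v) (Q z w) := by
    intro z v w
    have h1 : HasFDerivAt (fun y => B y v w) ((ContinuousLinearMap.apply ℝ ℝ w).comp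
        ((ContinuousLinearMap.apply ℝ (E →L[ℝ] ℝ) v).comp (fderiv ℝ B x))) x :=
      (ContinuousLinearMap.apply ℝ ℝ w).hasFDerivAt.comp x
        ((ContinuousLinearMap.apply ℝ (E →L[ℝ] ℝ) v).hasFDerivAt.comp x hB.hasFDerivAt)
    have hv : ∀ v, HasFDerivAt (fun y => fderiv ℝ ψ y v)
        ((ContinuousLinearMap.apply ℝ E v).comp Q) x := fun v =>
      (ContinuousLinearMap.apply ℝ E v).hasFDerivAt.comp x hψ2
    have h2 := (hHψ.clm_apply (hv v)).clm_apply (hv w)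
    have h3 := h1.unique (h2.congr_of_eventuallyEq (hiso.mono fun y hy => hy v w))
    have h4 := congrArg (fun f : E →L[ℝ] ℝ => f z) h3
    simp only [ContinuousLinearMap.comp_apply, ContinuousLinearMap.apply_apply,
      _root_.add_apply, ContinuousLinearMap.flip_apply] at h4
    rw [h4]
    ring
  have hinv := isInvertible_pairing hBn hiso.self_of_nhds
  ext1 z
  ext1 v
  rw [hessianOfJet_apply]
  have hN : pairing (H (ψ x)) L (Q z v) = (1 / 2 : ℝ) • (koszul (fderiv ℝ B x) z v -
      pullTri L (koszul (fderiv ℝ H (ψ x))) z v) := by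
    ext w
    simp only [pairing_apply, _root_.smul_apply, _root_.sub_apply,
      koszul_apply, pullTri_apply, smul_eq_mul]
    rw [hder z v w, hder v z w, hder w z v, hsymm v z, hsymm w z, hsymm w v,
      hHs (ψ x) (L v) (Q z w), hHs (ψ x) (L z) (Q v w)]
    ring
  rw [← hN]
  obtain ⟨N, hNe⟩ := hinv
  rw [← hNe, ContinuousLinearMap.inverse_equiv]
  simp

end Koszul

/-! ### Regularity of an isometry up to the boundary -/

section PointwiseClasses

variable {E F G : Type*} [NormedAddCommGroup E] [NormedSpace ℝ E]
  [NormedAddCommGroup F] [NormedSpace ℝ F] [NormedAddCommGroup G] [NormedSpace ℝ G]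

/-- `f` is of class `C^{k,a}_loc` in some neighbourhood of `x`. -/
def CkaAt (k : ℕ) (a : Fin 2) (f : E → F) (x : E) : Prop :=
  ContDiffAt ℝ k f x ∧
    (a = 1 → ∃ K : NNReal, ∃ t ∈ 𝓝 x, LipschitzOnWith K (iteratedFDeriv ℝ k f) t)

theorem eventually_norm_iteratedFDeriv_le {k i : ℕ} {f : E → F} {x : E}
    (hf : ContDiffAt ℝ k f x) (hi : i ≤ k) :
    ∃ C : ℝ, ∀ᶠ y in 𝓝 x, ‖iteratedFDeriv ℝ i f y‖ ≤ C := by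
  have h := (hf.continuousAt_iteratedFDeriv (k := i) (by exact_mod_cast hi)).norm
  exact ⟨_, h.eventually (ge_mem_nhds (lt_add_one _))⟩

/-- The derivatives of order at most `k + 1` of a function of class `C^{k,1}_loc` are locally
bounded; where the last one does not exist, it has the junk value `0`. -/
theorem CkaAt.eventually_norm_iteratedFDeriv_le {k i : ℕ} {f : E → F} {x : E}
    (hf : CkaAt k 1 f x) (hi : i ≤ k + 1) :
    ∃ C : ℝ, ∀ᶠ y in 𝓝 x, ‖iteratedFDeriv ℝ i f y‖ ≤ C := by
  rcases Nat.le_succ_iff.1 hi with hi | rfl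
  · exact SpacetimeExt.eventually_norm_iteratedFDeriv_le hf.1 hi
  · obtain ⟨K, t, ht, hK⟩ := hf.2 rfl
    refine ⟨K, ?_⟩
    filter_upwards [eventually_mem_nhds_iff.2 ht] with y hy
    rw [← norm_fderiv_iteratedFDeriv]
    exact norm_fderiv_le_of_lipschitzOn ℝ hy hK

/-- Along the filter `l`, the function `f` is of class `C^k`, and its derivatives of order at most
`k` are bounded. -/
def BddDerivs (k : ℕ) (f : E → F) (l : Filter E) : Prop :=
  (∀ᶠ x in l, ContDiffAt ℝ k f x) ∧ ∀ i ≤ k, ∃ C : ℝ, ∀ᶠ x in l, ‖iteratedFDeriv ℝ i f x‖ ≤ C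

variable {k : ℕ} {l : Filter E}

theorem BddDerivs.of_contDiffAt {f : E → F} {x : E} (hf : ContDiffAt ℝ k f x) (hl : l ≤ 𝓝 x) :
    BddDerivs k f l :=
  ⟨(hf.eventually (by simp)).filter_mono hl, fun i hi => by
    obtain ⟨C, hC⟩ := eventually_norm_iteratedFDeriv_le hf hi
    exact ⟨C, hC.filter_mono hl⟩⟩

theorem BddDerivs.prodMk {f : E → F} {g : E → G} (hf : BddDerivs k f l) (hg : BddDerivs k g l) :
    BddDerivs k (fun x => (f x, g x)) l := by
  refine ⟨by filter_upwards [hf.1, hg.1] with x h1 h2 using h1.prodMk h2, fun i hi => ?_⟩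
  obtain ⟨C, hC⟩ := hf.2 i hi
  obtain ⟨D, hD⟩ := hg.2 i hi
  refine ⟨max C D, ?_⟩
  filter_upwards [hf.1, hg.1, hC, hD] with x h1 h2 h3 h4
  rw [iteratedFDeriv_prodMk h1 h2 (by exact_mod_cast hi), ContinuousMultilinearMap.opNorm_prod]
  exact max_le_max h3 h4

theorem norm_iteratedFDeriv_comp_le_of_contDiffAt {g : F → G} {f : E → F} {x : E} {n : ℕ}
    (hg : ContDiffAt ℝ n g (f x)) (hf : ContDiffAt ℝ n f x) {C D : ℝ}
    (hC : ∀ i ≤ n, ‖iteratedFDeriv ℝ i g (f x)‖ ≤ C)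
    (hD : ∀ i, 1 ≤ i → i ≤ n → ‖iteratedFDeriv ℝ i f x‖ ≤ D ^ i) :
    ‖iteratedFDeriv ℝ n (g ∘ f) x‖ ≤ n.factorial * C * D ^ n := by
  obtain ⟨u, hu, hxu, hfu⟩ := exists_isOpen_contDiffOn hf
  obtain ⟨v, hv, hxv, hgv⟩ := exists_isOpen_contDiffOn hg
  have huv : IsOpen (u ∩ f ⁻¹' v) := hfu.continuousOn.isOpen_inter_preimage hu hv
  have := norm_iteratedFDerivWithin_comp_le (n := n) hgv (hfu.mono inter_subset_left) le_rfl
    hv.uniqueDiffOn huv.uniqueDiffOn (fun y hy => hy.2) (x := x) ⟨hxu, hxv⟩ (C := C) (D := D)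
    (fun i hi => by rw [iteratedFDerivWithin_of_isOpen _ hv hxv]; exact hC i hi)
    (fun i h1 hi => by rw [iteratedFDerivWithin_of_isOpen _ huv ⟨hxu, hxv⟩]; exact hD i h1 hi)
  rwa [iteratedFDerivWithin_of_isOpen _ huv ⟨hxu, hxv⟩] at this

theorem BddDerivs.comp {f : E → F} {g : F → G} (hf : BddDerivs k f l)
    (hg : BddDerivs k g (map f l)) : BddDerivs k (g ∘ f) l := by
  have hg1 : ∀ᶠ x in l, ContDiffAt ℝ k g (f x) := hg.1
  refine ⟨by filter_upwards [hf.1, hg1] with x h1 h2 using h2.comp x h1, fun i hi => ?_⟩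
  choose! C hC using hf.2
  choose! D hD using hg.2
  have hC' : ∀ᶠ x in l, ∀ j ∈ Finset.range (k + 1), ‖iteratedFDeriv ℝ j f x‖ ≤ C j :=
    (Finset.eventually_all _).2 fun j hj => hC j (by have := Finset.mem_range.1 hj; omega)
  have hD' : ∀ᶠ x in l, ∀ j ∈ Finset.range (k + 1), ‖iteratedFDeriv ℝ j g (f x)‖ ≤ D j :=
    (Finset.eventually_all _).2 fun j hj => hD j (by have := Finset.mem_range.1 hj; omega)
  set A := 1 + ∑ j ∈ Finset.range (k + 1), |C j| with hA
  have hA1 : 1 ≤ A := le_add_of_nonneg_right (Finset.sum_nonneg fun _ _ => abs_nonneg _)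
  refine ⟨i.factorial * (∑ j ∈ Finset.range (k + 1), |D j|) * A ^ i, ?_⟩
  filter_upwards [hf.1, hg1, hC', hD'] with x h1 h2 h3 h4
  have hmem : ∀ j ≤ i, j ∈ Finset.range (k + 1) := fun j hj => Finset.mem_range.2 (by omega)
  refine norm_iteratedFDeriv_comp_le_of_contDiffAt (h2.of_le (by exact_mod_cast hi))
    (h1.of_le (by exact_mod_cast hi)) (fun j hj => ?_) fun j hj1 hj => ?_
  · exact ((h4 j (hmem j hj)).trans (le_abs_self _)).trans
      (Finset.single_le_sum (f := fun j => |D j|) (fun _ _ => abs_nonneg _) (hmem j hj))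
  · calc ‖iteratedFDeriv ℝ j f x‖ ≤ |C j| := (h3 j (hmem j hj)).trans (le_abs_self _)
      _ ≤ A := (Finset.single_le_sum (f := fun j => |C j|) (fun _ _ => abs_nonneg _)
          (hmem j hj)).trans (by linarith)
      _ ≤ A ^ j := le_self_pow₀ hA1 (by omega)

/-- If `f` is contained in a compact set near which `g` is smooth, then the derivatives of `g` along
`f` are bounded. -/
theorem BddDerivs.of_isCompact {X : Type*} {l : Filter X} {f : X → F} {g : F → G}
    {S : Set F} (hS : IsCompact S)
    (hf : ∀ᶠ x in l, f x ∈ S) (hg : ∀ y ∈ S, ContDiffAt ℝ k g y) : BddDerivs k g (map f l) := by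
  refine ⟨hf.mono fun x hx => hg _ hx, fun i hi => ?_⟩
  obtain ⟨C, hC⟩ := hS.exists_bound_of_continuousOn (f := iteratedFDeriv ℝ i g) fun y hy =>
    ((hg y hy).continuousAt_iteratedFDeriv (by exact_mod_cast hi)).continuousWithinAt
  exact ⟨C, hf.mono fun x hx => hC _ hx⟩

theorem BddDerivs.congr {f g : E → F} (hf : BddDerivs k f l) (h : ∀ᶠ x in l, g =ᶠ[𝓝 x] f) :
    BddDerivs k g l := by
  refine ⟨by filter_upwards [hf.1, h] with x h1 h2 using h1.congr_of_eventuallyEq h2,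
    fun i hi => ?_⟩
  obtain ⟨C, hC⟩ := hf.2 i hi
  refine ⟨C, ?_⟩
  filter_upwards [hC, h] with x h1 h2
  rwa [(h2.iteratedFDeriv ℝ i).eq_of_nhds]

theorem BddDerivs.fderiv_of_bound {f : E → F} (h : ∀ᶠ x in l, ContDiffAt ℝ (k + 1 : ℕ) f x)
    (hb : ∀ i ≤ k + 1, ∃ C : ℝ, ∀ᶠ x in l, ‖iteratedFDeriv ℝ i f x‖ ≤ C) :
    BddDerivs k (fderiv ℝ f) l := by
  refine ⟨h.mono fun x hx => hx.fderiv_right (by norm_cast), fun i hi => ?_⟩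
  obtain ⟨C, hC⟩ := hb (i + 1) (by omega)
  exact ⟨C, hC.mono fun x hx => by rwa [norm_iteratedFDeriv_fderiv]⟩

end PointwiseClasses

section Bootstrap

set_option maxSynthPendingDepth 3

theorem eventually_eventuallyEq_of_nhdsWithin {E F : Type*} [TopologicalSpace E] {δ : E → ℝ} {p : E}
    {f g : E → F} (hδ : Continuous δ)
    (h : f =ᶠ[𝓝[{x | δ x ≤ 0}] p] g) : ∀ᶠ x in 𝓝 p, δ x < 0 → f =ᶠ[𝓝 x] g := by
  rw [EventuallyEq, eventually_nhdsWithin_iff] at h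
  filter_upwards [eventually_eventually_nhds.2 h] with x hx hx0
  filter_upwards [hx, mem_nhds_sublevel hδ hx0] with y hy hy0 using hy hy0

theorem eventually_nhds_nhdsWithin_lt {E : Type*} [TopologicalSpace E] {δ : E → ℝ} {p : E}
    {q : E → Prop} (h : ∀ᶠ x in 𝓝 p, δ x < 0 → q x) :
    ∀ᶠ x in 𝓝[{x | δ x < 0}] p, q x :=
  eventually_nhdsWithin_iff.2 h

variable {E : Type*} [NormedAddCommGroup E] [NormedSpace ℝ E]
  {δ : E → ℝ} {e : E} {K : NNReal} {B H : E → E →L[ℝ] E →L[ℝ] ℝ} {ψ Ψ : E → E} {p : E} {k n : ℕ}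

/-- Near `p`, the map `ψ` is a smooth isometry from the metric `B` to the metric `H` on the open set
`{δ < 0}`; nothing is said on the regularity at the points with `δ = 0`. -/
structure IsIsometryBelow (δ : E → ℝ) (B H : E → E →L[ℝ] E →L[ℝ] ℝ) (ψ : E → E) (p : E) : Prop where
  smooth : ∀ᶠ x in 𝓝 p, δ x < 0 →
    ContDiffAt ℝ ∞ ψ x ∧ ContDiffAt ℝ ∞ B x ∧ ContDiffAt ℝ ∞ H (ψ x)
  isometry : ∀ᶠ x in 𝓝 p, δ x < 0 →
    ∀ v w, B x v w = H (ψ x) (fderiv ℝ ψ x v) (fderiv ℝ ψ x w)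
  nondegenerate : ∀ᶠ x in 𝓝 p, ∀ v, (∀ w, B x v w = 0) → v = 0
  symm : ∀ y v w, H y v w = H y w v

/-- The argument of `hessianOfJet` for a map `Ψ`. -/
noncomputable def metricJet (B H : E → E →L[ℝ] E →L[ℝ] ℝ) (Ψ : E → E) (x : E) : MetricJet E :=
  (fderiv ℝ B x, fderiv ℝ H (Ψ x), H (Ψ x), fderiv ℝ Ψ x)

theorem contDiffAt_metricJet (hB : ContDiffAt ℝ (n + 1 : ℕ) B p)
    (hH : ContDiffAt ℝ (n + 1 : ℕ) H (Ψ p)) (hΨ : ContDiffAt ℝ (n + 1 : ℕ) Ψ p) :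
    ContDiffAt ℝ n (metricJet B H Ψ) p := by
  have hΨn : ContDiffAt ℝ n Ψ p := hΨ.of_le (by norm_cast; omega)
  exact (hB.fderiv_right (by norm_cast)).prodMk
    (((hH.fderiv_right (m := n) (by norm_cast)).comp p hΨn).prodMk
      (((hH.of_le (by norm_cast; omega)).comp p hΨn).prodMk (hΨ.fderiv_right (by norm_cast))))

variable [FiniteDimensional ℝ E]

theorem IsIsometryBelow.eventually_fderiv_fderiv_eq (hI : IsIsometryBelow δ B H ψ p)
    (hδ : Continuous δ) : ∀ᶠ x in 𝓝 p, δ x < 0 →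
      fderiv ℝ (fderiv ℝ ψ) x = hessianOfJet (metricJet B H ψ x) := by
  filter_upwards [hI.smooth, hI.nondegenerate, eventually_eventually_nhds.2 hI.isometry]
    with x h1 h2 h3 hx
  obtain ⟨hψ, hB, hH⟩ := h1 hx
  refine fderiv_fderiv_eq_hessianOfJet (hψ.of_le (by norm_cast))
    (hB.differentiableAt (by simp)) (hH.differentiableAt (by simp)) hI.symm h2 ?_
  filter_upwards [h3, (isOpen_lt hδ continuous_const).mem_nhds hx] with y hy hy0 using hy hy0

/-- The isometry relation persists at boundary points, by continuity. -/
theorem IsIsometryBelow.isInvertible_pairing (hI : IsIsometryBelow δ B H ψ p)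
    (hδ : Continuous δ) (hδe : ∀ x t, δ (x - t • e) = δ x - t) (hp : δ p ≤ 0)
    (hB : ContinuousAt B p) (hH : ContinuousAt H (Ψ p)) (hΨ : ContDiffAt ℝ 1 Ψ p)
    (hΨψ : Ψ =ᶠ[𝓝[{x | δ x ≤ 0}] p] ψ) :
    (pairing (H (Ψ p)) (fderiv ℝ Ψ p)).IsInvertible := by
  refine SpacetimeExt.isInvertible_pairing hI.nondegenerate.self_of_nhds fun v w => ?_
  have := nhdsWithin_neBot hδe hp
  have hL : ContinuousAt (fderiv ℝ Ψ) p := (hΨ.fderiv_right (m := 0) (by simp)).continuousAt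
  have hHΨ : ContinuousAt (fun x => H (Ψ x)) p := hH.comp hΨ.continuousAt
  have h1 : ContinuousAt (fun x => B x v w) p := (hB.clm_apply continuousAt_const).clm_apply
    continuousAt_const
  have h2 : ContinuousAt (fun x => H (Ψ x) (fderiv ℝ Ψ x v) (fderiv ℝ Ψ x w)) p :=
    (hHΨ.clm_apply (hL.clm_apply continuousAt_const)).clm_apply (hL.clm_apply continuousAt_const)
  refine tendsto_nhds_unique (h1.tendsto.mono_left (nhdsWithin_le_nhds (s := {x | δ x < 0})))
    ((h2.tendsto.mono_left nhdsWithin_le_nhds).congr' ?_)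
  filter_upwards [eventually_nhds_nhdsWithin_lt hI.isometry,
    eventually_nhds_nhdsWithin_lt (eventually_eventuallyEq_of_nhdsWithin hδ hΨψ)] with x hx hx'
  rw [hx, hx'.eq_of_nhds, hx'.fderiv_eq]

/-- An isometry of class `C^{n+1}` up to the boundary is of class `C^{n+2}` up to the boundary, if
the metrics are of class `C^{n+1}`: extend it as a function of class `C^{n+1}` and insert the
extension into the formula for the second derivative. -/
theorem IsIsometryBelow.contDiffWithinAt_succ (hI : IsIsometryBelow δ B H ψ p)
    (hδL : LipschitzWith K δ) (hδe : ∀ x t, δ (x - t • e) = δ x - t) (he : ‖e‖ ≤ 1)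
    (hp : δ p ≤ 0) (hB : ContDiffAt ℝ (n + 1 : ℕ) B p) (hH : ContDiffAt ℝ (n + 1 : ℕ) H (ψ p))
    (hψ : ContDiffWithinAt ℝ (n + 1 : ℕ) ψ {x | δ x ≤ 0} p) :
    ContDiffWithinAt ℝ (n + 1 + 1 : ℕ) ψ {x | δ x ≤ 0} p := by
  have hδ := hδL.continuous
  obtain ⟨Ψ, hΨ, hΨψ⟩ := exists_extension_of_contDiffWithinAt hδL hδe he hp hψ
  have hΨp : Ψ p = ψ p := hΨψ.self_of_nhdsWithin hp
  rw [← hΨp] at hH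
  have hinv := hI.isInvertible_pairing hδ hδe hp hB.continuousAt hH.continuousAt
    (hΨ.of_le (by norm_cast; omega)) hΨψ
  have hG : ContDiffAt ℝ n (fun x => hessianOfJet (metricJet B H Ψ x)) p :=
    (contDiffAt_hessianOfJet (y := metricJet B H Ψ p) hinv).comp p (contDiffAt_metricJet hB hH hΨ)
  have hL : ContDiffAt ℝ n (fderiv ℝ Ψ) p := hΨ.fderiv_right (by norm_cast)
  have hcont : ∀ {F : Type _} [NormedAddCommGroup F] [NormedSpace ℝ F] {f : E → F},
      ContDiffAt ℝ n f p → ∀ᶠ x in 𝓝 p, ContinuousAt f x := fun {F} _ _ {f} hf =>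
    (hf.eventually (by simp)).mono fun x hx => hx.continuousAt
  have hΨd : ∀ᶠ x in 𝓝 p, DifferentiableAt ℝ Ψ x :=
    (hΨ.eventually (by simp)).mono fun x hx =>
      hx.differentiableAt (by norm_cast)
  have hEq : ∀ᶠ x in 𝓝 p, δ x < 0 → DifferentiableAt ℝ (fderiv ℝ Ψ) x ∧
      fderiv ℝ (fderiv ℝ Ψ) x = hessianOfJet (metricJet B H Ψ x) := by
    filter_upwards [hI.smooth, hI.eventually_fderiv_fderiv_eq hδ,
      eventually_eventuallyEq_of_nhdsWithin hδ hΨψ] with x h1 h2 h3 hx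
    have h4 : fderiv ℝ Ψ =ᶠ[𝓝 x] fderiv ℝ ψ := (h3 hx).fderiv
    refine ⟨?_, ?_⟩
    · have h5 : DifferentiableAt ℝ (fderiv ℝ ψ) x :=
        ((h1 hx).1.fderiv_right (m := 1) (by norm_cast)).differentiableAt (by simp)
      exact h5.congr_of_eventuallyEq h4
    · rw [h4.fderiv_eq, h2 hx]
      simp only [metricJet, (h3 hx).eq_of_nhds, (h3 hx).fderiv_eq]
  obtain ⟨U, hU, hUo, hpU⟩ := eventually_nhds_iff.1 ((hcont hG).and ((hcont hL).and
    (hΨd.and hEq)))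
  have hUS : U ∩ {x | δ x ≤ 0} ∈ 𝓝[insert p {x | δ x ≤ 0}] p := by
    rw [insert_eq_of_mem (show p ∈ {x | δ x ≤ 0} from hp)]
    exact inter_mem (mem_nhdsWithin_of_mem_nhds (hUo.mem_nhds hpU)) self_mem_nhdsWithin
  have hLG : ∀ x ∈ U ∩ {x | δ x ≤ 0}, HasFDerivWithinAt (fderiv ℝ Ψ)
      (hessianOfJet (metricJet B H Ψ x)) {x | δ x ≤ 0} x := by
    rintro x ⟨hxU, hx⟩
    have hev : ∀ᶠ y in 𝓝 x, y ∈ U := hUo.eventually_mem hxU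
    refine hasFDerivWithinAt_sublevel_of_tendsto hδL hδe he hx
      (hev.mono fun y hy _ => (hU y hy).2.1.continuousWithinAt)
      (hev.mono fun y hy hy0 => ((hU y hy).2.2.2 hy0).1)
      (((hU x hxU).1.tendsto.mono_left nhdsWithin_le_nhds).congr' ?_)
    exact eventually_nhds_nhdsWithin_lt (hev.mono fun y hy hy0 => ((hU y hy).2.2.2 hy0).2.symm)
  refine ContDiffWithinAt.congr_of_eventuallyEq ?_ hΨψ.symm hΨp.symm
  have h1 : ContDiffWithinAt ℝ (n + 1 : ℕ) (fderiv ℝ Ψ) {x | δ x ≤ 0} p := by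
    push_cast
    rw [contDiffWithinAt_succ_iff_hasFDerivWithinAt' (by simp)]
    exact ⟨_, hUS, by rw [insert_eq_of_mem (show p ∈ {x | δ x ≤ 0} from hp)]; exact
      inter_subset_right, by simp, _, hLG, hG.contDiffWithinAt⟩
  have h2 : ((n + 1 + 1 : ℕ) : WithTop ℕ∞) = ((n + 1 : ℕ) : WithTop ℕ∞) + 1 := by norm_cast
  rw [h2, contDiffWithinAt_succ_iff_hasFDerivWithinAt' (by simp)]
  exact ⟨_, hUS, by rw [insert_eq_of_mem (show p ∈ {x | δ x ≤ 0} from hp)]; exact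
    inter_subset_right, by simp, _, fun x hx => (hU x hx.1).2.2.1.hasFDerivAt.hasFDerivWithinAt, h1⟩

theorem IsIsometryBelow.contDiffWithinAt (hI : IsIsometryBelow δ B H ψ p)
    (hδL : LipschitzWith K δ) (hδe : ∀ x t, δ (x - t • e) = δ x - t) (he : ‖e‖ ≤ 1)
    (hp : δ p ≤ 0) (hB : ContDiffAt ℝ k B p) (hH : ContDiffAt ℝ k H (ψ p))
    (hψ : ContDiffWithinAt ℝ 1 ψ {x | δ x ≤ 0} p) :
    ContDiffWithinAt ℝ (k + 1 : ℕ) ψ {x | δ x ≤ 0} p := by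
  suffices h : ∀ n ≤ k, ContDiffWithinAt ℝ (n + 1 : ℕ) ψ {x | δ x ≤ 0} p from h k le_rfl
  intro n
  induction n with
  | zero => intro _; exact_mod_cast hψ
  | succ n ih =>
    intro hn
    exact hI.contDiffWithinAt_succ hδL hδe he hp (hB.of_le (by exact_mod_cast hn))
      (hH.of_le (by exact_mod_cast hn)) (ih (by omega))

/-- If the metrics are of class `C^{k,1}_loc`, then the derivatives of order `k + 2` of the isometry
are bounded near the boundary. -/
theorem IsIsometryBelow.exists_bound (hI : IsIsometryBelow δ B H ψ p)
    (hδ : Continuous δ) (hδe : ∀ x t, δ (x - t • e) = δ x - t) (hp : δ p ≤ 0)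
    (hB : CkaAt k 1 B p) (hH : CkaAt k 1 H (Ψ p)) (hΨ : ContDiffAt ℝ (k + 1 : ℕ) Ψ p)
    (hΨψ : Ψ =ᶠ[𝓝[{x | δ x ≤ 0}] p] ψ) :
    ∃ C : ℝ, ∀ᶠ x in 𝓝 p, δ x < 0 → ‖iteratedFDeriv ℝ (k + 2) ψ x‖ ≤ C := by
  set l := 𝓝[{x | δ x < 0}] p with hl
  have hlp : l ≤ 𝓝 p := nhdsWithin_le_nhds
  have hinv := hI.isInvertible_pairing hδ hδe hp hB.1.continuousAt hH.1.continuousAt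
    (hΨ.of_le (by norm_cast; omega)) hΨψ
  have hEq := eventually_nhds_nhdsWithin_lt (eventually_eventuallyEq_of_nhdsWithin hδ hΨψ)
  have hsm := eventually_nhds_nhdsWithin_lt hI.smooth
  have hinf : ((k + 1 : ℕ) : WithTop ℕ∞) ≤ ∞ := by exact_mod_cast le_top
  have hΨk : ContDiffAt ℝ k Ψ p := hΨ.of_le (by norm_cast; omega)
  have hΨl : BddDerivs k Ψ l := BddDerivs.of_contDiffAt hΨk hlp
  have hΨt : Tendsto Ψ l (𝓝 (Ψ p)) := hΨ.continuousAt.tendsto.mono_left hlp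
  have hDB : BddDerivs k (fderiv ℝ B) l := BddDerivs.fderiv_of_bound
    (hsm.mono fun x hx => hx.2.1.of_le hinf) fun i hi => by
      obtain ⟨C, hC⟩ := hB.eventually_norm_iteratedFDeriv_le hi
      exact ⟨C, hC.filter_mono hlp⟩
  have hDH : BddDerivs k (fderiv ℝ H) (map Ψ l) := BddDerivs.fderiv_of_bound
    (by
      have : ∀ᶠ x in l, ContDiffAt ℝ (k + 1 : ℕ) H (Ψ x) := by
        filter_upwards [hsm, hEq] with x hx hx'
        rw [hx'.eq_of_nhds]
        exact hx.2.2.of_le hinf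
      exact this) fun i hi => by
      obtain ⟨C, hC⟩ := hH.eventually_norm_iteratedFDeriv_le hi
      exact ⟨C, hC.filter_mono hΨt⟩
  have hHΨ : ContDiffAt ℝ k (fun x => H (Ψ x)) p := hH.1.comp p hΨk
  have hL : ContDiffAt ℝ k (fderiv ℝ Ψ) p := hΨ.fderiv_right (by norm_cast)
  have hjet : BddDerivs k (metricJet B H Ψ) l :=
    hDB.prodMk ((hΨl.comp hDH).prodMk ((BddDerivs.of_contDiffAt hHΨ hlp).prodMk
      (BddDerivs.of_contDiffAt hL hlp)))
  -- `DB` and `DH ∘ Ψ` are merely bounded, whereas `H ∘ Ψ` and `DΨ` converge, to values at which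
  -- the formula for the second derivative is smooth
  obtain ⟨C₁, hC₁⟩ := hDB.2 0 (Nat.zero_le k)
  obtain ⟨C₂, hC₂⟩ := (hΨl.comp hDH).2 0 (Nat.zero_le k)
  have hopen : ∀ᶠ y in 𝓝 (H (Ψ p), fderiv ℝ Ψ p),
      (pairing (y : (E →L[ℝ] E →L[ℝ] ℝ) × (E →L[ℝ] E)).1 y.2).IsInvertible := by
    have hc : Continuous fun y : (E →L[ℝ] E →L[ℝ] ℝ) × (E →L[ℝ] E) => pairing y.1 y.2 :=
      ((ContinuousLinearMap.continuous _).comp continuous_snd).clm_comp continuous_fst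
    obtain ⟨N, hN⟩ := hinv
    have h1 := ContinuousLinearEquiv.nhds N
    rw [hN] at h1
    filter_upwards [hc.continuousAt.preimage_mem_nhds h1] with y hy
    obtain ⟨N', hN'⟩ := hy
    exact ⟨N', hN'⟩
  obtain ⟨r, hr, hball⟩ := Metric.nhds_basis_closedBall.eventually_iff.1 hopen
  let S : Set (MetricJet E) := Metric.closedBall 0 C₁ ×ˢ (Metric.closedBall 0 C₂ ×ˢ
    (Metric.closedBall (H (Ψ p)) r ×ˢ Metric.closedBall (fderiv ℝ Ψ p) r))
  have hS : IsCompact S := by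
    have : ProperSpace (Tri E) := FiniteDimensional.proper_real _
    have : ProperSpace (E →L[ℝ] E →L[ℝ] ℝ) := FiniteDimensional.proper_real _
    have : ProperSpace (E →L[ℝ] E) := FiniteDimensional.proper_real _
    exact (isCompact_closedBall _ _).prod ((isCompact_closedBall _ _).prod
      ((isCompact_closedBall _ _).prod (isCompact_closedBall _ _)))
  have hjS : ∀ᶠ x in l, metricJet B H Ψ x ∈ S := by
    filter_upwards [hC₁, hC₂,
      (hHΨ.continuousAt.tendsto.mono_left hlp).eventually (Metric.closedBall_mem_nhds _ hr),
      (hL.continuousAt.tendsto.mono_left hlp).eventually (Metric.closedBall_mem_nhds _ hr)]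
      with x h1 h2 h3 h4
    rw [norm_iteratedFDeriv_zero] at h1 h2
    exact ⟨mem_closedBall_zero_iff.2 h1, mem_closedBall_zero_iff.2 h2, h3, h4⟩
  have hhess : BddDerivs k (hessianOfJet ∘ metricJet B H Ψ) l := by
    refine hjet.comp (BddDerivs.of_isCompact hS hjS fun y hy => contDiffAt_hessianOfJet ?_)
    exact hball (x := y.2.2) (by rw [← closedBall_prod_same]; exact hy.2.2)
  have hfin : BddDerivs k (fderiv ℝ (fderiv ℝ ψ)) l := by
    refine hhess.congr ?_
    have h1 : ∀ᶠ x in 𝓝 p, δ x < 0 →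
        fderiv ℝ (fderiv ℝ ψ) =ᶠ[𝓝 x] hessianOfJet ∘ metricJet B H Ψ := by
      filter_upwards [eventually_eventually_nhds.2 (hI.eventually_fderiv_fderiv_eq hδ),
        eventually_eventually_nhds.2 (eventually_eventuallyEq_of_nhdsWithin hδ hΨψ)] with x h1 h2 hx
      filter_upwards [h1, h2, (isOpen_lt hδ continuous_const).mem_nhds hx] with y h3 h4 hy
      rw [h3 hy, Function.comp_apply]
      simp only [metricJet, (h4 hy).eq_of_nhds, (h4 hy).fderiv_eq]
    exact eventually_nhds_nhdsWithin_lt h1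
  obtain ⟨C, hC⟩ := hfin.2 k le_rfl
  refine ⟨C, (eventually_nhdsWithin_iff.1 hC).mono fun x hx hx0 => ?_⟩
  have := hx hx0
  rwa [norm_iteratedFDeriv_fderiv, norm_iteratedFDeriv_fderiv] at this

/-- The local form of the theorem: near each point on or below the graph the isometry extends as a
map of class `C^{k+1,a}_loc`. -/
theorem IsIsometryBelow.exists_extension (hI : IsIsometryBelow δ B H ψ p)
    (hδL : LipschitzWith K δ) (hδe : ∀ x t, δ (x - t • e) = δ x - t) (he : ‖e‖ ≤ 1)
    (hp : δ p ≤ 0) {a : Fin 2} (hB : CkaAt k a B p) (hH : CkaAt k a H (ψ p))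
    (hψ : ContDiffWithinAt ℝ 1 ψ {x | δ x ≤ 0} p) :
    ∃ F : E → E, CkaAt (k + 1) a F p ∧ F =ᶠ[𝓝[{x | δ x ≤ 0}] p] ψ := by
  have hδ := hδL.continuous
  have hk := hI.contDiffWithinAt hδL hδe he hp hB.1 hH.1 hψ
  obtain ⟨Ψ, hΨ, hΨψ⟩ := exists_extension_of_contDiffWithinAt hδL hδe he hp hk
  by_cases ha : a = 1
  · subst ha
    have hΨp : Ψ p = ψ p := hΨψ.self_of_nhdsWithin hp
    obtain ⟨C, hC⟩ := hI.exists_bound hδ hδe hp hB (by rwa [hΨp]) hΨ hΨψ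
    obtain ⟨F, hF, hFψ, hFL⟩ := exists_lipschitz_extension_of_contDiffWithinAt hδL hδe he hp hk
      (C := C) (by
        filter_upwards [hC, hI.smooth] with x h1 h2 hx
        exact ⟨(h2 hx).1.of_le (by exact_mod_cast le_top), h1 hx⟩)
    exact ⟨F, ⟨hF, fun _ => hFL⟩, hFψ⟩
  · exact ⟨Ψ, ⟨hΨ, fun h => absurd h ha⟩, hΨψ⟩

end Bootstrap

/-! ### Gluing local extensions -/

section Algebra

/-- `f` is Lipschitz in some neighbourhood of `x`. -/
def LipschitzNear {X Y : Type*} [PseudoEMetricSpace X] [PseudoEMetricSpace Y] (f : X → Y) (x : X) :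
    Prop :=
  ∃ K : NNReal, ∃ t ∈ 𝓝 x, LipschitzOnWith K f t

theorem LipschitzNear.congr {X Y : Type*} [PseudoEMetricSpace X] [PseudoEMetricSpace Y] {x : X}
    {f g : X → Y} (hf : LipschitzNear f x) (h : g =ᶠ[𝓝 x] f) :
    LipschitzNear g x := by
  obtain ⟨K, t, ht, hK⟩ := hf
  refine ⟨K, t ∩ {y | g y = f y}, inter_mem ht h, fun y hy z hz => ?_⟩
  rw [show g y = f y from hy.2, show g z = f z from hz.2]
  exact hK hy.1 hz.1

theorem LipschitzNear.add {X Y : Type*} [PseudoEMetricSpace X] [SeminormedAddCommGroup Y] {x : X}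
    {f g : X → Y} (hf : LipschitzNear f x) (hg : LipschitzNear g x) :
    LipschitzNear (fun y => f y + g y) x := by
  obtain ⟨K, t, ht, hK⟩ := hf
  obtain ⟨K', t', ht', hK'⟩ := hg
  exact ⟨K + K', t ∩ t', inter_mem ht ht',
    (hK.mono inter_subset_left).add (hK'.mono inter_subset_right)⟩

universe u

variable {E : Type u} [NormedAddCommGroup E] [NormedSpace ℝ E]

theorem LipschitzNear.bilinear {X W₁ W₂ W₃ : Type*} [PseudoMetricSpace X] {x : X}
    [NormedAddCommGroup W₁] [NormedSpace ℝ W₁] [NormedAddCommGroup W₂] [NormedSpace ℝ W₂]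
    [NormedAddCommGroup W₃] [NormedSpace ℝ W₃] (L : W₁ →L[ℝ] W₂ →L[ℝ] W₃) {f : X → W₁} {g : X → W₂}
    (hf : LipschitzNear f x) (hg : LipschitzNear g x) (hfc : ContinuousAt f x)
    (hgc : ContinuousAt g x) : LipschitzNear (fun y => L (f y) (g y)) x := by
  obtain ⟨K, t, ht, hK⟩ := hf
  obtain ⟨K', t', ht', hK'⟩ := hg
  set A : NNReal := ‖f x‖₊ + 1
  set B : NNReal := ‖g x‖₊ + 1
  have hA : ∀ᶠ y in 𝓝 x, ‖f y‖ ≤ A := hfc.norm.eventually (ge_mem_nhds (by simp [A]))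
  have hB : ∀ᶠ y in 𝓝 x, ‖g y‖ ≤ B := hgc.norm.eventually (ge_mem_nhds (by simp [B]))
  refine ⟨‖L‖₊ * (K * B + A * K'), _, inter_mem (inter_mem ht ht') (inter_mem hA hB),
    LipschitzOnWith.of_dist_le_mul fun y hy z hz => ?_⟩
  have h1 := hK.dist_le_mul y hy.1.1 z hz.1.1
  have h2 := hK'.dist_le_mul y hy.1.2 z hz.1.2
  have h3 : ‖f z‖ ≤ A := hz.2.1
  have h4 : ‖g y‖ ≤ B := hy.2.2
  rw [dist_eq_norm] at h1 h2 ⊢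
  have h5 : L (f y) (g y) - L (f z) (g z) = L (f y - f z) (g y) + L (f z) (g y - g z) := by
    simp
  rw [h5]
  push_cast
  calc _ ≤ ‖L‖ * ‖f y - f z‖ * ‖g y‖ + ‖L‖ * ‖f z‖ * ‖g y - g z‖ :=
        (norm_add_le _ _).trans (add_le_add (L.le_opNorm₂ _ _) (L.le_opNorm₂ _ _))
    _ ≤ ‖L‖ * (K * dist y z) * B + ‖L‖ * A * (K' * dist y z) := by gcongr
    _ = _ := by ring

variable {W : Type u} [NormedAddCommGroup W] [NormedSpace ℝ W] {k : ℕ} {a : Fin 2} {x : E}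

theorem ContDiffAt.lipschitzNear {f : E → W} (hf : ContDiffAt ℝ 1 f x) : LipschitzNear f x :=
  hf.exists_lipschitzOnWith

theorem lipschitzNear_iteratedFDeriv_zero {f : E → W} :
    LipschitzNear (iteratedFDeriv ℝ 0 f) x ↔ LipschitzNear f x := by
  have h : ∀ y z, edist (iteratedFDeriv ℝ 0 f y) (iteratedFDeriv ℝ 0 f z) = edist (f y) (f z) :=
    fun y z => by
      rw [iteratedFDeriv_zero_eq_comp]
      exact (continuousMultilinearCurryFin0 ℝ E W).symm.isometry _ _
  simp only [LipschitzNear, LipschitzOnWith, h]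

theorem lipschitzNear_iteratedFDeriv_succ {f : E → W} :
    LipschitzNear (iteratedFDeriv ℝ (k + 1) f) x ↔
      LipschitzNear (iteratedFDeriv ℝ k (fderiv ℝ f)) x := by
  have h : ∀ y z, edist (iteratedFDeriv ℝ (k + 1) f y) (iteratedFDeriv ℝ (k + 1) f z) =
      edist (iteratedFDeriv ℝ k (fderiv ℝ f) y) (iteratedFDeriv ℝ k (fderiv ℝ f) z) :=
    fun y z => by
      rw [iteratedFDeriv_succ_eq_comp_right (x := y), iteratedFDeriv_succ_eq_comp_right (x := z),
        Function.comp_apply, Function.comp_apply, LinearIsometryEquiv.edist_map]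
  simp only [LipschitzNear, LipschitzOnWith, h]

theorem CkaAt.congr {f g : E → W} (hf : CkaAt k a f x) (h : g =ᶠ[𝓝 x] f) : CkaAt k a g x :=
  ⟨hf.1.congr_of_eventuallyEq h, fun ha => LipschitzNear.congr (hf.2 ha) (h.iteratedFDeriv ℝ k)⟩

theorem CkaAt.of_contDiffAt {f : E → W} (hf : ContDiffAt ℝ (k + 1 : ℕ) f x) : CkaAt k a f x :=
  ⟨hf.of_le (by norm_cast; omega), fun _ => ContDiffAt.lipschitzNear
    (hf.iteratedFDeriv_right (m := 1) (i := k) (by norm_cast; omega))⟩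

theorem CkaAt.add {f g : E → W} (hf : CkaAt k a f x) (hg : CkaAt k a g x) :
    CkaAt k a (fun y => f y + g y) x := by
  refine ⟨hf.1.add hg.1, fun ha => ?_⟩
  refine (LipschitzNear.add (hf.2 ha) (hg.2 ha)).congr ?_
  filter_upwards [hf.1.eventually (by simp), hg.1.eventually (by simp)] with y h1 h2
  exact iteratedFDeriv_add_apply h1 h2

theorem CkaAt.fderiv {f : E → W} (hf : CkaAt (k + 1) a f x) : CkaAt k a (fderiv ℝ f) x :=
  ⟨hf.1.fderiv_right (by norm_cast), fun ha => lipschitzNear_iteratedFDeriv_succ.1 (hf.2 ha)⟩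

/-- Products of functions of class `C^{k,a}_loc` are of this class. -/
theorem CkaAt.bilinear (k : ℕ) : ∀ {W₁ W₂ W₃ : Type u} [NormedAddCommGroup W₁] [NormedSpace ℝ W₁]
    [NormedAddCommGroup W₂] [NormedSpace ℝ W₂] [NormedAddCommGroup W₃] [NormedSpace ℝ W₃]
    (L : W₁ →L[ℝ] W₂ →L[ℝ] W₃) {f : E → W₁} {g : E → W₂},
    CkaAt k a f x → CkaAt k a g x → CkaAt k a (fun y => L (f y) (g y)) x := by
  induction k with
  | zero =>
    intro W₁ W₂ W₃ _ _ _ _ _ _ L f g hf hg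
    refine ⟨(L.contDiff.contDiffAt.comp x hf.1).clm_apply hg.1, fun ha => ?_⟩
    exact lipschitzNear_iteratedFDeriv_zero.2 (LipschitzNear.bilinear L
      (lipschitzNear_iteratedFDeriv_zero.1 (hf.2 ha))
      (lipschitzNear_iteratedFDeriv_zero.1 (hg.2 ha)) hf.1.continuousAt hg.1.continuousAt)
  | succ k ih =>
    intro W₁ W₂ W₃ _ _ _ _ _ _ L f g hf hg
    refine ⟨(L.contDiff.contDiffAt.comp x hf.1).clm_apply hg.1, fun ha => ?_⟩
    have hf0 : CkaAt k a f x := CkaAt.of_contDiffAt hf.1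
    have hg0 : CkaAt k a g x := CkaAt.of_contDiffAt hg.1
    have h := (ih (L.precompR E) hf0 hg.fderiv).add (ih (L.precompL E) hf.fderiv hg0)
    refine lipschitzNear_iteratedFDeriv_succ.2 (CkaAt.congr h ?_ |>.2 ha)
    filter_upwards [hf.1.eventually (by simp), hg.1.eventually (by simp)] with y h1 h2
    exact (L.hasFDerivAt_of_bilinear (h1.differentiableAt (by norm_cast)).hasFDerivAt
      (h2.differentiableAt (by norm_cast)).hasFDerivAt).fderiv

theorem CkaAt.eventually {f : E → W} (hf : CkaAt k a f x) : ∀ᶠ y in 𝓝 x, CkaAt k a f y := by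
  by_cases ha : a = 1
  · obtain ⟨K, t, ht, hK⟩ := hf.2 ha
    filter_upwards [hf.1.eventually (by simp), eventually_mem_nhds_iff.2 ht] with y h1 h2
    exact ⟨h1, fun _ => ⟨K, t, h2, hK⟩⟩
  · filter_upwards [hf.1.eventually (by simp)] with y h1 using ⟨h1, fun h => absurd h ha⟩

theorem CkaAt.sum {ι : Type*} {f : ι → E → W} {s : Finset ι}
    (h : ∀ i ∈ s, CkaAt k a (f i) x) : CkaAt k a (fun y => ∑ i ∈ s, f i y) x := by
  classical
  induction s using Finset.induction_on with
  | empty =>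
    simp only [Finset.sum_empty]
    exact CkaAt.of_contDiffAt contDiffAt_const
  | insert i s hi ih =>
    simp only [Finset.sum_insert hi]
    exact (h i (Finset.mem_insert_self i s)).add
      (ih fun j hj => h j (Finset.mem_insert_of_mem hj))

theorem ckaLocOn_iff {f : E → W} {O : Set E} (hO : IsOpen O) :
    CkaLocOn k a f O ↔ ∀ y ∈ O, CkaAt k a f y := by
  have heq : EqOn (iteratedFDerivWithin ℝ k f O) (iteratedFDeriv ℝ k f) O :=
    iteratedFDerivWithin_of_isOpen k hO
  constructor
  · intro h y hy
    refine ⟨h.1.contDiffAt (hO.mem_nhds hy), fun ha => ?_⟩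
    obtain ⟨K, t, ht, hK⟩ := h.2 ha hy
    rw [hO.nhdsWithin_eq hy] at ht
    refine ⟨K, t ∩ O, inter_mem ht (hO.mem_nhds hy), fun u hu v hv => ?_⟩
    rw [← heq hu.2, ← heq hv.2]
    exact hK hu.1 hv.1
  · intro h
    refine ⟨fun y hy => (h y hy).1.contDiffWithinAt, fun ha y hy => ?_⟩
    obtain ⟨K, t, ht, hK⟩ := (h y hy).2 ha
    refine ⟨K, t ∩ O, mem_nhdsWithin_of_mem_nhds (inter_mem ht (hO.mem_nhds hy)),
      fun u hu v hv => ?_⟩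
    rw [heq hu.2, heq hv.2]
    exact hK hu.1 hv.1

/-- Local extensions of class `C^{k,a}_loc` of a function on a set glue to a global one, by means of
a partition of unity on the union of their domains. -/
theorem ckaLocOnSet_of_local {E W : Type} [NormedAddCommGroup E] [NormedSpace ℝ E]
    [FiniteDimensional ℝ E] [NormedAddCommGroup W] [NormedSpace ℝ W] {A : Set E} {ψ : E → W}
    (h : ∀ p ∈ A, ∃ F : E → W, CkaAt k a F p ∧ F =ᶠ[𝓝[A] p] ψ) : CkaLocOnSet k a ψ A := by
  classical
  have h' : ∀ p : A, ∃ F : E → W, ∃ U : Set E, IsOpen U ∧ (p : E) ∈ U ∧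
      ∀ y ∈ U, CkaAt k a F y ∧ (y ∈ A → F y = ψ y) := by
    rintro ⟨p, hp⟩
    obtain ⟨F, hF, hFψ⟩ := h p hp
    obtain ⟨U, hU, hUo, hpU⟩ := eventually_nhds_iff.1
      (hF.eventually.and (eventually_nhdsWithin_iff.1 hFψ))
    exact ⟨F, U, hUo, hpU, hU⟩
  choose F U hUo hpU hU using h'
  let O : TopologicalSpace.Opens E := ⟨⋃ p, U p, isOpen_iUnion hUo⟩
  have hAO : A ⊆ O := fun p hp => mem_iUnion.2 ⟨⟨p, hp⟩, hpU ⟨p, hp⟩⟩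
  have : LocallyCompactSpace O := O.isOpen.locallyCompactSpace
  have : SigmaCompactSpace O := sigmaCompactSpace_of_locallyCompact_secondCountable
  obtain ⟨ρ, hρ⟩ := SmoothPartitionOfUnity.exists_isSubordinate 𝓘(ℝ, E) (M := O)
    (s := univ) isClosed_univ (fun p : A => Subtype.val ⁻¹' U p)
    (fun p => (hUo p).preimage continuous_subtype_val)
    (fun y _ => by
      obtain ⟨p, hp⟩ := mem_iUnion.1 y.2
      exact mem_iUnion.2 ⟨p, hp⟩)
  let r : A → E → ℝ := fun p y => if hy : y ∈ O then ρ p ⟨y, hy⟩ else 0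
  have hr : ∀ p (y : O), r p y = ρ p y := fun p y => by simp [r]
  have hrs : ∀ p, ∀ y ∈ O, ContDiffAt ℝ ∞ (r p) y := by
    intro p y hy
    have h1 : ContMDiffAt 𝓘(ℝ, E) 𝓘(ℝ, ℝ) ∞ (fun z : O => r p z) ⟨y, hy⟩ := by
      simp only [hr]
      exact (ρ p).contMDiff.contMDiffAt
    exact (contMDiffAt_subtype_iff.1 h1).contDiffAt
  have hr0 : ∀ p, ∀ y ∈ O, y ∉ U p → r p =ᶠ[𝓝 y] 0 := by
    intro p y hy hyU
    have h1 : (⟨y, hy⟩ : O) ∉ tsupport (ρ p) := fun h => hyU (hρ p h)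
    have h2 : (ρ p : O → ℝ) =ᶠ[𝓝 (⟨y, hy⟩ : O)] 0 := notMem_tsupport_iff_eventuallyEq.1 h1
    have h3 := O.isOpen.isOpenEmbedding_subtypeVal.image_mem_nhds.2 h2
    filter_upwards [h3] with z hz
    obtain ⟨w, hw, rfl⟩ := hz
    rw [hr]
    exact hw
  let G : E → W := fun y => ∑ᶠ p, r p y • F p y
  refine ⟨O, G, O.isOpen, hAO, (ckaLocOn_iff O.isOpen).2 fun y hy => ?_, fun y hy => ?_⟩
  · obtain ⟨t, ht, hfin⟩ := ρ.locallyFinite ⟨y, hy⟩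
    have h1 : ∀ᶠ z in 𝓝 y, G z = ∑ p ∈ hfin.toFinset, r p z • F p z := by
      filter_upwards [O.isOpen.isOpenEmbedding_subtypeVal.image_mem_nhds.2 ht] with z hz
      obtain ⟨w, hw, rfl⟩ := hz
      refine finsum_eq_sum_of_support_subset _ fun p hp => ?_
      rw [Finite.coe_toFinset]
      refine ⟨w, fun h0 => hp ?_, hw⟩
      change r p w • F p w = 0
      rw [hr, h0, zero_smul]
    refine CkaAt.congr (CkaAt.sum (s := hfin.toFinset) fun p _ => ?_) h1
    by_cases hyU : y ∈ U p
    · exact CkaAt.bilinear k (.lsmul ℝ ℝ : ℝ →L[ℝ] W →L[ℝ] W) (CkaAt.of_contDiffAt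
        ((hrs p y hy).of_le (show ((k + 1 : ℕ) : WithTop ℕ∞) ≤ ∞ by exact_mod_cast le_top)))
        (hU p y hyU).1
    · refine CkaAt.congr (CkaAt.of_contDiffAt (contDiffAt_const (c := 0))) ?_
      filter_upwards [hr0 p y hy hyU] with z hz
      rw [hz, Pi.zero_apply, zero_smul]
  · have hyO := hAO hy
    have h1 : ∀ p, r p y • F p y = r p y • ψ y := fun p => by
      by_cases hyU : y ∈ U p
      · rw [(hU p y hyU).2 hy]
      · rw [(hr0 p y hyO hyU).eq_of_nhds, Pi.zero_apply, zero_smul, zero_smul]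
    have hfin : (Function.support fun p => r p y).Finite := by
      refine (ρ.locallyFinite.point_finite ⟨y, hyO⟩).subset fun p hp => ?_
      intro h0
      exact hp ((hr p ⟨y, hyO⟩).trans h0)
    change ∑ᶠ p, r p y • F p y = ψ y
    simp only [h1]
    rw [← finsum_smul' hfin]
    have h2 : ∑ᶠ p, r p y = 1 := by
      have := ρ.sum_eq_one (mem_univ (⟨y, hyO⟩ : O))
      rw [← this]
      exact finsum_congr fun p => hr p ⟨y, hyO⟩
    rw [h2, one_smul]

end Algebra

/-! ### Lorentzian metrics and isometric embeddings in coordinates -/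

section Coordinates

set_option maxSynthPendingDepth 3

variable {d : ℕ} {M N : Type*} [TopologicalSpace M] [ChartedSpace (E d) M]
  [TopologicalSpace N] [ChartedSpace (E d) N]

theorem LorentzMetric.nondegenerate (g : LorentzMetric d M) {x : M}
    {v : TangentSpace (𝓡 (d + 1)) x} (h : ∀ w, g.val x v w = 0) : v = 0 := by
  obtain ⟨b, hb⟩ := g.signature x
  refine b.ext_elem fun j => ?_
  have h1 : g.val x v (b j) = b.repr v j * (if j = 0 then -1 else 1) := by
    conv_lhs => rw [← b.sum_repr v]
    rw [map_sum, _root_.sum_apply]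
    simp only [map_smul, _root_.smul_apply, hb, smul_eq_mul]
    simp
  rw [h] at h1
  rw [map_zero, Finsupp.zero_apply]
  split_ifs at h1 <;> linarith

theorem LorentzMetric.coord_symm (g : LorentzMetric d M) (e : OpenPartialHomeomorph M (E d))
    (y v w : E d) : g.coord e y v w = g.coord e y w v :=
  g.symm _ _ _

theorem mdifferentiable_of_mem_maximalAtlas {e : OpenPartialHomeomorph M (E d)}
    (he : e ∈ IsManifold.maximalAtlas (𝓡 (d + 1)) ∞ M) :
    e.MDifferentiable (𝓡 (d + 1)) (𝓡 (d + 1)) :=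
  ⟨(contMDiffOn_of_mem_maximalAtlas he).mdifferentiableOn (by simp),
    (contMDiffOn_symm_of_mem_maximalAtlas he).mdifferentiableOn (by simp)⟩

theorem LorentzMetric.coord_nondegenerate (g : LorentzMetric d M)
    {e : OpenPartialHomeomorph M (E d)} (he : e ∈ IsManifold.maximalAtlas (𝓡 (d + 1)) ∞ M)
    {y : E d} (hy : y ∈ e.target) {v : E d} (h : ∀ w, g.coord e y v w = 0) : v = 0 := by
  have hb := (mdifferentiable_of_mem_maximalAtlas he).symm.mfderiv_bijective hy
  refine hb.1 (Eq.trans (g.nondegenerate fun w => ?_) (map_zero _).symm)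
  obtain ⟨u, rfl⟩ := hb.2 w
  exact h u

variable {g : LorentzMetric d M} {h : LorentzMetric d N} {ι : M → N} {k : ℕ} {a : Fin 2}

theorem IsExtension.contDiffAt_coord (hι : IsExtension g h ι k a)
    {c : OpenPartialHomeomorph M (E d)} (hc : c ∈ IsManifold.maximalAtlas (𝓡 (d + 1)) ∞ M)
    {e : OpenPartialHomeomorph N (E d)} (he : e ∈ IsManifold.maximalAtlas (𝓡 (d + 1)) ∞ N)
    {y : E d} (hy : y ∈ c.target) (hιy : ι (c.symm y) ∈ e.source) :
    ContDiffAt ℝ ∞ (e ∘ ι ∘ c.symm) y :=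
  ((contMDiffAt_of_mem_maximalAtlas he hιy).comp y
    (hι.embedding.contMDiff.contMDiffAt.comp y
      (contMDiffAt_symm_of_mem_maximalAtlas hc hy))).contDiffAt

/-- In charts, an isometric embedding pulls the matrix of the second metric back to that of the
first one. -/
theorem IsExtension.coord_eq (hι : IsExtension g h ι k a)
    {c : OpenPartialHomeomorph M (E d)} (hc : c ∈ IsManifold.maximalAtlas (𝓡 (d + 1)) ∞ M)
    {e : OpenPartialHomeomorph N (E d)} (he : e ∈ IsManifold.maximalAtlas (𝓡 (d + 1)) ∞ N)
    {y : E d} (hy : y ∈ c.target) (hιy : ι (c.symm y) ∈ e.source) (v w : E d) :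
    g.coord c y v w = h.coord e ((e ∘ ι ∘ c.symm) y) (fderiv ℝ (e ∘ ι ∘ c.symm) y v)
      (fderiv ℝ (e ∘ ι ∘ c.symm) y w) := by
  have hcs : MDifferentiableAt (𝓡 (d + 1)) (𝓡 (d + 1)) c.symm y :=
    (contMDiffAt_symm_of_mem_maximalAtlas hc hy).mdifferentiableAt (by simp)
  have hιd : MDifferentiableAt (𝓡 (d + 1)) (𝓡 (d + 1)) ι (c.symm y) :=
    hι.embedding.contMDiff.contMDiffAt.mdifferentiableAt (by simp)
  have hes : MDifferentiableAt (𝓡 (d + 1)) (𝓡 (d + 1)) e.symm ((e ∘ ι ∘ c.symm) y) :=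
    (contMDiffAt_symm_of_mem_maximalAtlas he (e.map_source hιy)).mdifferentiableAt (by simp)
  have hΦ : MDifferentiableAt (𝓡 (d + 1)) (𝓡 (d + 1)) (e ∘ ι ∘ c.symm) y :=
    ((hι.contDiffAt_coord hc he hy hιy).differentiableAt (by simp)).mdifferentiableAt
  have heq : e.symm ∘ (e ∘ ι ∘ c.symm) =ᶠ[𝓝 y] ι ∘ c.symm := by
    have h1 : ∀ᶠ z in 𝓝 y, ι (c.symm z) ∈ e.source :=
      (hιd.continuousAt.comp hcs.continuousAt).eventually (e.open_source.mem_nhds hιy)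
    filter_upwards [h1] with z hz
    exact e.left_inv hz
  have h1 := heq.mfderiv_eq (I := 𝓡 (d + 1)) (I' := 𝓡 (d + 1))
  rw [mfderiv_comp y hes hΦ, mfderiv_comp y hιd hcs] at h1
  have h2 : ∀ u : E d, mfderiv (𝓡 (d + 1)) (𝓡 (d + 1)) e.symm ((e ∘ ι ∘ c.symm) y)
      (fderiv ℝ (e ∘ ι ∘ c.symm) y u) = mfderiv (𝓡 (d + 1)) (𝓡 (d + 1)) ι (c.symm y)
        (mfderiv (𝓡 (d + 1)) (𝓡 (d + 1)) c.symm y u) := fun u => by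
    have := DFunLike.congr_fun h1 u
    rw [← mfderiv_eq_fderiv]
    exact this
  rw [LorentzMetric.coord_apply, LorentzMetric.coord_apply, h2, h2, ← hι.isometric]
  have h3 : e.symm ((e ∘ ι ∘ c.symm) y) = ι (c.symm y) := e.left_inv hιy
  rw [h3]

/-- An isometric embedding between manifolds of the same dimension has local inverses: in charts,
there is a smooth map `s` with values in a chart of `M` such that `ι ∘ s` is the inverse of the
given chart of `N`, and the metric of `N` is the pull-back of the one of `M` by `s`. -/
theorem IsExtension.exists_local_inverse [IsManifold (𝓡 (d + 1)) ∞ M] (hι : IsExtension g h ι k a)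
    {e : OpenPartialHomeomorph N (E d)} (he : e ∈ IsManifold.maximalAtlas (𝓡 (d + 1)) ∞ N)
    {m : M} (hm : ι m ∈ e.source) :
    ∃ c ∈ IsManifold.maximalAtlas (𝓡 (d + 1)) ∞ M, m ∈ c.source ∧ ∃ s : E d → E d,
      s (e (ι m)) = c m ∧ ContDiffAt ℝ ∞ s (e (ι m)) ∧ ∀ᶠ y in 𝓝 (e (ι m)),
        s y ∈ c.target ∧ ι (c.symm (s y)) = e.symm y ∧
          h.coord e y = (g.coord c (s y)).bilinearComp (fderiv ℝ s y) (fderiv ℝ s y) := by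
  set c := chartAt (E d) m
  have hc : c ∈ IsManifold.maximalAtlas (𝓡 (d + 1)) ∞ M := IsManifold.chart_mem_maximalAtlas m
  have hmc : m ∈ c.source := mem_chart_source _ m
  have hmt : c m ∈ c.target := c.map_source hmc
  have hmm : c.symm (c m) = m := c.left_inv hmc
  set Φ : E d → E d := e ∘ ι ∘ c.symm with hΦ
  have hΦm : Φ (c m) = e (ι m) := by rw [hΦ, Function.comp_apply, Function.comp_apply, hmm]
  have hιm : ι (c.symm (c m)) ∈ e.source := by rwa [hmm]
  have hs : ContDiffAt ℝ ∞ Φ (c m) := hι.contDiffAt_coord hc he hmt hιm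
  have hinj : Function.Injective (fderiv ℝ Φ (c m)) := by
    refine (injective_iff_map_eq_zero _).2 fun v hv => g.coord_nondegenerate hc hmt fun w => ?_
    rw [hι.coord_eq hc he hmt hιm, ← hΦ, hv, map_zero, _root_.zero_apply]
  let L : E d ≃L[ℝ] E d :=
    (LinearEquiv.ofInjectiveEndo (fderiv ℝ Φ (c m) : E d →ₗ[ℝ] E d) hinj).toContinuousLinearEquiv
  have hL : HasFDerivAt Φ (L : E d →L[ℝ] E d) (c m) := by
    have : (L : E d →L[ℝ] E d) = fderiv ℝ Φ (c m) := by ext v; rfl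
    rw [this]
    exact (hs.differentiableAt (by simp)).hasFDerivAt
  have h0 : (∞ : WithTop ℕ∞) ≠ 0 := by simp
  set s := hs.localInverse hL h0 with hsdef
  have hsm : s (e (ι m)) = c m := by rw [← hΦm]; exact hs.localInverse_apply_image hL h0
  have hss : ContDiffAt ℝ ∞ s (e (ι m)) := by rw [← hΦm]; exact hs.to_localInverse hL h0
  have hsr : ∀ᶠ y in 𝓝 (e (ι m)), Φ (s y) = y := by
    rw [← hΦm]; exact (hs.hasStrictFDerivAt' hL h0).eventually_right_inverse
  have hst : ∀ᶠ y in 𝓝 (e (ι m)), s y ∈ c.target ∧ ι (c.symm (s y)) ∈ e.source := by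
    have h1 : ContinuousAt (fun z => ι (c.symm z)) (c m) :=
      hι.embedding.contMDiff.continuous.continuousAt.comp (c.continuousAt_symm hmt)
    refine (hss.continuousAt.eventually (p := fun z => z ∈ c.target ∧ ι (c.symm z) ∈ e.source) ?_)
    rw [hsm]
    exact inter_mem (c.open_target.mem_nhds hmt) (h1.eventually (e.open_source.mem_nhds hιm))
  refine ⟨c, hc, hmc, s, hsm, hss, ?_⟩
  filter_upwards [hsr.eventually_nhds, hst,
    (hss.of_le (m := 1) (by simp)).eventually (by simp)] with y h1 ⟨h2, h3⟩ h4
  have h1y : Φ (s y) = y := h1.self_of_nhds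
  have hy : ι (c.symm (s y)) = e.symm y := by
    have : e.symm (Φ (s y)) = ι (c.symm (s y)) := e.left_inv h3
    rw [← this, h1y]
  refine ⟨h2, hy, ?_⟩
  have hd : (fderiv ℝ Φ (s y)).comp (fderiv ℝ s y) = ContinuousLinearMap.id ℝ (E d) := by
    rw [← fderiv_comp y ((hι.contDiffAt_coord hc he h2 h3).differentiableAt (by simp))
      (h4.differentiableAt (by simp)), Filter.EventuallyEq.fderiv_eq (f₁ := Φ ∘ s) (f := id) h1,
      fderiv_id]
  have hd' : ∀ v, fderiv ℝ Φ (s y) (fderiv ℝ s y v) = v := DFunLike.congr_fun hd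
  ext1 v; ext1 w
  rw [ContinuousLinearMap.bilinearComp_apply, hι.coord_eq hc he h2 h3, ← hΦ, h1y, hd', hd']

theorem IsExtension.contDiffAt_metric [IsManifold (𝓡 (d + 1)) ∞ M] (hι : IsExtension g h ι k a)
    (hg : g.IsSmooth)
    {e : OpenPartialHomeomorph N (E d)} (he : e ∈ IsManifold.maximalAtlas (𝓡 (d + 1)) ∞ N)
    {m : M} (hm : ι m ∈ e.source) : ContDiffAt ℝ ∞ (h.coord e) (e (ι m)) := by
  obtain ⟨c, hc, hmc, s, hsm, hs, heq⟩ := hι.exists_local_inverse he hm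
  refine ContDiffAt.congr_of_eventuallyEq ?_ (heq.mono fun y hy => hy.2.2)
  have hgs : ContDiffAt ℝ ∞ (fun y => g.coord c (s y)) (e (ι m)) := by
    refine ContDiffAt.comp (g := g.coord c) (e (ι m)) ?_ hs
    rw [hsm]
    exact (hg c hc).contDiffAt (c.open_target.mem_nhds (c.map_source hmc))
  have hds : ContDiffAt ℝ ∞ (fderiv ℝ s) (e (ι m)) := hs.fderiv_right (by simp)
  have hfl : ContDiff ℝ ∞ fun B : E d →L[ℝ] E d →L[ℝ] ℝ => B.flip :=
    (ContinuousLinearMap.flipₗᵢ ℝ (E d) (E d) ℝ).contDiff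
  exact hfl.contDiffAt.comp _ ((hfl.contDiffAt.comp _ (hgs.clm_comp hds)).clm_comp hds)

/-- The identification map between two extensions is, in charts, a smooth isometry. -/
theorem IsExtension.isometry_identMap {N₂ : Type*} [TopologicalSpace N₂] [ChartedSpace (E d) N₂]
    [IsManifold (𝓡 (d + 1)) ∞ M] [Nonempty M] {h₂ : LorentzMetric d N₂} {ι₂ : M → N₂} {k₂ : ℕ}
    {a₂ : Fin 2} (hι : IsExtension g h ι k a) (hι₂ : IsExtension g h₂ ι₂ k₂ a₂)
    {e : OpenPartialHomeomorph N (E d)} (he : e ∈ IsManifold.maximalAtlas (𝓡 (d + 1)) ∞ N)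
    {e₂ : OpenPartialHomeomorph N₂ (E d)}
    (he₂ : e₂ ∈ IsManifold.maximalAtlas (𝓡 (d + 1)) ∞ N₂) {m : M} (hm : ι m ∈ e.source)
    (hm₂ : ι₂ m ∈ e₂.source) {ψ : E d → E d}
    (hψ : ∀ᶠ y in 𝓝 (e (ι m)), ψ y = e₂ (identMap ι ι₂ (e.symm y))) :
    ψ (e (ι m)) = e₂ (ι₂ m) ∧ ContDiffAt ℝ ∞ ψ (e (ι m)) ∧ ∀ v w,
      h.coord e (e (ι m)) v w = h₂.coord e₂ (ψ (e (ι m))) (fderiv ℝ ψ (e (ι m)) v)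
        (fderiv ℝ ψ (e (ι m)) w) := by
  obtain ⟨c, hc, hmc, s, hsm, hs, heq⟩ := hι.exists_local_inverse he hm
  have hid : ∀ q, identMap ι ι₂ (ι q) = ι₂ q := fun q =>
    congrArg ι₂ (Function.leftInverse_invFun hι.embedding.isEmbedding.injective q)
  have hct : c m ∈ c.target := c.map_source hmc
  have hmm : c.symm (c m) = m := c.left_inv hmc
  have hm₂' : ι₂ (c.symm (c m)) ∈ e₂.source := by rwa [hmm]
  have hψs : ψ =ᶠ[𝓝 (e (ι m))] (e₂ ∘ ι₂ ∘ c.symm) ∘ s := by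
    filter_upwards [hψ, heq] with y h1 h2
    rw [h1, ← h2.2.1, hid]
    rfl
  have hΦ := hι₂.contDiffAt_coord hc he₂ hct hm₂'
  rw [← hsm] at hΦ
  have hval : ψ (e (ι m)) = e₂ (ι₂ m) := by
    rw [hψs.eq_of_nhds, Function.comp_apply, hsm, Function.comp_apply, Function.comp_apply, hmm]
  refine ⟨hval, (hΦ.comp _ hs).congr_of_eventuallyEq hψs, fun v w => ?_⟩
  have hd := hψs.fderiv_eq (𝕜 := ℝ)
  rw [fderiv_comp _ (hΦ.differentiableAt (by simp)) (hs.differentiableAt (by simp)), hsm] at hd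
  rw [heq.self_of_nhds.2.2, ContinuousLinearMap.bilinearComp_apply, hsm,
    hι₂.coord_eq hc he₂ hct hm₂', hd, hval]
  simp only [Function.comp_apply, hmm]
  rfl

end Coordinates

/-! ### Future boundary charts -/

theorem CkaAt.mono.{u} {E W : Type u} [NormedAddCommGroup E] [NormedSpace ℝ E]
    [NormedAddCommGroup W] [NormedSpace ℝ W] {k k' : ℕ} {a a' : Fin 2} {f : E → W} {x : E}
    (hf : CkaAt k' a' f x)
    (h : toLex (k, a) ≤ toLex (k', a')) : CkaAt k a f x := by
  rcases Prod.Lex.toLex_le_toLex.1 h with h | ⟨h1, h2⟩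
  · exact CkaAt.of_contDiffAt (hf.1.of_le
      (show ((k + 1 : ℕ) : WithTop ℕ∞) ≤ k' from Nat.cast_le.2 h))
  · obtain rfl : k = k' := h1
    exact ⟨hf.1, fun ha => hf.2 (le_antisymm (by omega) (by rw [← ha]; exact h2))⟩

theorem lipschitzWith_spatial {d : ℕ} : LipschitzWith 1 (spatial : E d → Fin d → ℝ) :=
  LipschitzWith.of_dist_le_mul fun x y => by
    rw [NNReal.coe_one, one_mul, dist_pi_le_iff dist_nonneg]
    intro i
    rw [dist_eq_norm, dist_eq_norm]
    exact PiLp.norm_apply_le (x - y) i.succ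

/-- The height above the graph of a Lipschitz function is Lipschitz, and decreases at unit speed in
the direction of `-x₀`. -/
theorem exists_lipschitzWith_height {d : ℕ} {f : (Fin d → ℝ) → ℝ} {L : NNReal}
    {S : Set (Fin d → ℝ)} (hf : LipschitzOnWith L f S) :
    ∃ (K : NNReal) (δ : E d → ℝ), LipschitzWith K δ ∧
      (∀ x t, δ (x - t • EuclideanSpace.single 0 1) = δ x - t) ∧
      ∀ x, spatial x ∈ S → δ x = x 0 - f (spatial x) := by
  obtain ⟨F, hF, hfF⟩ := hf.extend_real
  refine ⟨1 + L * 1, fun x => x 0 - F (spatial x), ?_, fun x t => ?_, fun x hx => ?_⟩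
  · refine LipschitzWith.sub (LipschitzWith.of_dist_le_mul fun x y => ?_)
      (hF.comp lipschitzWith_spatial)
    rw [NNReal.coe_one, one_mul, dist_eq_norm, dist_eq_norm]
    exact PiLp.norm_apply_le (x - y) 0
  · have : spatial (x - t • EuclideanSpace.single 0 1) = spatial x := by
      ext i
      simp [spatial]
    change (x - t • EuclideanSpace.single (0 : Fin (d + 1)) (1 : ℝ)) 0 - F _ = _
    rw [this]
    simp only [PiLp.sub_apply, PiLp.smul_apply, PiLp.single_apply, smul_eq_mul, if_true]
    ring
  · rw [hfF hx]

end SpacetimeExt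

open SpacetimeExt

theorem lemma5p8 {d : ℕ}
    {M : Type*} [TopologicalSpace M] [T2Space M] [SecondCountableTopology M]
    [ChartedSpace (SpacetimeExt.E d) M] [IsManifold (𝓡 (d + 1)) ∞ M] [Nonempty M]
    {N₁ : Type*} [TopologicalSpace N₁] [T2Space N₁] [SecondCountableTopology N₁]
    [ChartedSpace (SpacetimeExt.E d) N₁] [IsManifold (𝓡 (d + 1)) ∞ N₁]
    {N₂ : Type*} [TopologicalSpace N₂] [T2Space N₂] [SecondCountableTopology N₂]
    [ChartedSpace (SpacetimeExt.E d) N₂] [IsManifold (𝓡 (d + 1)) ∞ N₂]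
    -- the smooth, time-oriented, globally hyperbolic Lorentzian manifold `(M, g)`
    (g : SpacetimeExt.LorentzMetric d M) (hg : g.IsSmooth)
    (T : SpacetimeExt.TimeOrientation g) (hgh : SpacetimeExt.IsGloballyHyperbolic g)
    -- the two extensions
    (h₁ : SpacetimeExt.LorentzMetric d N₁) (h₂ : SpacetimeExt.LorentzMetric d N₂)
    (ι₁ : M → N₁) (ι₂ : M → N₂) (k₁ k₂ : ℕ) (a₁ a₂ : Fin 2)
    (hι₁ : SpacetimeExt.IsExtension g h₁ ι₁ k₁ a₁)
    (hι₂ : SpacetimeExt.IsExtension g h₂ ι₂ k₂ a₂)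
    -- the two future boundary charts
    (p₁ : N₁) (δ₁ ε₀₁ ε₁₁ : ℝ) (φ₁ : OpenPartialHomeomorph N₁ (SpacetimeExt.E d))
    (f₁ : (Fin d → ℝ) → ℝ)
    (hφ₁ : SpacetimeExt.IsFutureBoundaryChart g T h₁ ι₁ p₁ δ₁ φ₁ ε₀₁ ε₁₁ f₁)
    (p₂ : N₂) (δ₂ ε₀₂ ε₁₂ : ℝ) (φ₂ : OpenPartialHomeomorph N₂ (SpacetimeExt.E d))
    (f₂ : (Fin d → ℝ) → ℝ)
    (hφ₂ : SpacetimeExt.IsFutureBoundaryChart g T h₂ ι₂ p₂ δ₂ φ₂ ε₀₂ ε₁₂ f₂)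
    -- the open neighbourhoods of the centres
    (W₁ : Set N₁) (hW₁ : IsOpen W₁) (hpW₁ : p₁ ∈ W₁) (hWU₁ : W₁ ⊆ φ₁.source)
    (W₂ : Set N₂) (hW₂ : IsOpen W₂) (hpW₂ : p₂ ∈ W₂) (hWU₂ : W₂ ⊆ φ₂.source)
    -- the identification map (which is smooth with smooth inverse on the image of `M`)
    -- is a bijection, hence a diffeomorphism, of the parts below the graphs
    (hid : BijOn (SpacetimeExt.identMap ι₁ ι₂)
      (W₁ ∩ SpacetimeExt.below φ₁ f₁) (W₂ ∩ SpacetimeExt.below φ₂ f₂))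
    -- `J` is its extension to the parts on or below the graphs, and it is of class `C^1`
    (J : N₁ → N₂)
    (hJ : MapsTo J (W₁ ∩ SpacetimeExt.belowEq φ₁ f₁) (W₂ ∩ SpacetimeExt.belowEq φ₂ f₂))
    (hJid : EqOn J (SpacetimeExt.identMap ι₁ ι₂) (W₁ ∩ SpacetimeExt.below φ₁ f₁))
    (hJC1 : SpacetimeExt.CkaLocOnSet 1 0 (φ₂ ∘ J ∘ φ₁.symm)
      (φ₁ '' (W₁ ∩ SpacetimeExt.belowEq φ₁ f₁))) :
    SpacetimeExt.CkaLocOnSet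
      ((SpacetimeExt.minReg k₁ a₁ k₂ a₂).1 + 1) (SpacetimeExt.minReg k₁ a₁ k₂ a₂).2
      (φ₂ ∘ J ∘ φ₁.symm) (φ₁ '' (W₁ ∩ SpacetimeExt.belowEq φ₁ f₁)) := by

  set ψ : E d → E d := φ₂ ∘ J ∘ φ₁.symm with hψdef
  set A : Set (E d) := φ₁ '' (W₁ ∩ belowEq φ₁ f₁) with hAdef
  obtain ⟨L, hL⟩ := hφ₁.lipschitz
  obtain ⟨K, δ, hδL, hδe, hδ⟩ := exists_lipschitzWith_height hL
  obtain ⟨C, -, hsub⟩ := hφ₁.below_subset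
  have hδt : ∀ x ∈ φ₁.target, δ x = x 0 - f₁ (spatial x) := fun x hx =>
    hδ x (by rw [hφ₁.target_eq] at hx; exact hx.2)
  -- in coordinates, the domain of `ψ` is the part of the open set `V` where the height `δ` is `≤ 0`
  set V : Set (E d) := φ₁.target ∩ φ₁.symm ⁻¹' W₁ with hVdef
  have hV : IsOpen V := φ₁.isOpen_inter_preimage_symm hW₁
  have hA : A = V ∩ {x | δ x ≤ 0} := by
    ext x
    constructor
    · rintro ⟨q, ⟨hqW, hqs, hqf⟩, rfl⟩
      refine ⟨⟨φ₁.map_source hqs, ?_⟩, ?_⟩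
      · change φ₁.symm (φ₁ q) ∈ W₁
        rwa [φ₁.left_inv hqs]
      · change δ (φ₁ q) ≤ 0
        rw [hδt _ (φ₁.map_source hqs)]
        linarith
    · rintro ⟨⟨hxt, hxW⟩, hx⟩
      change δ x ≤ 0 at hx
      rw [hδt x hxt] at hx
      refine ⟨φ₁.symm x, ⟨hxW, φ₁.map_target hxt, ?_⟩, φ₁.right_inv hxt⟩
      rw [φ₁.right_inv hxt]
      linarith
  have hmemb : ∀ x ∈ V, δ x < 0 → φ₁.symm x ∈ W₁ ∩ below φ₁ f₁ := by
    rintro x ⟨hxt, hxW⟩ hx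
    rw [hδt x hxt] at hx
    refine ⟨hxW, φ₁.map_target hxt, ?_⟩
    rw [φ₁.right_inv hxt]
    linarith
  have hmembe : ∀ x ∈ A, φ₁.symm x ∈ W₁ ∩ belowEq φ₁ f₁ := by
    rintro _ ⟨q, hq, rfl⟩
    rwa [φ₁.left_inv hq.2.1]
  -- below the graph, the map `ψ` is the identification map in coordinates
  have hlocal : ∀ x ∈ V, δ x < 0 → (ContDiffAt ℝ ∞ ψ x ∧ ContDiffAt ℝ ∞ (h₁.coord φ₁) x ∧
      ContDiffAt ℝ ∞ (h₂.coord φ₂) (ψ x)) ∧ ∀ v w, h₁.coord φ₁ x v w =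
        h₂.coord φ₂ (ψ x) (fderiv ℝ ψ x v) (fderiv ℝ ψ x w) := by
    intro x hxV hx
    obtain ⟨m, -, hm⟩ := hsub (hmemb x hxV hx).2
    obtain rfl : φ₁ (ι₁ m) = x := by rw [hm, φ₁.right_inv hxV.1]
    have hms : ι₁ m ∈ φ₁.source := by rw [hm]; exact φ₁.map_target hxV.1
    have hev : ∀ᶠ y in 𝓝 (φ₁ (ι₁ m)), ψ y = φ₂ (identMap ι₁ ι₂ (φ₁.symm y)) := by
      filter_upwards [hV.mem_nhds hxV, hδL.continuous.continuousAt.eventually_lt_const hx]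
        with y hy1 hy2
      exact congrArg φ₂ (hJid (hmemb y hy1 hy2))
    have hm₂ : ι₂ m ∈ φ₂.source := by
      have h1 := (hid.mapsTo (hmemb _ hxV hx)).2.1
      rwa [← hm, show identMap ι₁ ι₂ (ι₁ m) = ι₂ m from congrArg ι₂
        (Function.leftInverse_invFun hι₁.embedding.isEmbedding.injective m)] at h1
    obtain ⟨h1, h2, h3⟩ := hι₁.isometry_identMap hι₂ hφ₁.chart hφ₂.chart hms hm₂ hev
    refine ⟨⟨h2, hι₁.contDiffAt_metric hg hφ₁.chart hms, ?_⟩, h3⟩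
    rw [h1]
    exact hι₂.contDiffAt_metric hg hφ₂.chart hm₂
  have hreg₁ : ∀ y ∈ φ₁.target, CkaAt (minReg k₁ a₁ k₂ a₂).1 (minReg k₁ a₁ k₂ a₂).2
      (h₁.coord φ₁) y := fun y hy =>
    ((ckaLocOn_iff φ₁.open_target).1 (hι₁.regular φ₁ hφ₁.chart) y hy).mono (min_le_left _ _)
  have hreg₂ : ∀ y ∈ φ₂.target, CkaAt (minReg k₁ a₁ k₂ a₂).1 (minReg k₁ a₁ k₂ a₂).2
      (h₂.coord φ₂) y := fun y hy =>
    ((ckaLocOn_iff φ₂.open_target).1 (hι₂.regular φ₂ hφ₂.chart) y hy).mono (min_le_right _ _)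
  obtain ⟨O, F, hO, hAO, hF, hFψ⟩ := hJC1
  refine ckaLocOnSet_of_local fun p hp => ?_
  have hpV : p ∈ V := (hA ▸ hp).1
  have hpδ : δ p ≤ 0 := (hA ▸ hp).2
  have hnA : 𝓝[A] p = 𝓝[{x | δ x ≤ 0}] p := by
    rw [hA, inter_comm]
    exact nhdsWithin_inter_of_mem' (mem_nhdsWithin_of_mem_nhds (hV.mem_nhds hpV))
  have hψ : ContDiffWithinAt ℝ 1 ψ {x | δ x ≤ 0} p := by
    have h1 : ContDiffAt ℝ 1 F p := hF.1.contDiffAt (hO.mem_nhds (hAO hp))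
    refine h1.contDiffWithinAt.congr_of_eventuallyEq ?_ (hFψ hp).symm
    rw [← hnA]
    filter_upwards [self_mem_nhdsWithin] with x hx using (hFψ hx).symm
  have hI : IsIsometryBelow δ (h₁.coord φ₁) (h₂.coord φ₂) ψ p :=
    { smooth := by filter_upwards [hV.mem_nhds hpV] with x hx hx0 using (hlocal x hx hx0).1
      isometry := by filter_upwards [hV.mem_nhds hpV] with x hx hx0 using (hlocal x hx hx0).2
      nondegenerate := by
        filter_upwards [hV.mem_nhds hpV] with x hx v using
          h₁.coord_nondegenerate hφ₁.chart hx.1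
      symm := h₂.coord_symm φ₂ }
  rw [hnA]
  exact hI.exists_extension hδL hδe (by simp) hpδ (hreg₁ p hpV.1)
    (hreg₂ _ (φ₂.map_source (hJ (hmembe p hp)).2.1)) hψ
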